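/- **Notation.** A *2-colored rooted tree* $X=(V,E,\mathrm{rt},V_\bullet)$ is a finite tree $(V,E)$ with a root $\mathrm{rt}\in V$ and a set $V_\bullet\subset V$ of *black* vertices containing all terminals (vertices of degree $1$); the other vertices are *white*. An *index* on $X$ is a family $\boldsymbol k=(k_e)_{e\in E}\in\mathbb Z_{\ge 0}^E$. Let $P(v,v')$ be the path from $v$ to $v'$ and $k_{P(v,v')}=\sum_{e\in P(v,v')}k_e$. The index is *essentially positive* if $k_{P(v,v')}>0$ for all distinct $v,v'\in V_\bullet$. Let $2\mathrm{CRT}$ be the $\mathbb Q$-vector space with basis the isomorphism classes of pairs $(X,\boldsymbol k)$ with $\mathrm{rt}\in V_\bullet$ and $\boldsymbol k$ essentially positive, and let $\Phi\colon 2\mathrm{CRT}\to 2\mathrm{CRT}$ be the $\mathbb Q$-linear map $\Phi(X,\boldsymbol k)=\sum_{v\in V_\bullet}(-1)^{k_{P(\mathrm{rt},v)}}(X_v,\boldsymbol k)$, where $X_v=(V,E,v,V_\bullet)$. A *branched point* is a vertex of degree at least $3$. A pair $(X,\boldsymbol k)$ is *harvestable* if the root is a terminal, all white vertices and no black vertices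 are branched points, $k_{\{v,u\}}>0$ whenever a white vertex $v$ is the parent of $u$, and $k_{\{u,v\}}>0$ whenever $u,v$ are adjacent black vertices. A *harvestable form* $(X_{\mathrm h},\boldsymbol k_{\mathrm h})$ of $(X,\boldsymbol k)$ is a result of the following procedure. (i) Contract an edge of index $0$ with a white end, the new vertex being black if one of the two ends is black, as long as there is such an edge. (ii) Delete a white vertex of degree $2$ and join its two edges to one edge, whose index is the sum of the two indices, as long as there is such a vertex. (iii) At a black branched point $v\ne\mathrm{rt}$, insert a new white vertex $v'$ and an edge $\{v,v'\}$ of index $0$, and replace $\{v,u\}$ by $\{v',u\}$ (with the same index) for each child $u$ of $v$, as long as there is such a $v$. (iv) If the root is not a terminal, insert a new white vertex and an edge at the root in the same way. Let $\mathfrak H=\mathbb Q\langle x,y\rangle$, let $\mathfrak H^1=\mathbb Q+y\mathfrak H$, which has the basis of the elements $z_{k_1}\cdots z_{k_r}$ with $r\ge 0$, $k_i\ge 1$ and $z_k=yx^{k-1}$, and let $ш$ be the shuffle product on $\mathfrak H$. Let $\phi\colon\mathfrak H^1\to\mathfrak H^1$ be the $\mathbb Q$-linear map $$\phi(z_{k_1}\cdots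 z_{k_r})=\sum_{i=0}^r(-1)^{k_{i+1}+\cdots+k_r}\,z_{k_1}\cdots z_{k_i}\; ш\; z_{k_r}\cdots z_{k_{i+1}} .$$ For a harvestable pair, $w(X,\boldsymbol k)\in\mathfrak H^1$ is defined inductively. If, starting from the root, $X$ consists of black vertices $\mathrm{rt}=v_{r+1},v_r,\dots,v_1$ only, with index $k_a$ on $\{v_a,v_{a+1}\}$, then $w(X,\boldsymbol k)=z_{k_1}\cdots z_{k_r}$. If $v_1$ is followed by an edge of index $k'$ to a white vertex $v_0$ with children $u_1,\dots,u_s$, then $w(X,\boldsymbol k)=(w_1\,ш\cdots ш\, w_s)\,x^{k'}z_{k_1}\cdots z_{k_r}$, where $w_j$ is the element of the pair obtained from the part of the tree formed by $v_0$, $u_j$ and the descendants of $u_j$ by making $v_0$ its black root. **Proposition.** Let $X=(V,E,\mathrm{rt},V_\bullet)$ be a 2-colored rooted tree with $\mathrm{rt}\in V_\bullet$ and $\boldsymbol k$ an essentially positive index on $X$. Suppose that 1. there are an edge $f\in E$ and decompositions $V=V_1\sqcup V_2$, $E=E_1\sqcup E_2\sqcup\{f\}$, $V_\bullet=V_{1,\bullet}\sqcup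 V_{2,\bullet}$, where $V_{i,\bullet}\subset V_i$ and the edges in $E_i$ have both ends in $V_i$; 2. $\mathrm{rt}\in V_{1,\bullet}$, and there is an isomorphism $F\colon(V_1,E_1,\mathrm{rt})\to(V_2,E_2,F(\mathrm{rt}))$ of rooted trees such that, for $v\in V_1$, $v\in V_{1,\bullet}$ if and only if $F(v)\in V_{2,\bullet}$; 3. $f=\{u,F(u)\}$ for some $u\in V_1$; 4. $k_f$ is odd, and $k_{\{a,b\}}=k_{\{F(a),F(b)\}}$ for all $\{a,b\}\in E_1$. Then $\Phi(X,\boldsymbol k)=0$ in $2\mathrm{CRT}$. Moreover $(X,\boldsymbol k)$ has a harvestable form which is a harvestable pair, and $\phi\bigl(w(X_{\mathrm h},\boldsymbol k_{\mathrm h})\bigr)=0$ for every such form $(X_{\mathrm h},\boldsymbol k_{\mathrm h})$. -/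

import Mathlib

universe u

/-! ## The algebra `ℚ⟨x, y⟩`, the shuffle product and the symmetrization map -/

/-- The two letters of the alphabet. -/
inductive Letter : Type
  | x : Letter
  | y : Letter

/-- The non-commutative polynomial ring `ℚ⟨x, y⟩`. -/
abbrev HAlg : Type := FreeAlgebra ℚ Letter

noncomputable section

namespace HAlg

/-- The variable given by a letter. -/
def letter (u : Letter) : HAlg := FreeAlgebra.ι ℚ u

/-- The variable `x`. -/
def X : HAlg := letter Letter.x

/-- The variable `y`. -/
def Y : HAlg := letter Letter.y

/-- The monomial given by a word. -/
def word (a : List Letter) : HAlg := (a.map letter).prod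

/-- The basis of `ℚ⟨x, y⟩` consisting of the monomials. -/
def wordBasis : Module.Basis (List Letter) ℚ HAlg :=
  (FreeAlgebra.basisFreeMonoid ℚ Letter).reindex FreeMonoid.toList

theorem wordBasis_apply (a : List Letter) : wordBasis a = word a := by
  simp only [wordBasis, Module.Basis.reindex_apply, FreeAlgebra.basisFreeMonoid,
    Module.Basis.map_apply, word]
  simp [FreeAlgebra.equivMonoidAlgebraFreeMonoid, MonoidAlgebra.lift_apply, FreeMonoid.lift_apply]
  rfl

theorem word_append_singleton (a : List Letter) (u : Letter) :
    word (a ++ [u]) = word a * letter u := by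
  simp [word]

/-- The shuffle product of two words, both given by their reversals (last letter first):
`(a₁u₁) ⧢ (a₂u₂) = (a₁ ⧢ a₂u₂)u₁ + (a₁u₁ ⧢ a₂)u₂`. -/
def shRev : List Letter → List Letter → HAlg
  | [], b => word b.reverse
  | a, [] => word a.reverse
  | u₁ :: a₁, u₂ :: a₂ =>
      shRev a₁ (u₂ :: a₂) * letter u₁ + shRev (u₁ :: a₁) a₂ * letter u₂
termination_by a b => a.length + b.length

/-- The shuffle product `⧢` on `ℚ⟨x, y⟩`, as a `ℚ`-bilinear map. -/
def sh : HAlg →ₗ[ℚ] HAlg →ₗ[ℚ] HAlg :=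
  wordBasis.constr ℚ fun a => wordBasis.constr ℚ fun b => shRev a.reverse b.reverse

theorem sh_word (a b : List Letter) : sh (word a) (word b) = shRev a.reverse b.reverse := by
  rw [← wordBasis_apply, ← wordBasis_apply, sh, Module.Basis.constr_basis,
    Module.Basis.constr_basis]

/-- The recursive rule that defines the shuffle product. -/
theorem sh_word_rule (a₁ a₂ : List Letter) (u₁ u₂ : Letter) :
    sh (word a₁ * letter u₁) (word a₂ * letter u₂)
      = sh (word a₁) (word a₂ * letter u₂) * letter u₁
        + sh (word a₁ * letter u₁) (word a₂) * letter u₂ := by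
  simp only [← word_append_singleton, sh_word, List.reverse_append, List.reverse_singleton,
    List.singleton_append]
  rw [shRev]

theorem sh_one_right (a : HAlg) : sh a 1 = a := by
  have h1 : (1 : HAlg) = word [] := by simp [word]
  have : sh.flip 1 = LinearMap.id := by
    apply wordBasis.ext
    intro a
    rw [LinearMap.flip_apply, wordBasis_apply, h1, sh_word]
    rcases h : a.reverse with _ | ⟨u, b⟩
    · simp at h; subst h; simp [shRev]
    · rw [List.reverse_nil, shRev, ← h, List.reverse_reverse]
      · rfl
      · simp
  exact LinearMap.congr_fun this a

theorem sh_one_left (a : HAlg) : sh 1 a = a := by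
  have h1 : (1 : HAlg) = word [] := by simp [word]
  have : sh 1 = LinearMap.id := by
    apply wordBasis.ext
    intro a
    rw [wordBasis_apply, h1, sh_word, List.reverse_nil, shRev, List.reverse_reverse]
    rfl
  exact LinearMap.congr_fun this a

/-- The iterated shuffle product `w₁ ⧢ ⋯ ⧢ wₛ` (equal to `1` for `s = 0`). -/
def shList (l : List HAlg) : HAlg := l.foldr (fun a b => sh a b) 1

/-- The subspace `y ℚ⟨x, y⟩`. -/
def yH : Submodule ℚ HAlg := LinearMap.range (LinearMap.mulLeft ℚ Y)

/-- The subspace `𝔥¹ = ℚ + y ℚ⟨x, y⟩`. -/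
def H1 : Submodule ℚ HAlg := Submodule.span ℚ {1} ⊔ yH

/-- The element `z_k = y x ^ (k - 1)`, for `k ≥ 1`. -/
def z (k : ℕ) : HAlg := Y * X ^ (k - 1)

/-- The element `z_{k₁} ⋯ z_{k_r}` for an index `(k₁, …, k_r)` of positive integers. -/
def zMon (l : List ℕ+) : HAlg := (l.map fun k : ℕ+ => z (k : ℕ)).prod

theorem one_mem_H1 : (1 : HAlg) ∈ H1 :=
  Submodule.mem_sup_left (Submodule.mem_span_singleton_self 1)

theorem yH_le_H1 : yH ≤ H1 := le_sup_right

theorem mul_mem_yH {a : HAlg} (ha : a ∈ yH) (b : HAlg) : a * b ∈ yH := by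
  obtain ⟨c, rfl⟩ := ha
  exact ⟨c * b, by simp [mul_assoc]⟩

theorem Y_mul_mem_yH (b : HAlg) : Y * b ∈ yH := ⟨b, by simp⟩

theorem mul_z_mem_yH {a : HAlg} (ha : a ∈ H1) (k : ℕ) : a * z k ∈ yH := by
  obtain ⟨b, hb, c, hc, rfl⟩ := Submodule.mem_sup.1 ha
  obtain ⟨r, rfl⟩ := Submodule.mem_span_singleton.1 hb
  rw [add_mul, smul_mul_assoc, one_mul]
  exact yH.add_mem (yH.smul_mem _ (Y_mul_mem_yH _)) (mul_mem_yH hc _)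

theorem zMon_mem_H1 (l : List ℕ+) : zMon l ∈ H1 := by
  cases l with
  | nil => simpa [zMon] using one_mem_H1
  | cons k l =>
    rw [zMon, List.map_cons, List.prod_cons, z, mul_assoc]
    exact yH_le_H1 (Y_mul_mem_yH _)

/-- The words not beginning with `x`. -/
def Adm (a : List Letter) : Prop := a = [] ∨ ∃ b, a = Letter.y :: b

theorem word_mem_yH (b : List Letter) : word (Letter.y :: b) ∈ yH := by
  rw [word, List.map_cons, List.prod_cons]
  exact Y_mul_mem_yH _

theorem Adm.word_mem {a : List Letter} (ha : Adm a) : word a ∈ H1 := by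
  rcases ha with rfl | ⟨b, rfl⟩
  · simpa [word] using one_mem_H1
  · exact yH_le_H1 (word_mem_yH b)

theorem Adm.word_mem' {a : List Letter} (ha : Adm a) (h : a ≠ []) : word a ∈ yH := by
  rcases ha with rfl | ⟨b, rfl⟩
  · exact absurd rfl h
  · exact word_mem_yH b

theorem Adm.prefix {a : List Letter} {u : Letter} (h : Adm (a ++ [u])) : Adm a := by
  rcases a with _ | ⟨v, a⟩
  · exact Or.inl rfl
  · rcases h with h | ⟨b, h⟩
    · simp at h
    · simp at h
      exact Or.inr ⟨a, by rw [h.1]⟩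

theorem shRev_mem (a b : List Letter) (ha : Adm a.reverse) (hb : Adm b.reverse)
    (h : a ≠ [] ∨ b ≠ []) : shRev a b ∈ yH := by
  match a, b with
  | [], b =>
    rw [shRev]
    exact hb.word_mem' (by simpa using h)
  | u₁ :: a₁, [] =>
    rw [shRev]
    · exact ha.word_mem' (by simp)
    · simp
  | u₁ :: a₁, u₂ :: a₂ =>
    rw [shRev]
    have h1 : Adm a₁.reverse := by rw [List.reverse_cons] at ha; exact ha.prefix
    have h2 : Adm a₂.reverse := by rw [List.reverse_cons] at hb; exact hb.prefix
    exact yH.add_mem (mul_mem_yH (shRev_mem a₁ (u₂ :: a₂) h1 hb (by simp)) _)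
      (mul_mem_yH (shRev_mem (u₁ :: a₁) a₂ ha h2 (by simp)) _)
termination_by a.length + b.length

/-- `y ℚ⟨x, y⟩` is spanned by the words beginning with `y`. -/
theorem yH_eq_span : yH = Submodule.span ℚ (Set.range fun b => word (Letter.y :: b)) := by
  rw [yH, LinearMap.range_eq_map, ← wordBasis.span_eq, Submodule.map_span, ← Set.range_comp]
  congr 2
  funext b
  simp [wordBasis_apply, word, Y]

theorem sh_mem_yH {a b : HAlg} (ha : a ∈ yH) (hb : b ∈ yH) : sh a b ∈ yH := by
  rw [yH_eq_span] at ha hb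
  refine Submodule.span_induction₂ (p := fun a b _ _ => sh a b ∈ yH) ?_ ?_ ?_ ?_ ?_ ?_ ?_ ha hb
  · rintro _ _ ⟨a, rfl⟩ ⟨b, rfl⟩
    rw [sh_word]
    exact shRev_mem _ _ (by simp [Adm]) (by simp [Adm]) (by simp)
  · intro y _; simp
  · intro x _; simp
  · intro x y w _ _ _ h1 h2; simpa using yH.add_mem h1 h2
  · intro x y w _ _ _ h1 h2; simpa using yH.add_mem h1 h2
  · intro r x y _ _ h; simpa using yH.smul_mem r h
  · intro r x y _ _ h; simpa using yH.smul_mem r h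

/-- `𝔥¹` is closed under the shuffle product. -/
theorem sh_mem_H1 {a b : HAlg} (ha : a ∈ H1) (hb : b ∈ H1) : sh a b ∈ H1 := by
  obtain ⟨a₀, ha₀, a₁, ha₁, rfl⟩ := Submodule.mem_sup.1 ha
  obtain ⟨r, rfl⟩ := Submodule.mem_span_singleton.1 ha₀
  obtain ⟨b₀, hb₀, b₁, hb₁, rfl⟩ := Submodule.mem_sup.1 hb
  obtain ⟨s, rfl⟩ := Submodule.mem_span_singleton.1 hb₀
  have h1 : sh a₁ (s • (1 : HAlg) + b₁) ∈ H1 := by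
    rw [map_add, map_smul, sh_one_right]
    exact H1.add_mem (H1.smul_mem _ (yH_le_H1 ha₁)) (yH_le_H1 (sh_mem_yH ha₁ hb₁))
  rw [map_add sh, LinearMap.add_apply, map_smul sh, LinearMap.smul_apply, sh_one_left]
  exact H1.add_mem (H1.smul_mem _ hb) h1

theorem shList_mem {l : List HAlg} (h : ∀ a ∈ l, a ∈ yH) :
    shList l ∈ H1 ∧ (l ≠ [] → shList l ∈ yH) := by
  induction l with
  | nil => exact ⟨one_mem_H1, fun h => absurd rfl h⟩
  | cons a l ih =>
    have key : shList (a :: l) ∈ yH := by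
      have ha : a ∈ yH := h a (by simp)
      have ih' := ih fun b hb => h b (by simp [hb])
      by_cases hl : l = []
      · subst hl
        simpa [shList, sh_one_right] using ha
      · exact sh_mem_yH ha (ih'.2 hl)
    exact ⟨yH_le_H1 key, fun _ => key⟩

/-- The word of `z_{k₁} ⋯ z_{k_r}`. -/
def zWord : List ℕ+ → List Letter
  | [] => []
  | k :: l => Letter.y :: (List.replicate ((k : ℕ) - 1) Letter.x ++ zWord l)

theorem zMon_eq_word (l : List ℕ+) : zMon l = word (zWord l) := by
  induction l with
  | nil => simp [zMon, word, zWord]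
  | cons k l ih =>
    have : zMon (k :: l) = z k * zMon l := by simp [zMon]
    rw [this, ih]
    simp [word, zWord, z, X, Y, mul_assoc]

theorem zWord_replicate_inj (m n : ℕ) (l l' : List ℕ+)
    (h : List.replicate m Letter.x ++ zWord l = List.replicate n Letter.x ++ zWord l') :
    m = n ∧ zWord l = zWord l' := by
  induction m generalizing n with
  | zero =>
    cases n with
    | zero => simpa using h
    | succ n => cases l <;> simp [zWord, List.replicate_succ] at h
  | succ m ih =>
    cases n with
    | zero => cases l' <;> simp [zWord, List.replicate_succ] at h
    | succ n =>
      simp only [List.replicate_succ, List.cons_append, List.cons.injEq, true_and] at h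
      obtain ⟨h1, h2⟩ := ih n h
      exact ⟨by rw [h1], h2⟩

theorem zWord_injective : Function.Injective zWord := by
  intro l
  induction l with
  | nil => intro l' h; cases l' <;> simp_all [zWord]
  | cons k l ih =>
    intro l' h
    cases l' with
    | nil => simp [zWord] at h
    | cons k' l' =>
      simp only [zWord, List.cons.injEq, true_and] at h
      obtain ⟨h1, h2⟩ := zWord_replicate_inj _ _ _ _ h
      have hk : k = k' := by
        have := k.pos; have := k'.pos
        exact PNat.eq (by omega)
      rw [hk, ih h2]

theorem exists_zWord (b : List Letter) : ∃ l, zWord l = Letter.y :: b := by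
  suffices h : ∀ b : List Letter, ∃ (n : ℕ) (l : List ℕ+),
      b = List.replicate n Letter.x ++ zWord l by
    obtain ⟨n, l, rfl⟩ := h b
    exact ⟨⟨n + 1, n.succ_pos⟩ :: l, by simp [zWord]⟩
  intro b
  induction b with
  | nil => exact ⟨0, [], by simp [zWord]⟩
  | cons u b ih =>
    obtain ⟨n, l, rfl⟩ := ih
    cases u with
    | x => exact ⟨n + 1, l, by simp [List.replicate_succ]⟩
    | y => exact ⟨0, ⟨n + 1, n.succ_pos⟩ :: l, by simp [zWord]⟩

/-- The basis of `𝔥¹` consisting of the elements `z_{k₁} ⋯ z_{k_r}`. -/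
def zBasis : Module.Basis (List ℕ+) ℚ H1 :=
  Module.Basis.mk (v := fun l => (⟨zMon l, zMon_mem_H1 l⟩ : H1))
    (by
      apply LinearIndependent.of_comp H1.subtype
      have h := wordBasis.linearIndependent.comp zWord zWord_injective
      convert h using 1
      funext l
      simp [wordBasis_apply, zMon_eq_word])
    (by
      rintro ⟨a, ha⟩ -
      have hle : H1 ≤ Submodule.span ℚ (Set.range zMon) := by
        rw [H1, yH_eq_span]
        refine sup_le (Submodule.span_mono ?_) (Submodule.span_mono ?_)
        · rintro _ rfl
          exact ⟨[], by simp [zMon]⟩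
        · rintro _ ⟨b, rfl⟩
          obtain ⟨l, hl⟩ := exists_zWord b
          exact ⟨l, by rw [zMon_eq_word, hl]⟩
      have h2 : Submodule.map H1.subtype
          (Submodule.span ℚ (Set.range fun l => (⟨zMon l, zMon_mem_H1 l⟩ : H1)))
            = Submodule.span ℚ (Set.range zMon) := by
        rw [Submodule.map_span, ← Set.range_comp]
        rfl
      have h3 := hle ha
      rw [← h2] at h3
      obtain ⟨b, hb, hba⟩ := h3
      have : b = ⟨a, ha⟩ := Subtype.ext hba
      exact this ▸ hb)

/-- The symmetrization map `φ : 𝔥¹ → 𝔥¹`,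
`φ(z_{k₁} ⋯ z_{k_r}) = ∑_{i=0}^{r} (-1)^{k_{i+1} + ⋯ + k_r}
  z_{k₁} ⋯ z_{k_i} ⧢ z_{k_r} ⋯ z_{k_{i+1}}`. -/
def phi : H1 →ₗ[ℚ] H1 :=
  zBasis.constr ℚ fun l => ∑ i ∈ Finset.range (l.length + 1),
    (-1 : ℚ) ^ ((l.drop i).map fun k : ℕ+ => (k : ℕ)).sum •
      ⟨sh (zMon (l.take i)) (zMon (l.drop i).reverse),
        sh_mem_H1 (zMon_mem_H1 _) (zMon_mem_H1 _)⟩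

end HAlg

/-! ## 2-colored rooted trees -/

/-- A 2-colored rooted tree: a finite tree with a root and a set `black` of vertices that contains
all terminals, that is, all vertices of degree one. -/
structure TwoColoredRootedTree : Type (u + 1) where
  /-- The vertices. -/
  V : Type u
  [fintypeV : Fintype V]
  /-- The underlying graph. -/
  graph : SimpleGraph V
  isTree : graph.IsTree
  /-- The root. -/
  root : V
  /-- The black vertices; the other vertices are white. -/
  black : Set V
  terminal_black : ∀ v, (graph.neighborSet v).ncard = 1 → v ∈ black

attribute [instance] TwoColoredRootedTree.fintypeV

namespace TwoColoredRootedTree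

/-- The degree of a vertex. -/
def deg (X : TwoColoredRootedTree.{u}) (v : X.V) : ℕ := (X.graph.neighborSet v).ncard

/-- An index on `X`: a family of non-negative integers indexed by the edges. -/
abbrev Index (X : TwoColoredRootedTree.{u}) : Type u := X.graph.edgeSet → ℕ

/-- The path `P(v, w)`. -/
def path (X : TwoColoredRootedTree.{u}) (v w : X.V) : X.graph.Walk v w :=
  (X.isTree.existsUnique_path v w).choose

theorem path_isPath (X : TwoColoredRootedTree.{u}) (v w : X.V) : (X.path v w).IsPath :=
  (X.isTree.existsUnique_path v w).choose_spec.1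

theorem path_unique (X : TwoColoredRootedTree.{u}) {v w : X.V} (p : X.graph.Walk v w)
    (hp : p.IsPath) : p = X.path v w :=
  (X.isTree.existsUnique_path v w).choose_spec.2 p hp

/-- The sum `k_{P(v, w)}` of the index over the edges of the path `P(v, w)`. -/
def pathSum (X : TwoColoredRootedTree.{u}) (k : X.Index) (v w : X.V) : ℕ :=
  ((X.path v w).darts.map fun d => k ⟨d.edge, d.edge_mem⟩).sum

/-- An index is essentially positive if `k_{P(v, w)} > 0` for distinct black vertices `v, w`. -/
def EssentiallyPositive (X : TwoColoredRootedTree.{u}) (k : X.Index) : Prop :=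
  ∀ v ∈ X.black, ∀ w ∈ X.black, v ≠ w → 0 < X.pathSum k v w

/-- The tree `X_v`, obtained from `X` by changing the root to `v`. -/
def reroot (X : TwoColoredRootedTree.{u}) (v : X.V) : TwoColoredRootedTree.{u} :=
  { X with root := v }

/-- `p` is the parent of `v`: the edge `{p, v}` belongs to the path from the root to `v`. -/
def IsParent (X : TwoColoredRootedTree.{u}) (p v : X.V) : Prop :=
  s(p, v) ∈ (X.path X.root v).edges

theorem IsParent.adj {X : TwoColoredRootedTree.{u}} {p v : X.V} (h : X.IsParent p v) :
    X.graph.Adj p v :=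
  (X.path X.root v).adj_of_mem_edges h

theorem IsParent.eq_penultimate {X : TwoColoredRootedTree.{u}} {p v : X.V}
    (h : X.IsParent p v) : p = (X.path X.root v).penultimate :=
  (X.path_isPath X.root v).eq_penultimate_of_mem_edges (by rw [Sym2.eq_swap]; exact h)

theorem IsParent.unique {X : TwoColoredRootedTree.{u}} {p q v : X.V}
    (h : X.IsParent p v) (h' : X.IsParent q v) : p = q := by
  rw [h.eq_penultimate, h'.eq_penultimate]

open Classical in
/-- The children of a vertex. -/
def children (X : TwoColoredRootedTree.{u}) (v : X.V) : Finset X.V :=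
  Finset.univ.filter fun c => X.IsParent v c

theorem mem_children {X : TwoColoredRootedTree.{u}} {v c : X.V} :
    c ∈ X.children v ↔ X.IsParent v c := by
  simp [children]

theorem IsParent.length {X : TwoColoredRootedTree.{u}} {p v : X.V} (h : X.IsParent p v) :
    (X.path X.root v).length = (X.path X.root p).length + 1 := by
  have hnil : ¬ (X.path X.root v).Nil := by
    intro hn
    have := SimpleGraph.Walk.edges_eq_nil.2 hn
    rw [IsParent, this] at h
    simp at h
  obtain rfl := h.eq_penultimate
  have hp : (X.path X.root v).dropLast.IsPath := (X.path_isPath X.root v).dropLast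
  rw [← X.path_unique _ hp]
  exact (SimpleGraph.Walk.length_dropLast_add_one hnil).symm

theorem path_length_lt (X : TwoColoredRootedTree.{u}) (v w : X.V) :
    (X.path v w).length < Fintype.card X.V :=
  (X.path_isPath v w).length_lt

/-- Of two adjacent vertices, one is the parent of the other. -/
theorem isParent_or_isParent {X : TwoColoredRootedTree.{u}} {v w : X.V} (h : X.graph.Adj v w) :
    X.IsParent v w ∨ X.IsParent w v := by
  by_cases hw : w ∈ (X.path X.root v).support
  · right
    have hv : v ∉ (X.path X.root w).support :=
      X.isTree.isAcyclic.ne_mem_support_of_support_of_adj_of_isPath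
        (X.path_isPath _ _) (X.path_isPath _ _) h hw
    have hp := (X.path_isPath X.root w).concat hv h.symm
    rw [IsParent, ← X.path_unique _ hp, SimpleGraph.Walk.edges_concat]
    simp
  · left
    have hp := (X.path_isPath X.root v).concat hw h
    rw [IsParent, ← X.path_unique _ hp, SimpleGraph.Walk.edges_concat]
    simp

end TwoColoredRootedTree

/-- A pair `(X, k)` of a 2-colored rooted tree and an index on it. -/
structure IndexedTree : Type (u + 1) where
  /-- The 2-colored rooted tree. -/
  tree : TwoColoredRootedTree.{u}
  /-- The index. -/
  idx : tree.Index

namespace IndexedTree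

/-- The component of the index at an edge `{a, b}`. -/
def idxAt (P : IndexedTree.{u}) {a b : P.tree.V} (h : P.tree.graph.Adj a b) : ℕ :=
  P.idx ⟨s(a, b), h⟩

/-- An isomorphism of pairs: an isomorphism of trees that respects the root, the colors and the
index. -/
structure Iso (P Q : IndexedTree.{u}) where
  /-- The isomorphism of the underlying graphs. -/
  toIso : P.tree.graph ≃g Q.tree.graph
  map_root : toIso P.tree.root = Q.tree.root
  map_black : ∀ v, toIso v ∈ Q.tree.black ↔ v ∈ P.tree.black
  map_idx : ∀ a b (h : P.tree.graph.Adj a b) (h' : Q.tree.graph.Adj (toIso a) (toIso b)),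
    Q.idxAt h' = P.idxAt h

theorem Iso.pathSum_eq {P Q : IndexedTree.{u}} (e : Iso P Q) (v w : P.tree.V) :
    Q.tree.pathSum Q.idx (e.toIso v) (e.toIso w) = P.tree.pathSum P.idx v w := by
  have hp : ((P.tree.path v w).map e.toIso.toHom).IsPath :=
    (P.tree.path_isPath v w).map e.toIso.injective
  have h := Q.tree.path_unique _ hp
  unfold TwoColoredRootedTree.pathSum
  rw [show Q.tree.path (e.toIso v) (e.toIso w) = _ from h.symm, SimpleGraph.Walk.darts_map,
    List.map_map]
  congr 1
  apply List.map_congr_left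
  rintro ⟨⟨a, b⟩, hab⟩ -
  exact e.map_idx a b hab _

/-- The pair `(X_v, k)`. -/
def reroot (P : IndexedTree.{u}) (v : P.tree.V) : IndexedTree.{u} where
  tree := P.tree.reroot v
  idx := P.idx

end IndexedTree

/-! ## The space `2CRT` and the symmetrization map on it -/

/-- The pairs `(X, k)` with black root and essentially positive index. -/
abbrev AdmissiblePair : Type (u + 1) :=
  {P : IndexedTree.{u} // P.tree.root ∈ P.tree.black ∧ P.tree.EssentiallyPositive P.idx}

/-- Pairs are identified when they are isomorphic. -/
instance AdmissiblePair.setoid : Setoid AdmissiblePair.{u} where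
  r P Q := Nonempty (IndexedTree.Iso P.1 Q.1)
  iseqv :=
    { refl := fun P => ⟨⟨SimpleGraph.Iso.refl, rfl, fun _ => Iff.rfl, fun _ _ _ _ => rfl⟩⟩
      symm := by
        rintro P Q ⟨e⟩
        refine ⟨⟨e.toIso.symm, ?_, ?_, ?_⟩⟩
        · rw [← e.map_root]; simp
        · intro v
          rw [← e.map_black]; simp
        · intro a b h h'
          have h'' : Q.1.tree.graph.Adj (e.toIso (e.toIso.symm a)) (e.toIso (e.toIso.symm b)) := by
            simpa using h
          have := e.map_idx _ _ h' h''
          rw [← this]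
          simp [IndexedTree.idxAt]
      trans := by
        rintro P Q R ⟨e⟩ ⟨f⟩
        refine ⟨⟨e.toIso.trans f.toIso, ?_, ?_, ?_⟩⟩
        · simp [e.map_root, f.map_root]
        · intro v
          simp [e.map_black, f.map_black]
        · intro a b h h'
          have h'' : Q.1.tree.graph.Adj (e.toIso a) (e.toIso b) := e.toIso.map_adj_iff.2 h
          exact (f.map_idx _ _ h'' h').trans (e.map_idx _ _ h h'') }

/-- The `ℚ`-vector space `2CRT` with basis the isomorphism classes of pairs `(X, k)` with black
root and essentially positive index. -/
abbrev TwoCRT : Type (u + 1) := Quotient AdmissiblePair.setoid.{u} →₀ ℚ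

/-- The basis element of `2CRT` given by a pair. -/
def AdmissiblePair.toTwoCRT (P : AdmissiblePair.{u}) : TwoCRT.{u} :=
  Finsupp.single ⟦P⟧ 1

/-- The pair `(X_v, k)` for a black vertex `v`. -/
def AdmissiblePair.reroot (P : AdmissiblePair.{u}) (v : P.1.tree.black) : AdmissiblePair.{u} :=
  ⟨P.1.reroot v, v.2, P.2.2⟩

open Classical in
/-- The element `∑_{v ∈ V_•} (-1)^{k_{P(rt, v)}} (X_v, k)` of `2CRT`. -/
def AdmissiblePair.symm (P : AdmissiblePair.{u}) : TwoCRT.{u} :=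
  ∑ v : P.1.tree.black,
    (-1 : ℚ) ^ P.1.tree.pathSum P.1.idx P.1.tree.root v • (P.reroot v).toTwoCRT

theorem AdmissiblePair.symm_congr (P Q : AdmissiblePair.{u}) (h : P ≈ Q) : P.symm = Q.symm := by
  obtain ⟨e⟩ := h
  classical
  let f : P.1.tree.black ≃ Q.1.tree.black :=
    e.toIso.toEquiv.subtypeEquiv fun v => (e.map_black v).symm
  unfold AdmissiblePair.symm
  refine Fintype.sum_equiv f _ _ ?_
  intro v
  have h1 : P.1.tree.pathSum P.1.idx P.1.tree.root v
      = Q.1.tree.pathSum Q.1.idx Q.1.tree.root (f v) := by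
    rw [← e.map_root]
    exact (e.pathSum_eq _ _).symm
  have h2 : (P.reroot v).toTwoCRT = (Q.reroot (f v)).toTwoCRT := by
    unfold AdmissiblePair.toTwoCRT
    rw [Quotient.sound (s := AdmissiblePair.setoid.{u}) (a := P.reroot v) (b := Q.reroot (f v))
      ⟨⟨e.toIso, rfl, e.map_black, e.map_idx⟩⟩]
  rw [h1, h2]

/-- The symmetrization map `Φ : 2CRT → 2CRT`, the `ℚ`-linear map with
`Φ(X, k) = ∑_{v ∈ V_•} (-1)^{k_{P(rt, v)}} (X_v, k)`. -/
def PhiMap : TwoCRT.{u} →ₗ[ℚ] TwoCRT.{u} :=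
  Finsupp.linearCombination ℚ (Quotient.lift AdmissiblePair.symm AdmissiblePair.symm_congr)

/-! ## Harvestable pairs and the harvestable form -/

namespace IndexedTree

/-- A pair is harvestable. A branched point is a vertex of degree at least three. -/
structure IsHarvestable (P : IndexedTree.{u}) : Prop where
  /-- The root is a terminal. -/
  root_terminal : P.tree.deg P.tree.root = 1
  /-- White vertices are branched points. -/
  white_branched : ∀ v, v ∉ P.tree.black → 3 ≤ P.tree.deg v
  /-- Black vertices are not branched points. -/
  black_not_branched : ∀ v, v ∈ P.tree.black → ¬ 3 ≤ P.tree.deg v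
  /-- The index is positive on an edge from a white vertex to one of its children. -/
  pos_of_white_parent : ∀ v w (h : P.tree.IsParent v w), v ∉ P.tree.black → 0 < P.idxAt h.adj
  /-- The index is positive on an edge between black vertices. -/
  pos_of_black : ∀ v w (h : P.tree.graph.Adj v w), v ∈ P.tree.black → w ∈ P.tree.black →
    0 < P.idxAt h

/-- `{a, b}` is an edge that may be contracted: its index is zero and it has a white end `a`. -/
def Contractible (P : IndexedTree.{u}) (a b : P.tree.V) : Prop :=
  a ∉ P.tree.black ∧ ∃ h : P.tree.graph.Adj a b, P.idxAt h = 0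

/-- `Q` is obtained from `P` by contracting the edge `{a, b}`; the new vertex is black if `a` or
`b` is black, it is the root if `a` or `b` is the root, and the index on the other edges does not
change. -/
def IsContraction (P Q : IndexedTree.{u}) (a b : P.tree.V) : Prop :=
  ∃ π : P.tree.V → Q.tree.V, Function.Surjective π ∧
    (∀ x y, π x = π y ↔ x = y ∨ s(x, y) = s(a, b)) ∧
    (∀ p q, Q.tree.graph.Adj p q ↔
      p ≠ q ∧ ∃ x y, π x = p ∧ π y = q ∧ P.tree.graph.Adj x y) ∧
    π P.tree.root = Q.tree.root ∧
    (∀ p, p ∈ Q.tree.black ↔ ∃ x ∈ P.tree.black, π x = p) ∧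
    ∀ x y (h : P.tree.graph.Adj x y) (h' : Q.tree.graph.Adj (π x) (π y)), Q.idxAt h' = P.idxAt h

/-- One contraction of an edge. -/
def ContractStep (P Q : IndexedTree.{u}) : Prop :=
  ∃ a b, P.Contractible a b ∧ IsContraction P Q a b

/-- `c` is a vertex at which two edges may be joined: it is white of degree two. -/
def Joinable (P : IndexedTree.{u}) (c : P.tree.V) : Prop :=
  c ∉ P.tree.black ∧ P.tree.deg c = 2

/-- `Q` is obtained from `P` by deleting the vertex `c` and joining its two edges `{a, c}` and
`{c, b}` to one edge `{a, b}`, on which the index is the sum of the two indices. -/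
def IsJoin (P Q : IndexedTree.{u}) (c : P.tree.V) : Prop :=
  ∃ (a b : P.tree.V) (ha : P.tree.graph.Adj a c) (hb : P.tree.graph.Adj c b)
    (ι : Q.tree.V → P.tree.V), a ≠ b ∧ Function.Injective ι ∧ Set.range ι = {c}ᶜ ∧
    (∀ p q, Q.tree.graph.Adj p q ↔ P.tree.graph.Adj (ι p) (ι q) ∨ s(ι p, ι q) = s(a, b)) ∧
    ι Q.tree.root = P.tree.root ∧
    (∀ p, p ∈ Q.tree.black ↔ ι p ∈ P.tree.black) ∧
    (∀ p q (h : Q.tree.graph.Adj p q) (h' : P.tree.graph.Adj (ι p) (ι q)),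
      Q.idxAt h = P.idxAt h') ∧
    ∀ p q (h : Q.tree.graph.Adj p q), s(ι p, ι q) = s(a, b) → Q.idxAt h = P.idxAt ha + P.idxAt hb

/-- One joining of two edges at a white vertex of degree two. -/
def JoinStep (P Q : IndexedTree.{u}) : Prop :=
  ∃ c, P.Joinable c ∧ IsJoin P Q c

/-- `Q` is obtained from `P` by inserting a new white vertex `n` together with an edge `{v, n}` of
index zero at the vertex `v`, and replacing the edges `{v, w}` by `{n, w}` for the children `w`
of `v`, without changing the index on them. -/
def IsInsertion (P Q : IndexedTree.{u}) (v : P.tree.V) : Prop :=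
  ∃ (ι : P.tree.V → Q.tree.V) (n : Q.tree.V), Function.Injective ι ∧ Set.range ι = {n}ᶜ ∧
    (∀ x y, Q.tree.graph.Adj (ι x) (ι y) ↔ P.tree.graph.Adj x y ∧
      ¬ (x = v ∧ P.tree.IsParent v y) ∧ ¬ (y = v ∧ P.tree.IsParent v x)) ∧
    (∀ x, Q.tree.graph.Adj n (ι x) ↔ x = v ∨ P.tree.IsParent v x) ∧
    ι P.tree.root = Q.tree.root ∧
    n ∉ Q.tree.black ∧ (∀ x, ι x ∈ Q.tree.black ↔ x ∈ P.tree.black) ∧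
    (∀ x y (h : P.tree.graph.Adj x y) (h' : Q.tree.graph.Adj (ι x) (ι y)),
      Q.idxAt h' = P.idxAt h) ∧
    (∀ h : Q.tree.graph.Adj n (ι v), Q.idxAt h = 0) ∧
    ∀ w (h : P.tree.IsParent v w) (h' : Q.tree.graph.Adj n (ι w)), Q.idxAt h' = P.idxAt h.adj

/-- `v` is a black branched point other than the root. -/
def Splittable (P : IndexedTree.{u}) (v : P.tree.V) : Prop :=
  v ∈ P.tree.black ∧ v ≠ P.tree.root ∧ 3 ≤ P.tree.deg v

/-- One insertion at a black branched point other than the root. -/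
def InsertStep (P Q : IndexedTree.{u}) : Prop :=
  ∃ v, P.Splittable v ∧ IsInsertion P Q v

/-- `Q` is a result of the following procedure, applied to `P`.
(i) Contract edges of index zero with a white end as long as there are any.
(ii) Join the two edges at white vertices of degree two as long as there are any.
(iii) Insert white vertices at black branched points other than the root as long as there are any.
(iv) If the root is not a terminal, insert a white vertex at the root. -/
def IsHarvestableForm (P Q : IndexedTree.{u}) : Prop :=
  ∃ P₁ P₂ P₃ : IndexedTree.{u},
    (Relation.ReflTransGen ContractStep P P₁ ∧ ∀ a b, ¬ P₁.Contractible a b) ∧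
    (Relation.ReflTransGen JoinStep P₁ P₂ ∧ ∀ c, ¬ P₂.Joinable c) ∧
    (Relation.ReflTransGen InsertStep P₂ P₃ ∧ ∀ v, ¬ P₃.Splittable v) ∧
    ((P₃.tree.deg P₃.tree.root = 1 ∧ Q = P₃) ∨
      (P₃.tree.deg P₃.tree.root ≠ 1 ∧ IsInsertion P₃ Q P₃.tree.root))

/-! ## The element `w(X, k)` -/

open Classical in
/-- The element of `ℚ⟨x, y⟩` of the part of the tree above the vertex `v`: the shuffle product, over
the children `c` of `v`, of the element of the part above `c` times `z_k` if `c` is black and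
times `x ^ k` if `c` is white, where `k` is the index on the edge `{v, c}`.
For a harvestable pair a black vertex has at most one child, so that no product is formed there,
and the shuffle products are taken at the white vertices only. -/
def branch (P : IndexedTree.{u}) (v : P.tree.V) : HAlg :=
  HAlg.shList ((P.tree.children v).attach.toList.map fun c =>
    P.branch c.1 *
      (if c.1 ∈ P.tree.black
        then HAlg.z (P.idxAt (TwoColoredRootedTree.mem_children.1 c.2).adj)
        else HAlg.X ^ P.idxAt (TwoColoredRootedTree.mem_children.1 c.2).adj))
termination_by Fintype.card P.tree.V - (P.tree.path P.tree.root v).length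
decreasing_by
  have h := (TwoColoredRootedTree.mem_children.1 c.2).length
  have h' := P.tree.path_length_lt P.tree.root c.1
  omega

theorem IsHarvestable.exists_child {P : IndexedTree.{u}} (hP : P.IsHarvestable) {v : P.tree.V}
    (hv : v ∉ P.tree.black) : (P.tree.children v).Nonempty := by
  by_contra hne
  rw [Finset.not_nonempty_iff_eq_empty] at hne
  have h3 := hP.white_branched v hv
  have hsub : (P.tree.graph.neighborSet v).Subsingleton := by
    have key : ∀ w ∈ P.tree.graph.neighborSet v, P.tree.IsParent w v := by
      intro w hw
      rcases TwoColoredRootedTree.isParent_or_isParent hw with h | h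
      · have := TwoColoredRootedTree.mem_children.2 h
        rw [hne] at this
        simp at this
      · exact h
    intro a ha b hb
    exact (key a ha).unique (key b hb)
  have := (Set.ncard_le_one_iff_subsingleton (s := P.tree.graph.neighborSet v)).2 hsub
  unfold TwoColoredRootedTree.deg at h3
  omega

theorem IsHarvestable.branch_mem {P : IndexedTree.{u}} (hP : P.IsHarvestable) (v : P.tree.V) :
    P.branch v ∈ HAlg.H1 ∧ (v ∉ P.tree.black → P.branch v ∈ HAlg.yH) := by
  rw [branch]
  have key := HAlg.shList_mem (l := (P.tree.children v).attach.toList.map fun c =>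
    P.branch c.1 * (open Classical in
      (if c.1 ∈ P.tree.black
        then HAlg.z (P.idxAt (TwoColoredRootedTree.mem_children.1 c.2).adj)
        else HAlg.X ^ P.idxAt (TwoColoredRootedTree.mem_children.1 c.2).adj))) (by
    intro a ha
    obtain ⟨c, -, rfl⟩ := List.mem_map.1 ha
    have ih := hP.branch_mem c.1
    split_ifs with hc
    · exact HAlg.mul_z_mem_yH ih.1 _
    · exact HAlg.mul_mem_yH (ih.2 hc) _)
  refine ⟨key.1, fun hv => key.2 ?_⟩
  obtain ⟨c, hc⟩ := hP.exists_child hv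
  intro h
  have : (⟨c, hc⟩ : {c // c ∈ P.tree.children v}) ∈ (P.tree.children v).attach.toList := by simp
  rw [List.map_eq_nil_iff] at h
  rw [h] at this
  simp at this
termination_by Fintype.card P.tree.V - (P.tree.path P.tree.root v).length
decreasing_by
  have h := (TwoColoredRootedTree.mem_children.1 c.2).length
  have h' := P.tree.path_length_lt P.tree.root c.1
  omega

end IndexedTree

/-- The harvestable pairs. -/
abbrev HarvestablePair : Type (u + 1) := {P : IndexedTree.{u} // P.IsHarvestable}

/-- The element `w(X, k)` of `𝔥¹` of a harvestable pair. If the pair consists, starting from the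
root, of black vertices `v_{r+1}, …, v_1` with indices `k_r, …, k_1` on the edges between them,
followed by an edge of index `k'` to a white vertex with branches whose elements are
`w_1, …, w_s`, it is `(w_1 ⧢ ⋯ ⧢ w_s) x ^ k' z_{k_1} ⋯ z_{k_r}`; without the white vertex it is
`z_{k_1} ⋯ z_{k_r}`. -/
def HarvestablePair.w (P : HarvestablePair.{u}) : HAlg.H1 :=
  ⟨P.1.branch P.1.tree.root, (P.2.branch_mem _).1⟩

end

/-! ## The shuffle algebra -/

noncomputable section

namespace HAlg

/-! Exchanging `v` and `F v` is an automorphism `σ` of the colored tree that preserves the index,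
since `f` joins a vertex to its image and is merely reversed. Hence `X_v` and `X_{σ v}` are
isomorphic as rooted trees with index. The heights `k_{P(rt, v)}` and `k_{P(rt, σ v)}` have
different parities: the parity of their sum is constant along edges, because an edge and its image
have the same index, and at an end of `f` it is the parity of `k_f`. So the terms of `Φ(X, k)` at
`v` and `σ v` cancel (`IndexedTree.exists_isMirror`, `IndexedTree.IsMirror.phiMap_eq_zero`).

For `φ`, it suffices to write `φ(w(X_h, k_h))` as a signed sum, over the black vertices `v` of the
original tree, of elements that depend only on the isomorphism class of `(X_v, k)`; the same
cancellation then applies. This is `IndexedTree.cut_value_root`, and it rests on two constructions.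

The first is an extension of `w` to pairs that are not harvestable. `IndexedTree.value` records an
element of the shuffle algebra and the number of black vertices whose letter `y` has not been
written; the letter is written at the first edge of positive index on the way to the root. This is
an evaluation in a commutative monoid on which indices act additively, so every step towards a
harvestable form preserves it (`IndexedTree.IsHarvestableForm.eval_root_eq`), and on a harvestable
pair it gives `w` (`IndexedTree.IsHarvestable.value_eq`). Essential positivity keeps the number of
pending vertices at most one (`IndexedTree.ZeroSeparated.pending_le`).

The second is the formula `φ(a) = cut (a y) 1`, where `cut w q` is the sum of `a ⧢ (q S(b))` over
the decompositions `w = a y b`, and `S` reverses a word with the sign of its length. Cutting obeys a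
Leibniz rule for the shuffle product (`HAlg.cut_sh`): one factor is cut and the others pass to the
second argument. This matches the branching of the tree, a letter `x` passing through the cut
matches the sign of an edge, and the cuts at letters `y` match the black vertices. The outcome is
the recursion `IndexedTree.rerootSum_recursion` over the vertices, which telescopes.

For the existence of a harvestable form, contractions and joins lower the number of vertices and
insertions lower the number of black branched points other than the root; invariants carried through
the steps show that the result is harvestable. -/

theorem word_nil : word [] = 1 := by simp [word]

theorem sh_mul_letter (a b : HAlg) (u v : Letter) :
    sh (a * letter u) (b * letter v)
      = sh a (b * letter v) * letter u + sh (a * letter u) b * letter v := by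
  let r (w : Letter) : HAlg →ₗ[ℚ] HAlg := LinearMap.mulRight ℚ (letter w)
  have h : (sh.compl₁₂ (r u) (r v) : HAlg →ₗ[ℚ] HAlg →ₗ[ℚ] HAlg)
      = (sh.compl₂ (r v)).compr₂ (r u) + (sh ∘ₗ r u).compr₂ (r v) := by
    refine wordBasis.ext fun a => wordBasis.ext fun b => ?_
    simpa [r, wordBasis_apply] using sh_word_rule a b u v
  simpa [r] using LinearMap.congr_fun₂ h a b

theorem shRev_comm (a b : List Letter) : shRev a b = shRev b a := by
  match a, b with
  | [], [] => rfl
  | [], v :: b => simp [shRev]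
  | u :: a, [] => simp [shRev]
  | u :: a, v :: b =>
    rw [shRev, shRev, shRev_comm a, shRev_comm (u :: a), add_comm]
termination_by a.length + b.length

theorem sh_comm (a b : HAlg) : sh a b = sh b a := by
  have h : sh = sh.flip := by
    refine wordBasis.ext fun a => wordBasis.ext fun b => ?_
    rw [LinearMap.flip_apply, wordBasis_apply, wordBasis_apply, sh_word, sh_word, shRev_comm]
  exact LinearMap.congr_fun₂ h a b

theorem sh_assoc_word (n : ℕ) (a b c : List Letter) (h : a.length + b.length + c.length = n) :
    sh (sh (word a) (word b)) (word c) = sh (word a) (sh (word b) (word c)) := by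
  induction n using Nat.strong_induction_on generalizing a b c with
  | _ n ih =>
    rcases List.eq_nil_or_concat' a with rfl | ⟨a, u, rfl⟩
    · simp [word_nil, sh_one_left]
    rcases List.eq_nil_or_concat' b with rfl | ⟨b, v, rfl⟩
    · simp [word_nil, sh_one_left, sh_one_right]
    rcases List.eq_nil_or_concat' c with rfl | ⟨c, w, rfl⟩
    · simp [word_nil, sh_one_right]
    simp only [List.length_append, List.length_cons, List.length_nil] at h
    -- The last letter of a term is `u`, `v` or `w`. Removing it leaves a triple product of total
    -- length `n - 1`, and the three sorts of terms agree separately.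
    have h1 := ih (n - 1) (by omega) a (b ++ [v]) (c ++ [w]) (by simp; omega)
    have h2 := ih (n - 1) (by omega) (a ++ [u]) b (c ++ [w]) (by simp; omega)
    have h3 := ih (n - 1) (by omega) (a ++ [u]) (b ++ [v]) c (by simp; omega)
    simp only [word_append_singleton, sh_mul_letter, map_add, LinearMap.add_apply] at h1 h2 h3 ⊢
    rw [h1, h2, ← h3]
    simp only [add_mul]
    abel

theorem sh_assoc (a b c : HAlg) : sh (sh a b) c = sh a (sh b c) := by
  have h : sh.compr₂ sh = LinearMap.lcomp ℚ _ sh ∘ₗ LinearMap.llcomp ℚ _ _ _ ∘ₗ sh := by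
    refine wordBasis.ext fun a => wordBasis.ext fun b => wordBasis.ext fun c => ?_
    simpa [wordBasis_apply] using sh_assoc_word _ a b c rfl
  simpa using LinearMap.congr_fun (LinearMap.congr_fun₂ h a b) c

end HAlg

/-- The space `ℚ⟨x, y⟩` with the shuffle product as its multiplication. -/
def Shuffle : Type := HAlg

namespace Shuffle

/-- The identity map from `ℚ⟨x, y⟩` with its concatenation product. -/
def of (a : HAlg) : Shuffle := a

/-- The identity map to `ℚ⟨x, y⟩` with its concatenation product. -/
def val (a : Shuffle) : HAlg := a

instance : CommMonoid Shuffle where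
  mul a b := of (HAlg.sh a.val b.val)
  one := of 1
  mul_assoc := HAlg.sh_assoc
  one_mul := HAlg.sh_one_left
  mul_one := HAlg.sh_one_right
  mul_comm := HAlg.sh_comm

@[simp] theorem val_of (a : HAlg) : (of a).val = a := rfl

@[simp] theorem val_one : (1 : Shuffle).val = 1 := rfl

@[simp] theorem val_mul (a b : Shuffle) : (a * b).val = HAlg.sh a.val b.val := rfl

theorem val_list_prod (l : List Shuffle) : l.prod.val = HAlg.shList (l.map val) := by
  induction l with
  | nil => rfl
  | cons a l ih => rw [List.prod_cons, val_mul, ih]; rfl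

end Shuffle

namespace HAlg

/-! ### Cutting words at the letter `y` -/

/-- The map `q ↦ ∑ a ⧢ (q S(b))`, the sum over the decompositions `w = a y b` of a word `w`, given
by its reversal, where `S` is the antipode of the shuffle algebra. -/
def cutRev : List Letter → HAlg →ₗ[ℚ] HAlg
  | [] => 0
  -- Either the cut lies before the last letter `u`, which then opens the antipode and is absorbed
  -- into `q` with a sign, or it lies at `u` itself.
  | u :: w => -(cutRev w ∘ₗ LinearMap.mulRight ℚ (letter u)) +
      match u with
      | Letter.x => 0
      | Letter.y => sh (word w.reverse)

/-- The bilinear map that sends a word `w` and `q` to `∑ a ⧢ (q S(b))`, the sum over the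
decompositions `w = a y b`, where `S` is the antipode of the shuffle algebra. -/
def cut : HAlg →ₗ[ℚ] HAlg →ₗ[ℚ] HAlg :=
  wordBasis.constr ℚ fun w => cutRev w.reverse

theorem cut_word (w : List Letter) : cut (word w) = cutRev w.reverse := by
  rw [← wordBasis_apply, cut, Module.Basis.constr_basis]

@[simp] theorem cut_one : cut 1 = 0 := by
  rw [← word_nil, cut_word, List.reverse_nil, cutRev]

theorem cut_mul_X (w q : HAlg) : cut (w * X) q = -cut w (q * X) := by
  have h : cut ∘ₗ LinearMap.mulRight ℚ X
      = -(LinearMap.lcomp ℚ _ (LinearMap.mulRight ℚ X) ∘ₗ cut) := by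
    refine wordBasis.ext fun w => ?_
    ext q
    simp only [LinearMap.comp_apply, wordBasis_apply, LinearMap.mulRight_apply,
      X, ← word_append_singleton, cut_word]
    simp [cutRev, cut_word]
  simpa using LinearMap.congr_fun₂ h w q

theorem cut_mul_Y (w q : HAlg) : cut (w * Y) q = sh w q - cut w (q * Y) := by
  have h : cut ∘ₗ LinearMap.mulRight ℚ Y
      = sh - (LinearMap.lcomp ℚ _ (LinearMap.mulRight ℚ Y) ∘ₗ cut) := by
    refine wordBasis.ext fun w => ?_
    ext q
    simp only [LinearMap.comp_apply, wordBasis_apply, LinearMap.mulRight_apply,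
      Y, ← word_append_singleton, cut_word]
    simp [cutRev, cut_word, sub_eq_neg_add]
  simpa using LinearMap.congr_fun₂ h w q

theorem cut_mul_X_pow (w q : HAlg) (k : ℕ) :
    cut (w * X ^ k) q = (-1 : ℚ) ^ k • cut w (q * X ^ k) := by
  induction k generalizing q with
  | zero => simp
  | succ k ih =>
    rw [pow_succ, ← mul_assoc, cut_mul_X, ih, mul_assoc, ← pow_succ', pow_succ (-1 : ℚ), mul_neg_one,
      neg_smul, pow_succ]

/-- A uniform rule, with `r = 0` for `x` and `r = 1` for `y`, that spares the next induction a case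
distinction on letters. -/
theorem cut_mul_letter (u : Letter) :
    ∃ r : ℚ, ∀ w q : HAlg, cut (w * letter u) q = r • sh w q - cut w (q * letter u) := by
  cases u with
  | x => exact ⟨0, fun w q => by simpa [X] using cut_mul_X w q⟩
  | y => exact ⟨1, fun w q => by simpa [Y] using cut_mul_Y w q⟩

/-- Induction on the total length. A letter stripped from the end of the first argument is appended
to the second, so in the induction hypothesis `q c` plays the part of `q` and the stripped letter
that of `c`. This is why the second argument must end in a letter. -/
theorem cut_sh_word (n : ℕ) (a b : List Letter) (q : HAlg) (c : Letter)
    (h : a.length + b.length = n) :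
    cut (sh (word a) (word b)) (q * letter c)
      = cut (word a) (sh q (word b) * letter c) + cut (word b) (sh q (word a) * letter c) := by
  induction n using Nat.strong_induction_on generalizing a b q c with
  | _ n ih =>
    rcases List.eq_nil_or_concat' a with rfl | ⟨a, u, rfl⟩
    · simp [word_nil, sh_one_left, sh_one_right]
    rcases List.eq_nil_or_concat' b with rfl | ⟨b, v, rfl⟩
    · simp [word_nil, sh_one_right]
    simp only [List.length_append, List.length_cons, List.length_nil] at h
    have h1 := ih (n - 1) (by omega) a (b ++ [v]) (q * letter c) u (by simp; omega)
    have h2 := ih (n - 1) (by omega) (a ++ [u]) b (q * letter c) v (by simp; omega)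
    obtain ⟨r, hr⟩ := cut_mul_letter u
    obtain ⟨s, hs⟩ := cut_mul_letter v
    -- The terms cut at the last letter `u`. The first summand occurs on the right-hand side; the
    -- second cancels against a term of the induction hypothesis `h2`. In `e2` the letters `u` and
    -- `v` are exchanged, and the cancellation is with `h1`.
    have e1 : sh (sh (word a) (word b * letter v)) (q * letter c)
        = sh (word a) (sh q (word b * letter v) * letter c)
          + sh (word a) (sh (q * letter c) (word b) * letter v) := by
      rw [sh_assoc, sh_comm _ (q * letter c), sh_mul_letter, map_add]
    have e2 : sh (sh (word a * letter u) (word b)) (q * letter c)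
        = sh (word b) (sh q (word a * letter u) * letter c)
          + sh (word b) (sh (q * letter c) (word a) * letter u) := by
      rw [sh_comm (word a * letter u), sh_assoc, sh_comm _ (q * letter c), sh_mul_letter, map_add]
    simp only [word_append_singleton, sh_mul_letter, map_add, LinearMap.add_apply, hr, hs,
      e1, e2, add_mul, smul_add] at h1 h2 ⊢
    rw [h1, h2]
    abel

theorem cut_sh (a b q : HAlg) (c : Letter) :
    cut (sh a b) (q * letter c)
      = cut a (sh q b * letter c) + cut b (sh q a * letter c) := by
  let r : HAlg →ₗ[ℚ] HAlg := LinearMap.mulRight ℚ (letter c)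
  have h : (sh.compr₂ (cut.flip (q * letter c)) : HAlg →ₗ[ℚ] HAlg →ₗ[ℚ] HAlg)
      = cut.compl₂ (r ∘ₗ sh q) + (cut.compl₂ (r ∘ₗ sh q)).flip := by
    refine wordBasis.ext fun a => wordBasis.ext fun b => ?_
    simpa [r, wordBasis_apply] using cut_sh_word _ a b q c rfl
  simpa [r] using LinearMap.congr_fun₂ h a b

open Classical in
-- The Leibniz rule for several factors: one is cut and the others are shuffled into `q`, which
-- therefore varies in the induction.
theorem cut_prod {ι : Type*} (s : Finset ι) (f : ι → Shuffle) (q : Shuffle) (c : Letter) :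
    cut (∏ i ∈ s, f i).val (q.val * letter c)
      = ∑ i ∈ s, cut (f i).val ((q * ∏ j ∈ s.erase i, f j).val * letter c) := by
  induction s using Finset.induction_on generalizing q with
  | empty => simp
  | insert a s ha ih =>
    rw [Finset.prod_insert ha, Shuffle.val_mul, cut_sh, ← Shuffle.val_mul, ← Shuffle.val_mul,
      ih, Finset.sum_insert ha, Finset.erase_insert ha]
    congr 1
    refine Finset.sum_congr rfl fun i hi => ?_
    have hia : a ≠ i := fun h => ha (h ▸ hi)
    rw [Finset.erase_insert_of_ne hia, Finset.prod_insert (by simp [ha]), mul_assoc]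

/-! ### The map `phi` as a cut -/

theorem zMon_append_singleton (l : List ℕ+) (k : ℕ+) : zMon (l ++ [k]) = zMon l * z k := by
  simp [zMon]

/-- Either the cut is at the final `y`, or the `y` and then the `k - 1` letters `x` pass to the end
of `q`, where they form `z k` with the sign `(-1) ^ k`. -/
theorem cut_mul_z (w q : HAlg) (k : ℕ+) :
    cut (w * z k * Y) q = sh (w * z k) q + (-1 : ℚ) ^ (k : ℕ) • cut (w * Y) (q * z k) := by
  obtain ⟨n, hn⟩ : ∃ n, (k : ℕ) = n + 1 := ⟨k - 1, by have := k.pos; omega⟩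
  rw [cut_mul_Y, sub_eq_add_neg, hn]
  simp [z, ← mul_assoc, cut_mul_X_pow, pow_succ]

/-- The summand `i` is the cut at the letter `y` with number `i + 1`. The appended `y` replaces the
one removed by the cut, so that the reversed remainder is again a product of elements `z k`, of
length the sum of the indices dropped. -/
theorem cut_zMon (l : List ℕ+) (q : HAlg) :
    cut (zMon l * Y) q = ∑ i ∈ Finset.range (l.length + 1),
      (-1 : ℚ) ^ ((l.drop i).map fun k : ℕ+ => (k : ℕ)).sum •
        sh (zMon (l.take i)) (q * zMon (l.drop i).reverse) := by
  induction l using List.reverseRecOn generalizing q with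
  | nil => simp only [zMon]; simpa using cut_mul_Y 1 q
  | append_singleton l k ih =>
    rw [Finset.sum_range_succ, zMon_append_singleton, cut_mul_z, ih, Finset.smul_sum, add_comm]
    congr 1
    · simp only [List.length_append, List.length_cons, List.length_nil]
      refine Finset.sum_congr rfl fun i hi => ?_
      rw [Finset.mem_range] at hi
      rw [List.drop_append_of_le_length (by omega), List.take_append_of_le_length (by omega),
        smul_smul, ← pow_add]
      simp [zMon, mul_assoc, add_comm]
    · simp [zMon]

/-- The map `φ` in terms of `cut`. -/
theorem phi_eq_cut (a : H1) : (phi a : HAlg) = cut (a * Y) 1 := by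
  have h : H1.subtype ∘ₗ phi = cut.flip 1 ∘ₗ LinearMap.mulRight ℚ Y ∘ₗ H1.subtype := by
    refine zBasis.ext fun l => ?_
    rw [LinearMap.comp_apply, phi, Module.Basis.constr_basis]
    simp [zBasis, cut_zMon]
  exact LinearMap.congr_fun h a

end HAlg
end

/-! ## Parents, children and recursion on trees -/

noncomputable section

namespace TwoColoredRootedTree

variable {X : TwoColoredRootedTree.{u}}

/-- The distance from the root. -/
def depth (X : TwoColoredRootedTree.{u}) (v : X.V) : ℕ := (X.path X.root v).length

theorem IsParent.depth_eq {p v : X.V} (h : X.IsParent p v) : X.depth v = X.depth p + 1 := h.length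

theorem path_self (X : TwoColoredRootedTree.{u}) (v : X.V) :
    X.path v v = SimpleGraph.Walk.nil :=
  (X.path_unique _ SimpleGraph.Walk.IsPath.nil).symm

theorem not_isParent_root (p : X.V) : ¬ X.IsParent p X.root := by
  simp [IsParent, path_self]

theorem exists_isParent {v : X.V} (hv : v ≠ X.root) : ∃ p, X.IsParent p v := by
  have hn : ¬ (X.path X.root v).Nil := fun h => hv h.eq.symm
  exact ⟨_, SimpleGraph.Walk.mk_penultimate_end_mem_edges hn⟩

theorem IsParent.ne_root {p v : X.V} (h : X.IsParent p v) : v ≠ X.root := by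
  rintro rfl
  exact not_isParent_root p h

theorem IsParent.asymm {p v : X.V} (h : X.IsParent p v) : ¬ X.IsParent v p := fun h' => by
  have := h.depth_eq
  have := h'.depth_eq
  omega

theorem adj_iff_isParent {a b : X.V} : X.graph.Adj a b ↔ X.IsParent a b ∨ X.IsParent b a :=
  ⟨isParent_or_isParent, fun h => h.elim IsParent.adj fun h => h.adj.symm⟩

/-- Induction from the leaves to the root. -/
theorem children_induction {p : X.V → Prop}
    (h : ∀ v, (∀ c, X.IsParent v c → p c) → p v) (v : X.V) : p v := by
  induction hn : Fintype.card X.V - X.depth v using Nat.strong_induction_on generalizing v with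
  | _ n ih =>
    refine h v fun c hc => ih _ ?_ c rfl
    have h1 := hc.depth_eq
    have h2 : X.depth c < Fintype.card X.V := X.path_length_lt _ _
    omega

/-- Induction from the root to the leaves. -/
theorem parent_induction {p : X.V → Prop} (h0 : p X.root)
    (h : ∀ v w, X.IsParent v w → p v → p w) (v : X.V) : p v := by
  induction hn : X.depth v generalizing v with
  | zero =>
    by_cases hv : v = X.root
    · rwa [hv]
    · obtain ⟨w, hw⟩ := exists_isParent hv
      have := hw.depth_eq
      omega
  | succ n ih =>
    by_cases hv : v = X.root
    · rwa [hv]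
    · obtain ⟨w, hw⟩ := exists_isParent hv
      refine h w v hw (ih w ?_)
      have := hw.depth_eq
      omega

/-- A relation between adjacent vertices that increases a rank, and in which every vertex except
for the root has a predecessor, is the relation of being the parent. -/
theorem isParent_iff_of_rank {r : X.V → X.V → Prop} (d : X.V → ℕ)
    (hadj : ∀ p v, r p v → X.graph.Adj p v) (hd : ∀ p v, r p v → d p < d v)
    (hex : ∀ v, v ≠ X.root → ∃ p, r p v) (p v : X.V) : X.IsParent p v ↔ r p v := by
  have key : ∀ n p v, d v = n → r p v → X.IsParent p v := by
    intro n
    induction n using Nat.strong_induction_on with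
    | _ n ih =>
      intro p v hv h
      rcases isParent_or_isParent (hadj p v h) with h1 | h1
      · exact h1
      -- Here `v` would be the parent of `p`. A predecessor of `p` is by induction its parent too,
      -- hence equal to `v`, against the ranks.
      · exfalso
        obtain ⟨q, hq⟩ := hex p h1.ne_root
        have hlt := hd _ _ h
        have h2 := ih (d p) (by omega) q p rfl hq
        obtain rfl := h1.unique h2
        have := hd _ _ hq
        omega
  refine ⟨fun h => ?_, key _ p v rfl⟩
  obtain ⟨q, hq⟩ := hex v h.ne_root
  rwa [h.unique (key _ q v rfl hq)]

open Classical in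
theorem deg_eq (v : X.V) :
    X.deg v = (X.children v).card + if v = X.root then 0 else 1 := by
  rw [deg, ← Set.ncard_coe_finset]
  split_ifs with hv
  · congr 1
    ext w
    simp only [SimpleGraph.mem_neighborSet, Finset.mem_coe, mem_children, adj_iff_isParent]
    refine or_iff_left fun h => h.ne_root hv
  · obtain ⟨p, hp⟩ := exists_isParent hv
    have hm : p ∉ (X.children v : Set X.V) := by
      simpa [mem_children] using hp.asymm
    rw [← Set.ncard_insert_of_notMem hm (Set.toFinite _)]
    congr 1
    ext w
    simp only [SimpleGraph.mem_neighborSet, Set.mem_insert_iff, Finset.mem_coe, mem_children,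
      adj_iff_isParent, or_comm (a := w = p)]
    refine or_congr Iff.rfl ⟨fun h => h.unique hp, ?_⟩
    rintro rfl
    exact hp

end TwoColoredRootedTree

namespace IndexedTree

open TwoColoredRootedTree

variable {P Q : IndexedTree.{u}} {M : Type*} [CommMonoid M]

open Classical in
/-- The index at the edge `{a, b}`, and zero if there is no such edge. -/
def wt (P : IndexedTree.{u}) (a b : P.tree.V) : ℕ :=
  if h : P.tree.graph.Adj a b then P.idxAt h else 0

theorem wt_of_adj {a b : P.tree.V} (h : P.tree.graph.Adj a b) : P.wt a b = P.idxAt h := dif_pos h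

theorem idxAt_comm {a b : P.tree.V} (h : P.tree.graph.Adj a b) : P.idxAt h.symm = P.idxAt h := by
  unfold idxAt
  congr 1
  exact Subtype.ext Sym2.eq_swap

theorem wt_comm (a b : P.tree.V) : P.wt a b = P.wt b a := by
  by_cases h : P.tree.graph.Adj a b
  · rw [wt_of_adj h, wt_of_adj h.symm, idxAt_comm]
  · rw [wt, wt, dif_neg h, dif_neg fun h' => h h'.symm]

/-! ## Evaluation of a tree in a commutative monoid -/

open Classical in
/-- The value `m` of a black vertex, and `1` at a white vertex. -/
def color (m : M) (P : IndexedTree.{u}) (v : P.tree.V) : M := if v ∈ P.tree.black then m else 1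

/-- The value of the part of the tree above `v` in a commutative monoid: the product of the value
`m` of a black vertex with the values of the parts above the children, on which the index on the
edges to them has acted by `act`. -/
def eval (m : M) (act : ℕ → M → M) (P : IndexedTree.{u}) (v : P.tree.V) : M :=
  color m P v * ∏ c ∈ (P.tree.children v).attach, act (P.wt v c) (eval m act P c)
termination_by Fintype.card P.tree.V - P.tree.depth v
decreasing_by
  have h := (mem_children.1 c.2).depth_eq
  have h' : P.tree.depth c.1 < _ := P.tree.path_length_lt P.tree.root c.1
  omega

variable (m : M) (act : ℕ → M → M)

theorem eval_eq (P : IndexedTree.{u}) (v : P.tree.V) :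
    eval m act P v
      = color m P v * ∏ c ∈ P.tree.children v, act (P.wt v c) (eval m act P c) := by
  rw [eval, Finset.prod_attach _ fun c => act (P.wt v c) (eval m act P c)]

/-- The recursion has only one solution, so an invariance proof only has to check the recursion. -/
theorem eq_eval {α : P.tree.V → M}
    (h : ∀ v, α v = color m P v * ∏ c ∈ P.tree.children v, act (P.wt v c) (α c))
    (v : P.tree.V) : α v = eval m act P v := by
  induction v using children_induction with
  | h v ih =>
    rw [h, eval_eq]
    congr 1
    exact Finset.prod_congr rfl fun c hc => by rw [ih c (mem_children.1 hc)]

/-- `Q` is obtained from `P` by deleting the vertex `c`, so that the parent of `c` becomes the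
parent of the children of `c` and black if `c` is black, and the indices are added. -/
structure IsDeletion (P Q : IndexedTree.{u}) (c : P.tree.V) (ι : Q.tree.V → P.tree.V) : Prop where
  injective : Function.Injective ι
  range_eq : Set.range ι = {c}ᶜ
  map_root : ι Q.tree.root = P.tree.root
  isParent_iff : ∀ p q, Q.tree.IsParent p q ↔ P.tree.IsParent (ι p) (ι q) ∨
    (P.tree.IsParent (ι p) c ∧ P.tree.IsParent c (ι q))
  wt_eq : ∀ p q, P.tree.IsParent (ι p) (ι q) → Q.wt p q = P.wt (ι p) (ι q)
  wt_eq' : ∀ p q, P.tree.IsParent (ι p) c → P.tree.IsParent c (ι q) →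
    Q.wt p q = P.wt (ι p) c + P.wt c (ι q)
  black_iff : ∀ p, p ∈ Q.tree.black ↔
    ι p ∈ P.tree.black ∨ (P.tree.IsParent (ι p) c ∧ c ∈ P.tree.black)
  not_black : ∀ p, P.tree.IsParent p c → c ∈ P.tree.black → p ∉ P.tree.black ∧ P.wt p c = 0
  wt_zero : ∀ p, P.tree.IsParent p c → P.wt p c = 0 ∨ (P.tree.children c).card = 1

variable {m act}

/-- The factor of `c` is merged into that of its parent. As `act` need not respect products, this
works only because the edge above `c` has index zero or `c` contributes a single factor. -/
theorem IsDeletion.eval_eq (act_zero : ∀ a, act 0 a = a)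
    (act_add : ∀ i j a, act (i + j) a = act i (act j a))
    {c : P.tree.V} {ι : Q.tree.V → P.tree.V} (h : IsDeletion P Q c ι) (q : Q.tree.V) :
    eval m act Q q = eval m act P (ι q) := by
  classical
  refine (IndexedTree.eq_eval m act (α := fun q => eval m act P (ι q)) (fun q => ?_) q).symm
  have hc : ∀ q, ι q ≠ c := fun q => by
    have : ι q ∈ Set.range ι := ⟨q, rfl⟩
    rw [h.range_eq] at this
    exact this
  have hex : ∀ x, x ≠ c → ∃ q, ι q = x := fun x hx => by
    have : x ∈ Set.range ι := by rw [h.range_eq]; exact hx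
    exact this
  by_cases hqc : P.tree.IsParent (ι q) c
  · have hdisj : Disjoint ((P.tree.children (ι q)).erase c) (P.tree.children c) := by
      rw [Finset.disjoint_left]
      intro x hx hx'
      exact hc q ((mem_children.1 (Finset.mem_of_mem_erase hx)).unique (mem_children.1 hx'))
    have himg : (Q.tree.children q).map ⟨ι, h.injective⟩
        = (P.tree.children (ι q)).erase c ∪ P.tree.children c := by
      ext x
      simp only [Finset.mem_map, mem_children, Function.Embedding.coeFn_mk, Finset.mem_union,
        Finset.mem_erase, h.isParent_iff]
      constructor
      · rintro ⟨y, hy | hy, rfl⟩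
        · exact Or.inl ⟨hc y, hy⟩
        · exact Or.inr hy.2
      · rintro (⟨hx, hx'⟩ | hx)
        · obtain ⟨y, rfl⟩ := hex x hx
          exact ⟨y, Or.inl hx', rfl⟩
        · obtain ⟨y, rfl⟩ := hex x hx.adj.ne'
          exact ⟨y, Or.inr ⟨hqc, hx⟩, rfl⟩
    have hprod : ∏ y ∈ Q.tree.children q, act (Q.wt q y) (eval m act P (ι y))
        = ∏ x ∈ (Q.tree.children q).map ⟨ι, h.injective⟩,
          if P.tree.IsParent (ι q) x then act (P.wt (ι q) x) (eval m act P x)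
          else act (P.wt (ι q) c + P.wt c x) (eval m act P x) := by
      rw [Finset.prod_map]
      refine Finset.prod_congr rfl fun y hy => ?_
      simp only [Function.Embedding.coeFn_mk]
      split_ifs with hy'
      · rw [h.wt_eq _ _ hy']
      · rw [h.wt_eq' _ _ hqc]
        exact (((h.isParent_iff _ _).1 (mem_children.1 hy)).resolve_left hy').2
    rw [hprod, himg, Finset.prod_union hdisj, IndexedTree.eval_eq m act P (ι q),
      ← Finset.mul_prod_erase _ _ (mem_children.2 hqc)]
    have e1 : ∏ x ∈ (P.tree.children (ι q)).erase c,
          (if P.tree.IsParent (ι q) x then act (P.wt (ι q) x) (eval m act P x)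
            else act (P.wt (ι q) c + P.wt c x) (eval m act P x))
        = ∏ x ∈ (P.tree.children (ι q)).erase c, act (P.wt (ι q) x) (eval m act P x) :=
      Finset.prod_congr rfl fun x hx =>
        if_pos (mem_children.1 (Finset.mem_of_mem_erase hx))
    have e2 : ∏ x ∈ P.tree.children c,
          (if P.tree.IsParent (ι q) x then act (P.wt (ι q) x) (eval m act P x)
            else act (P.wt (ι q) c + P.wt c x) (eval m act P x))
        = ∏ x ∈ P.tree.children c, act (P.wt (ι q) c) (act (P.wt c x) (eval m act P x)) :=
      Finset.prod_congr rfl fun x hx => by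
        rw [if_neg fun hx' => hc q (hx'.unique (mem_children.1 hx)), act_add]
    -- If the index is not zero, `c` is white and has one child, so `act` meets one factor only and
    -- no product has to be split.
    have e3 : color m P (ι q) * act (P.wt (ι q) c) (eval m act P c)
        = color m Q q *
          ∏ x ∈ P.tree.children c, act (P.wt (ι q) c) (act (P.wt c x) (eval m act P x)) := by
      have hcol : color m P (ι q) * color m P c = color m Q q := by
        simp only [color, h.black_iff, hqc, true_and]
        by_cases hcb : c ∈ P.tree.black
        · simp [hcb, (h.not_black _ hqc hcb).1]
        · simp [hcb]
      rw [IndexedTree.eval_eq m act P c, ← hcol]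
      rcases h.wt_zero _ hqc with h0 | h1
      · simp only [h0, act_zero, mul_assoc]
      · obtain ⟨d, hd⟩ := Finset.card_eq_one.1 h1
        by_cases hcb : c ∈ P.tree.black
        · simp only [(h.not_black _ hqc hcb).2, act_zero, mul_assoc]
        · simp [hd, color, hcb]
    rw [e1, e2, ← mul_assoc, e3]
    ac_rfl
  · rw [IndexedTree.eval_eq m act P (ι q)]
    have hcol : color m Q q = color m P (ι q) := by
      simp [color, h.black_iff, hqc]
    have himg : P.tree.children (ι q) = (Q.tree.children q).map ⟨ι, h.injective⟩ := by
      ext x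
      simp only [Finset.mem_map, mem_children, Function.Embedding.coeFn_mk,
        h.isParent_iff, hqc, false_and, or_false]
      constructor
      · intro hx
        obtain ⟨y, rfl⟩ := hex x (by rintro rfl; exact hqc hx)
        exact ⟨y, hx, rfl⟩
      · rintro ⟨y, hy, rfl⟩
        exact hy
    rw [hcol, himg, Finset.prod_map]
    congr 1
    refine Finset.prod_congr rfl fun y hy => ?_
    have hy' : P.tree.IsParent (ι q) (ι y) := by
      simpa [hqc, h.isParent_iff, mem_children] using hy
    rw [h.wt_eq _ _ hy']
    rfl

end IndexedTree
end

/-! ## Invariance of the evaluation under the steps to the harvestable form -/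

noncomputable section

namespace IndexedTree

open TwoColoredRootedTree

variable {P Q : IndexedTree.{u}} {M : Type*} [CommMonoid M] {m : M} {act : ℕ → M → M}

/-! ### Contractions and joins as deletions of a vertex -/

theorem IsContraction.swap {a b : P.tree.V} (h : IsContraction P Q a b) :
    IsContraction P Q b a := by
  unfold IsContraction at h ⊢
  rwa [Sym2.eq_swap]

/-- The only fibre of `π` with two points is `{p, c}`, so choosing in each fibre the point other
than `c` gives `ι`. The last hypothesis prevents two black vertices from being merged, which would
lose one of their factors. -/
theorem IsContraction.exists_isDeletion {p c : P.tree.V} (h : IsContraction P Q p c)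
    (hpc : P.tree.IsParent p c) (h0 : P.wt p c = 0)
    (hb : c ∈ P.tree.black → p ∉ P.tree.black) : ∃ ι, IsDeletion P Q c ι := by
  obtain ⟨π, hπ, hfib, hadj, hroot, hblack, hidx⟩ := h
  have hne : p ≠ c := hpc.adj.ne
  have hfib' : ∀ x y, x ≠ c → y ≠ c → π x = π y → x = y := by
    intro x y hx hy hxy
    rcases (hfib x y).1 hxy with h | h
    · exact h
    · rcases Sym2.eq_iff.1 h with ⟨-, h⟩ | ⟨h, -⟩
      · exact absurd h hy
      · exact absurd h hx
  have hpcπ : π c = π p := (hfib c p).2 (Or.inr Sym2.eq_swap)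
  have hsec : ∀ q, ∃ x, x ≠ c ∧ π x = q := fun q => by
    obtain ⟨x, rfl⟩ := hπ q
    by_cases hx : x = c
    · exact ⟨p, hne, by rw [hx, hpcπ]⟩
    · exact ⟨x, hx, rfl⟩
  choose ι hιc hπι using hsec
  have hιπ : ∀ x, x ≠ c → ι (π x) = x := fun x hx => hfib' _ _ (hιc _) hx (hπι _)
  have hc : c ≠ P.tree.root := hpc.ne_root
  have hιroot : ι Q.tree.root = P.tree.root := by rw [← hroot, hιπ _ hc.symm]
  have hinj : Function.Injective ι := fun x y h => by rw [← hπι x, h, hπι]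
  have hadj1 : ∀ q q', P.tree.IsParent (ι q) (ι q') → Q.tree.graph.Adj q q' := fun q q' h => by
    refine (hadj q q').2 ⟨?_, _, _, hπι q, hπι q', h.adj⟩
    rintro rfl
    exact h.adj.ne rfl
  have hadj2 : ∀ q q', P.tree.IsParent (ι q) c → P.tree.IsParent c (ι q') →
      Q.tree.graph.Adj q q' := fun q q' h h' => by
    refine (hadj q q').2 ⟨?_, c, _, ?_, hπι q', h'.adj⟩
    · rintro rfl
      exact h.asymm h'
    · rw [hpcπ, ← h.unique hpc, hπι]
  have hpar := isParent_iff_of_rank (X := Q.tree)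
    (r := fun p q => P.tree.IsParent (ι p) (ι q) ∨
      (P.tree.IsParent (ι p) c ∧ P.tree.IsParent c (ι q)))
    (fun q => P.tree.depth (ι q))
    (fun q q' h => h.elim (hadj1 q q') fun h => hadj2 q q' h.1 h.2)
    (fun q q' h => by
      rcases h with h | ⟨h, h'⟩
      · rw [h.depth_eq]; omega
      · rw [h'.depth_eq, h.depth_eq]; omega)
    (fun q hq => by
      obtain ⟨x, hx⟩ := exists_isParent (X := P.tree) (v := ι q)
        (fun h => hq (hinj (h.trans hιroot.symm)))
      by_cases hxc : x = c
      · subst hxc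
        exact ⟨π p, Or.inr ⟨by rwa [hιπ p hne], hx⟩⟩
      · exact ⟨π x, Or.inl (by rwa [hιπ x hxc])⟩)
  have hwt : ∀ x y, P.tree.graph.Adj x y → Q.tree.graph.Adj (π x) (π y) →
      Q.wt (π x) (π y) = P.wt x y := fun x y h h' => by
    rw [wt_of_adj h, wt_of_adj h', hidx]
  refine ⟨ι, hinj, ?_, hιroot, hpar, ?_, ?_, ?_, ?_, ?_⟩
  · ext x
    exact ⟨fun ⟨q, hq⟩ => hq ▸ hιc q, fun hx => ⟨_, hιπ x hx⟩⟩
  · intro q q' h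
    have := hwt _ _ h.adj (by rw [hπι, hπι]; exact hadj1 q q' h)
    rwa [hπι, hπι] at this
  · intro q q' h h'
    have hq : π c = q := by rw [hpcπ, ← h.unique hpc, hπι]
    have := hwt _ _ h'.adj (by rw [hq, hπι]; exact hadj2 q q' h h')
    rw [hq, hπι] at this
    rw [this, h.unique hpc, h0, zero_add]
  · intro q
    rw [hblack]
    constructor
    · rintro ⟨x, hx, rfl⟩
      by_cases hxc : x = c
      · subst hxc
        refine Or.inr ⟨?_, hx⟩
        rwa [hpcπ, hιπ p hne]
      · exact Or.inl (by rwa [hιπ x hxc])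
    · rintro (h | ⟨h, h'⟩)
      · exact ⟨_, h, hπι q⟩
      · exact ⟨c, h', by rw [hpcπ, ← h.unique hpc, hπι]⟩
  · intro x hx hcb
    obtain rfl := hx.unique hpc
    exact ⟨hb hcb, h0⟩
  · intro x hx
    obtain rfl := hx.unique hpc
    exact Or.inl h0

theorem ContractStep.exists_isDeletion (h : ContractStep P Q) : ∃ c ι, IsDeletion P Q c ι := by
  obtain ⟨a, b, ⟨ha, hab, h0⟩, h⟩ := h
  rcases isParent_or_isParent hab with h' | h'
  · exact ⟨b, h.exists_isDeletion h' (by rw [wt_of_adj hab, h0]) fun _ => ha⟩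
  · exact ⟨a, h.swap.exists_isDeletion h' (by rw [wt_comm, wt_of_adj hab, h0])
      fun h => absurd h ha⟩

/-- The root survives the join, so `c` is not the root, and degree two leaves it one parent and one
child. These are `a` and `b` in one of the two orders. -/
theorem IsJoin.exists_isDeletion {c : P.tree.V} (hc : P.Joinable c) (h : IsJoin P Q c) :
    ∃ ι, IsDeletion P Q c ι := by
  classical
  obtain ⟨a, b, ha, hb, ι, hab, hinj, hrange, hadj, hroot, hblack, hidx, hidx'⟩ := h
  have hιc : ∀ q, ι q ≠ c := fun q => by
    have : ι q ∈ Set.range ι := ⟨q, rfl⟩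
    rw [hrange] at this
    exact this
  have hex : ∀ x, x ≠ c → ∃ q, ι q = x := fun x hx => by
    have : x ∈ Set.range ι := by rw [hrange]; exact hx
    exact this
  have hcr : c ≠ P.tree.root := fun h => hιc _ (hroot.trans h.symm)
  have hcard : (P.tree.children c).card = 1 := by
    have := deg_eq (X := P.tree) c
    rw [hc.2, if_neg hcr] at this
    omega
  obtain ⟨d, hd⟩ := Finset.card_eq_one.1 hcard
  have hdc : P.tree.IsParent c d := mem_children.1 (by simp [hd])
  have hd' : ∀ x, P.tree.IsParent c x → x = d := fun x hx => by
    have := mem_children.2 hx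
    rwa [hd, Finset.mem_singleton] at this
  obtain ⟨p, hpc⟩ := exists_isParent hcr
  have hpd : s(a, b) = s(p, d) := by
    rcases isParent_or_isParent ha with h1 | h1 <;> rcases isParent_or_isParent hb with h2 | h2
    · rw [h1.unique hpc, hd' _ h2]
    · exact absurd (h1.unique h2) hab
    · exact absurd ((hd' _ h1).trans (hd' _ h2).symm) hab
    · rw [h2.unique hpc, hd' _ h1, Sym2.eq_swap]
  have hsum : P.idxAt ha + P.idxAt hb = P.wt p c + P.wt c d := by
    rw [← wt_of_adj ha, ← wt_of_adj hb]
    rcases Sym2.eq_iff.1 hpd with ⟨rfl, rfl⟩ | ⟨rfl, rfl⟩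
    · rfl
    · rw [add_comm, wt_comm c b, wt_comm a c]
  have hadj2 : ∀ q q', P.tree.IsParent (ι q) c → P.tree.IsParent c (ι q') →
      s(ι q, ι q') = s(a, b) := fun q q' h h' => by
    rw [hpd, h.unique hpc, hd' _ h']
  have hpar := isParent_iff_of_rank (X := Q.tree)
    (r := fun p q => P.tree.IsParent (ι p) (ι q) ∨
      (P.tree.IsParent (ι p) c ∧ P.tree.IsParent c (ι q)))
    (fun q => P.tree.depth (ι q))
    (fun q q' h => (hadj q q').2 (h.imp IsParent.adj fun h => hadj2 q q' h.1 h.2))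
    (fun q q' h => by
      rcases h with h | ⟨h, h'⟩
      · rw [h.depth_eq]; omega
      · rw [h'.depth_eq, h.depth_eq]; omega)
    (fun q hq => by
      obtain ⟨x, hx⟩ := exists_isParent (X := P.tree) (v := ι q)
        (fun h => hq (hinj (h.trans hroot.symm)))
      by_cases hxc : x = c
      · subst hxc
        obtain ⟨y, rfl⟩ := hex p hpc.adj.ne
        exact ⟨y, Or.inr ⟨hpc, hx⟩⟩
      · obtain ⟨y, rfl⟩ := hex x hxc
        exact ⟨y, Or.inl hx⟩)
  refine ⟨ι, hinj, hrange, hroot, hpar, ?_, ?_, ?_, ?_, ?_⟩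
  · intro q q' h
    have h' := (hadj q q').2 (Or.inl h.adj)
    rw [wt_of_adj h.adj, wt_of_adj h', hidx]
  · intro q q' h h'
    have hs := hadj2 q q' h h'
    have h'' := (hadj q q').2 (Or.inr hs)
    rw [wt_of_adj h'', hidx' _ _ h'' hs, hsum, h.unique hpc, hd' _ h']
  · intro q
    rw [hblack]
    exact (or_iff_left fun h => hc.1 h.2).symm
  · exact fun _ _ h => absurd h hc.1
  · exact fun _ _ => Or.inr hcard

theorem JoinStep.exists_isDeletion (h : JoinStep P Q) : ∃ c ι, IsDeletion P Q c ι := by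
  obtain ⟨c, hc, h⟩ := h
  exact ⟨c, h.exists_isDeletion hc⟩

/-- `Q` is obtained from `P` by inserting a white vertex `n` of index zero between `v` and the
children of `v`. -/
structure IsInsertionAt (P Q : IndexedTree.{u}) (v : P.tree.V) (ι : P.tree.V → Q.tree.V)
    (n : Q.tree.V) : Prop where
  injective : Function.Injective ι
  range_eq : Set.range ι = {n}ᶜ
  map_root : ι P.tree.root = Q.tree.root
  isParent_iff : ∀ x y, Q.tree.IsParent (ι x) (ι y) ↔ P.tree.IsParent x y ∧ x ≠ v
  isParent_new : ∀ x, Q.tree.IsParent (ι x) n ↔ x = v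
  new_isParent : ∀ x, Q.tree.IsParent n (ι x) ↔ P.tree.IsParent v x
  wt_eq : ∀ x y, P.tree.IsParent x y → x ≠ v → Q.wt (ι x) (ι y) = P.wt x y
  wt_new : Q.wt (ι v) n = 0
  wt_new' : ∀ y, P.tree.IsParent v y → Q.wt n (ι y) = P.wt v y
  black_iff : ∀ x, ι x ∈ Q.tree.black ↔ x ∈ P.tree.black
  new_white : n ∉ Q.tree.black

theorem IsInsertion.exists_isInsertionAt {v : P.tree.V} (h : IsInsertion P Q v) :
    ∃ ι n, IsInsertionAt P Q v ι n := by
  classical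
  obtain ⟨ι, n, hinj, hrange, hadj, hnew, hroot, hn, hblack, hidx, hidx0, hidx'⟩ := h
  have hιn : ∀ x, ι x ≠ n := fun x => by
    have : ι x ∈ Set.range ι := ⟨x, rfl⟩
    rw [hrange] at this
    exact this
  have hex : ∀ q, q ≠ n → ∃ x, ι x = q := fun q hq => by
    have : q ∈ Set.range ι := by rw [hrange]; exact hq
    exact this
  have hadj1 : ∀ x y, P.tree.IsParent x y → x ≠ v → Q.tree.graph.Adj (ι x) (ι y) := by
    intro x y h hx
    refine (hadj x y).2 ⟨h.adj, fun h => hx h.1, ?_⟩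
    rintro ⟨rfl, h'⟩
    exact h.asymm h'
  let r : Q.tree.V → Q.tree.V → Prop := fun q q' =>
    (q = ι v ∧ q' = n) ∨ (q = n ∧ ∃ y, q' = ι y ∧ P.tree.IsParent v y) ∨
      ∃ x y, q = ι x ∧ q' = ι y ∧ P.tree.IsParent x y ∧ x ≠ v
  -- Doubled depths leave room for the rank of `n` between those of `v` and its children.
  have hdep : ∃ d : Q.tree.V → ℕ, (∀ x, d (ι x) = 2 * P.tree.depth x) ∧
      d n = 2 * P.tree.depth v + 1 := by
    refine ⟨fun q => if h : ∃ x, ι x = q then 2 * P.tree.depth h.choose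
      else 2 * P.tree.depth v + 1, fun x => ?_, ?_⟩
    · have h : ∃ y, ι y = ι x := ⟨x, rfl⟩
      simp only [dif_pos h]
      rw [hinj h.choose_spec]
    · exact dif_neg fun ⟨x, hx⟩ => hιn x hx
  obtain ⟨d, hd, hdn⟩ := hdep
  have hpar := isParent_iff_of_rank (X := Q.tree) (r := r) d
    (fun q q' h => by
      rcases h with ⟨rfl, rfl⟩ | ⟨rfl, y, rfl, hy⟩ | ⟨x, y, rfl, rfl, h, hx⟩
      · exact ((hnew v).2 (Or.inl rfl)).symm
      · exact (hnew y).2 (Or.inr hy)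
      · exact hadj1 x y h hx)
    (fun q q' h => by
      rcases h with ⟨rfl, rfl⟩ | ⟨rfl, y, rfl, hy⟩ | ⟨x, y, rfl, rfl, h, hx⟩
      · rw [hd, hdn]; omega
      · rw [hd, hdn, hy.depth_eq]; omega
      · rw [hd, hd, h.depth_eq]; omega)
    (fun q hq => by
      by_cases hqn : q = n
      · exact ⟨ι v, Or.inl ⟨rfl, hqn⟩⟩
      · obtain ⟨y, rfl⟩ := hex q hqn
        obtain ⟨x, hx⟩ := exists_isParent (X := P.tree) (v := y) (fun h => hq (by rw [h, hroot]))
        by_cases hxv : x = v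
        · exact ⟨n, Or.inr (Or.inl ⟨rfl, y, rfl, hxv ▸ hx⟩)⟩
        · exact ⟨ι x, Or.inr (Or.inr ⟨x, y, rfl, rfl, hx, hxv⟩)⟩)
  refine ⟨ι, n, hinj, hrange, hroot, ?_, ?_, ?_, ?_, ?_, ?_, hblack, hn⟩
  · intro x y
    rw [hpar]
    constructor
    · rintro (⟨-, h⟩ | ⟨h, -⟩ | ⟨x', y', hx, hy, h, h'⟩)
      · exact absurd h (hιn y)
      · exact absurd h (hιn x)
      · rw [hinj hx, hinj hy]
        exact ⟨h, h'⟩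
    · exact fun h => Or.inr (Or.inr ⟨x, y, rfl, rfl, h⟩)
  · intro x
    rw [hpar]
    constructor
    · rintro (⟨h, -⟩ | ⟨h, -⟩ | ⟨x', y', hx, hy, h, h'⟩)
      · exact hinj h
      · exact absurd h (hιn x)
      · exact absurd hy.symm (hιn y')
    · rintro rfl
      exact Or.inl ⟨rfl, rfl⟩
  · intro x
    rw [hpar]
    constructor
    · rintro (⟨h, -⟩ | ⟨-, y, hy, h⟩ | ⟨x', y', hx, hy, h, h'⟩)
      · exact absurd h.symm (hιn v)
      · rwa [hinj hy]
      · exact absurd hx.symm (hιn x')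
    · exact fun h => Or.inr (Or.inl ⟨rfl, x, rfl, h⟩)
  · intro x y h hx
    have h' := hadj1 x y h hx
    rw [wt_of_adj h.adj, wt_of_adj h', hidx]
  · rw [wt_comm, wt_of_adj ((hnew v).2 (Or.inl rfl)), hidx0]
  · intro y hy
    rw [wt_of_adj ((hnew y).2 (Or.inr hy)), wt_of_adj hy.adj, hidx' y hy]

namespace IsInsertionAt

variable {v : P.tree.V} {ι : P.tree.V → Q.tree.V} {n : Q.tree.V}

theorem ne_new (h : IsInsertionAt P Q v ι n) (x : P.tree.V) : ι x ≠ n := by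
  have : ι x ∈ Set.range ι := ⟨x, rfl⟩
  rw [h.range_eq] at this
  exact this

theorem exists_eq (h : IsInsertionAt P Q v ι n) {q : Q.tree.V} (hq : q ≠ n) : ∃ x, ι x = q := by
  have : q ∈ Set.range ι := by rw [h.range_eq]; exact hq
  exact this

theorem children_of_ne (h : IsInsertionAt P Q v ι n) {x : P.tree.V} (hx : x ≠ v) :
    Q.tree.children (ι x) = (P.tree.children x).map ⟨ι, h.injective⟩ := by
  ext q
  simp only [mem_children, Finset.mem_map, Function.Embedding.coeFn_mk]
  constructor
  · intro hq
    by_cases hqn : q = n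
    · subst hqn
      exact absurd ((h.isParent_new x).1 hq) hx
    · obtain ⟨y, rfl⟩ := h.exists_eq hqn
      exact ⟨y, ((h.isParent_iff x y).1 hq).1, rfl⟩
  · rintro ⟨y, hy, rfl⟩
    exact (h.isParent_iff x y).2 ⟨hy, hx⟩

theorem children_self (h : IsInsertionAt P Q v ι n) : Q.tree.children (ι v) = {n} := by
  ext q
  simp only [mem_children, Finset.mem_singleton]
  constructor
  · intro hq
    by_contra hqn
    obtain ⟨y, rfl⟩ := h.exists_eq hqn
    exact ((h.isParent_iff v y).1 hq).2 rfl
  · rintro rfl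
    exact (h.isParent_new v).2 rfl

theorem children_new (h : IsInsertionAt P Q v ι n) :
    Q.tree.children n = (P.tree.children v).map ⟨ι, h.injective⟩ := by
  ext q
  simp only [mem_children, Finset.mem_map, Function.Embedding.coeFn_mk]
  constructor
  · intro hq
    obtain ⟨y, rfl⟩ := h.exists_eq hq.adj.ne'
    exact ⟨y, (h.new_isParent y).1 hq, rfl⟩
  · rintro ⟨y, hy, rfl⟩
    exact (h.new_isParent y).2 hy

/-- The new vertex is white and hangs on an edge of index zero, so it only passes on the product
over the former children of `v`. -/
theorem eval_eq (act_zero : ∀ a, act 0 a = a) (h : IsInsertionAt P Q v ι n) (x : P.tree.V) :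
    eval m act Q (ι x) = eval m act P x := by
  induction x using children_induction with
  | h x ih =>
    have hcol : color m Q (ι x) = color m P x := by
      have := h.black_iff x
      by_cases hx : x ∈ P.tree.black <;> simp_all [color]
    by_cases hx : x = v
    · subst hx
      have hcol' : color m Q n = 1 := if_neg h.new_white
      rw [IndexedTree.eval_eq m act Q, IndexedTree.eval_eq m act P, h.children_self,
        Finset.prod_singleton, h.wt_new, act_zero, IndexedTree.eval_eq m act Q n, hcol', one_mul,
        h.children_new, Finset.prod_map, hcol]
      congr 1
      refine Finset.prod_congr rfl fun y hy => ?_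
      rw [mem_children] at hy
      simp only [Function.Embedding.coeFn_mk]
      rw [h.wt_new' y hy, ih y hy]
    · rw [IndexedTree.eval_eq m act Q, IndexedTree.eval_eq m act P, h.children_of_ne hx,
        Finset.prod_map, hcol]
      congr 1
      refine Finset.prod_congr rfl fun y hy => ?_
      rw [mem_children] at hy
      simp only [Function.Embedding.coeFn_mk]
      rw [h.wt_eq x y hy hx, ih y hy]

end IsInsertionAt

theorem IsHarvestableForm.eval_root_eq (act_zero : ∀ a, act 0 a = a)
    (act_add : ∀ i j a, act (i + j) a = act i (act j a)) (h : IsHarvestableForm P Q) :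
    eval m act Q Q.tree.root = eval m act P P.tree.root := by
  have hdel : ∀ {P Q : IndexedTree.{u}}, (∃ c ι, IsDeletion P Q c ι) →
      eval m act Q Q.tree.root = eval m act P P.tree.root := by
    rintro P Q ⟨c, ι, h⟩
    rw [h.eval_eq act_zero act_add, h.map_root]
  have hins : ∀ {P Q : IndexedTree.{u}} {v}, IsInsertion P Q v →
      eval m act Q Q.tree.root = eval m act P P.tree.root := by
    intro P Q v h
    obtain ⟨ι, n, h⟩ := h.exists_isInsertionAt
    rw [← h.map_root, h.eval_eq act_zero]
  have hchain : ∀ {r : IndexedTree.{u} → IndexedTree.{u} → Prop}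
      (_ : ∀ P Q, r P Q → eval m act Q Q.tree.root = eval m act P P.tree.root) {P Q},
      Relation.ReflTransGen r P Q →
        eval m act Q Q.tree.root = eval m act P P.tree.root := by
    intro r hr P Q h
    induction h with
    | refl => rfl
    | tail _ h ih => rw [hr _ _ h, ih]
  obtain ⟨P₁, P₂, P₃, ⟨h1, -⟩, ⟨h2, -⟩, ⟨h3, -⟩, h4⟩ := h
  have e3 : eval m act P₃ P₃.tree.root = eval m act P P.tree.root := by
    rw [hchain (fun P Q ⟨_, _, h⟩ => hins h) h3,
      hchain (fun P Q h => hdel h.exists_isDeletion) h2,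
      hchain (fun P Q h => hdel h.exists_isDeletion) h1]
  rcases h4 with ⟨-, rfl⟩ | ⟨-, h4⟩
  · exact e3
  · rw [hins h4, e3]

end IndexedTree
end

/-! ## The evaluation in the shuffle algebra and the symmetrization map -/

noncomputable section

namespace TwoColoredRootedTree

variable {X : TwoColoredRootedTree.{u}}

theorem path_of_isParent {p v : X.V} (h : X.IsParent p v) :
    X.path X.root v = (X.path X.root p).concat h.adj := by
  refine (X.path_unique _ ((X.path_isPath _ _).concat (fun hv => h.asymm ?_) h.adj)).symm
  have hp : p ∉ (X.path X.root v).support :=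
    X.isTree.isAcyclic.ne_mem_support_of_support_of_adj_of_isPath
      (X.path_isPath _ _) (X.path_isPath _ _) h.adj hv
  have hp' := (X.path_isPath X.root v).concat hp h.adj.symm
  rw [IsParent, ← X.path_unique _ hp', SimpleGraph.Walk.edges_concat]
  simp

theorem isParent_root_iff {c : X.V} : X.IsParent X.root c ↔ X.graph.Adj X.root c :=
  ⟨IsParent.adj, fun h => (isParent_or_isParent h).resolve_right (not_isParent_root c)⟩

theorem IsParent.isParent_iff {p v : X.V} (h : X.IsParent p v) {c : X.V} :
    X.IsParent v c ↔ X.graph.Adj v c ∧ c ≠ p := by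
  refine ⟨fun hc => ⟨hc.adj, ?_⟩, fun ⟨hc, hne⟩ => ?_⟩
  · rintro rfl
    exact h.asymm hc
  · exact (isParent_or_isParent hc).resolve_right fun h' => hne (h'.unique h)

/-- `v` belongs to the path from the root to `w`. -/
def IsAncestor (X : TwoColoredRootedTree.{u}) : X.V → X.V → Prop :=
  Relation.ReflTransGen X.IsParent

theorem IsAncestor.depth_le {v w : X.V} (h : X.IsAncestor v w) : X.depth v ≤ X.depth w := by
  induction h with
  | refl => rfl
  | tail _ h ih =>
    rw [h.depth_eq]
    omega

/-- The ancestors of `w` form a chain. Hence no vertex lies above two children of the same vertex.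
-/
theorem IsAncestor.eq_of_depth_eq {v v' w : X.V} (h : X.IsAncestor v w) (h' : X.IsAncestor v' w)
    (hd : X.depth v = X.depth v') : v = v' := by
  induction h with
  | refl =>
    rcases Relation.ReflTransGen.cases_tail h' with h' | ⟨p, hp, hpv⟩
    · exact h'
    · have := hpv.depth_eq
      have := IsAncestor.depth_le hp
      omega
  | tail hv h ih =>
    rcases Relation.ReflTransGen.cases_tail h' with h' | ⟨p, hp, hpv⟩
    · subst h'
      have := h.depth_eq
      have := IsAncestor.depth_le hv
      omega
    · rw [hpv.unique h] at hp
      exact ih hp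

end TwoColoredRootedTree

namespace IndexedTree

open TwoColoredRootedTree

variable {P : IndexedTree.{u}}

/-- The sum of the index over the path from the root. -/
def height (P : IndexedTree.{u}) (v : P.tree.V) : ℕ := P.tree.pathSum P.idx P.tree.root v

theorem height_root (P : IndexedTree.{u}) : P.height P.tree.root = 0 := by
  simp [height, pathSum, path_self]

theorem height_of_isParent {p v : P.tree.V} (h : P.tree.IsParent p v) :
    P.height v = P.height p + P.wt p v := by
  unfold height pathSum
  rw [path_of_isParent h, SimpleGraph.Walk.darts_concat, wt_of_adj h.adj]
  simp [idxAt, SimpleGraph.Dart.edge]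

theorem height_le_of_adj {a b : P.tree.V} (h : P.tree.graph.Adj a b) :
    P.height b ≤ P.height a + P.wt a b := by
  rcases isParent_or_isParent h with h | h
  · rw [height_of_isParent h]
  · rw [height_of_isParent h]; omega

/-- `a` and `b` are joined by an edge of index zero. -/
def ZeroAdj (P : IndexedTree.{u}) (a b : P.tree.V) : Prop := P.tree.graph.Adj a b ∧ P.wt a b = 0

theorem ZeroAdj.symm {a b : P.tree.V} (h : P.ZeroAdj a b) : P.ZeroAdj b a :=
  ⟨h.1.symm, by rw [wt_comm, h.2]⟩

/-- Distinct black vertices are not joined by a walk with edges of index zero. -/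
def ZeroSeparated (P : IndexedTree.{u}) : Prop :=
  ∀ a ∈ P.tree.black, ∀ b ∈ P.tree.black, Relation.ReflTransGen P.ZeroAdj a b → a = b

/-- With `a` as the root, heights do not grow along edges of index zero, so a walk of such edges
from `a` to `b` forces the sum over the path between them to vanish. -/
theorem zeroSeparated_of_essentiallyPositive (h : P.tree.EssentiallyPositive P.idx) :
    P.ZeroSeparated := by
  intro a ha b hb hab
  by_contra hne
  have key : (P.reroot a).height b = 0 := by
    clear hb hne
    induction hab with
    | refl => exact (P.reroot a).height_root
    | tail _ h ih =>
      rename_i c d _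
      have h1 : (P.reroot a).height d ≤ (P.reroot a).height c + P.wt c d :=
        height_le_of_adj (P := P.reroot a) h.1
      rw [h.2, ih] at h1
      omega
  exact (h a ha b hb hne).ne' key

/-- The values of a part of a tree: an element of the shuffle algebra, and the number of the black
vertices at distance zero from its root, the factors of which have not been inserted yet. -/
abbrev BranchValue : Type := Shuffle × Multiplicative ℕ

namespace BranchValue

/-- The number of the pending black vertices. -/
def pending (a : BranchValue) : ℕ := a.2.toAdd

/-- The first letter to be inserted: `y` if a black vertex is pending. -/
def next (n : ℕ) : Letter := if n = 0 then Letter.x else Letter.y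

theorem next_zero : next 0 = Letter.x := rfl

theorem next_one : next 1 = Letter.y := rfl

/-- The value of a black vertex. -/
def dot : BranchValue := (1, Multiplicative.ofAdd 1)

/-- The action of an index. -/
def act (k : ℕ) (a : BranchValue) : BranchValue :=
  -- A positive index writes `k` letters: first the `y` of a pending black vertex, or `x` if there
  -- is none, then only `x`. Afterwards nothing is pending.
  if k = 0 then a
    else (Shuffle.of (a.1.val * HAlg.letter (next a.pending) * HAlg.X ^ (k - 1)), 1)

theorem pending_mul (a b : BranchValue) : (a * b).pending = a.pending + b.pending := rfl

theorem pending_one : pending 1 = 0 := rfl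

theorem pending_dot : pending dot = 1 := rfl

theorem pending_prod {ι : Type*} (s : Finset ι) (f : ι → BranchValue) :
    (∏ i ∈ s, f i).pending = ∑ i ∈ s, (f i).pending := by
  classical
  induction s using Finset.induction_on with
  | empty => rfl
  | insert a s ha ih => rw [Finset.prod_insert ha, Finset.sum_insert ha, pending_mul, ih]

theorem act_zero (a : BranchValue) : act 0 a = a := if_pos rfl

theorem pending_act (k : ℕ) (a : BranchValue) :
    (act k a).pending = if k = 0 then a.pending else 0 := by
  unfold act
  split_ifs <;> rfl

theorem fst_act_succ (k : ℕ) (a : BranchValue) :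
    (act (k + 1) a).1.val = a.1.val * HAlg.letter (next a.pending) * HAlg.X ^ k := by
  simp [act]

/-- After a positive index nothing is pending, so the index that acts next adds only letters `x`. -/
theorem act_add (i j : ℕ) (a : BranchValue) : act (i + j) a = act i (act j a) := by
  rcases Nat.eq_zero_or_pos i with rfl | hi
  · rw [act_zero, zero_add]
  rcases Nat.eq_zero_or_pos j with rfl | hj
  · rw [act_zero, add_zero]
  obtain ⟨i, rfl⟩ := Nat.exists_eq_succ_of_ne_zero hi.ne'
  obtain ⟨j, rfl⟩ := Nat.exists_eq_succ_of_ne_zero hj.ne'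
  refine Prod.ext ?_ ?_
  · change (act _ _).1.val = (act _ _).1.val
    have h0 : (act (j + 1) a).pending = 0 := by simp [pending_act]
    rw [Nat.succ_eq_add_one, Nat.succ_eq_add_one, fst_act_succ i, fst_act_succ j, h0, next_zero,
      ← HAlg.X, show i + 1 + (j + 1) = i + j + 1 + 1 by omega, fst_act_succ]
    simp only [mul_assoc, ← pow_succ', ← pow_add]
    congr 3
    omega
  · have h1 : (act (i.succ + j.succ) a).pending = (act i.succ (act j.succ a)).pending := by
      simp [pending_act]
    exact h1

end BranchValue

open BranchValue

/-- The value of the part of the tree above a vertex. -/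
def value (P : IndexedTree.{u}) (v : P.tree.V) : BranchValue := eval dot act P v

theorem value_eq (P : IndexedTree.{u}) (v : P.tree.V) :
    P.value v = color dot P v * ∏ c ∈ P.tree.children v, act (P.wt v c) (P.value c) :=
  eval_eq _ _ _ _

/-- In a harvestable pair an edge of index zero leads from a black vertex to a white child. A black
child therefore gets its `y` on the edge to its parent, where `y x ^ (k - 1)` is the factor `z k` of
`branch`, and no black vertex stays pending below itself. -/
theorem IsHarvestable.value_eq (hP : P.IsHarvestable) (v : P.tree.V) :
    (P.value v).1.val = P.branch v ∧ (P.value v).pending = (color dot P v).pending := by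
  classical
  induction v using children_induction with
  | h v ih =>
    constructor
    · rw [branch, IndexedTree.value_eq, ← Finset.prod_attach, Prod.fst_mul, Prod.fst_prod,
        ← Finset.prod_map_toList]
      have hcol : (color dot P v).1 = 1 := by
        unfold color
        split_ifs <;> rfl
      rw [hcol, one_mul, Shuffle.val_list_prod, List.map_map]
      congr 1
      refine List.map_congr_left fun c _ => ?_
      have hc := mem_children.1 c.2
      obtain ⟨ih1, ih2⟩ := ih c hc
      simp only [Function.comp_apply]
      rw [← wt_of_adj hc.adj]
      rcases hk : P.wt v c with _ | k
      · have hcb : c.1 ∉ P.tree.black := by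
          intro hcb
          rw [wt_of_adj hc.adj] at hk
          by_cases hv : v ∈ P.tree.black
          · exact (hP.pos_of_black v c hc.adj hv hcb).ne' hk
          · exact (hP.pos_of_white_parent v c hc hv).ne' hk
        simp [hcb, act_zero, ih1]
      · rw [fst_act_succ, ih1, ih2]
        by_cases hcb : c.1 ∈ P.tree.black
        · simp [color, hcb, pending_dot, next_one, HAlg.z, HAlg.Y, mul_assoc]
        · simp [color, hcb, pending_one, next_zero, HAlg.X, pow_succ', mul_assoc]
    · rw [IndexedTree.value_eq, pending_mul, pending_prod, Finset.sum_eq_zero, add_zero]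
      intro c hc
      rw [mem_children] at hc
      rw [pending_act]
      split_ifs with hk
      · rw [wt_of_adj hc.adj] at hk
        rw [(ih c hc).2]
        by_cases hcb : c ∈ P.tree.black
        · by_cases hv : v ∈ P.tree.black
          · exact absurd hk (hP.pos_of_black v c hc.adj hv hcb).ne'
          · exact absurd hk (hP.pos_of_white_parent v c hc hv).ne'
        · simp [color, hcb, pending_one]
      · rfl

/-- At most one black vertex is pending at each vertex. -/
theorem ZeroSeparated.pending_le (hP : P.ZeroSeparated) (v : P.tree.V) :
    (P.value v).pending ≤ 1 := by
  classical
  -- The black vertices pending at `v` are among those above `v` that edges of index zero connect to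
  -- `v`. Separation allows only one of these.
  let S (v : P.tree.V) : Finset P.tree.V := Finset.univ.filter fun b =>
    b ∈ P.tree.black ∧ P.tree.IsAncestor v b ∧ Relation.ReflTransGen P.ZeroAdj v b
  have hS : ∀ {v b}, b ∈ S v ↔ b ∈ P.tree.black ∧ P.tree.IsAncestor v b ∧
      Relation.ReflTransGen P.ZeroAdj v b := by simp [S]
  have key : ∀ v, (P.value v).pending ≤ (S v).card := by
    intro v
    induction v using children_induction with
    | h v ih =>
      let T (c : P.tree.V) : Finset P.tree.V := if P.wt v c = 0 then S c else ∅
      have hT : ∀ c b, b ∈ T c → P.wt v c = 0 ∧ b ∈ S c := by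
        intro c b hb
        by_cases hk : P.wt v c = 0 <;> simp_all [T]
      rw [value_eq, pending_mul, pending_prod]
      have h1 : ∑ c ∈ P.tree.children v, (act (P.wt v c) (P.value c)).pending
          ≤ ((P.tree.children v).biUnion T).card := by
        rw [Finset.card_biUnion]
        · refine Finset.sum_le_sum fun c hc => ?_
          rw [pending_act]
          by_cases hk : P.wt v c = 0
          · simpa [hk, T] using ih c (mem_children.1 hc)
          · simp [hk]
        · intro c hc d hd hcd
          change Disjoint (T c) (T d)
          rw [Finset.disjoint_left]
          intro b hb hb'
          refine hcd (IsAncestor.eq_of_depth_eq (hS.1 (hT _ _ hb).2).2.1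
            (hS.1 (hT _ _ hb').2).2.1 ?_)
          rw [(mem_children.1 hc).depth_eq, (mem_children.1 hd).depth_eq]
      have h2 : (P.tree.children v).biUnion T ⊆ (S v).erase v := by
        intro b hb
        obtain ⟨c, hc, hb⟩ := Finset.mem_biUnion.1 hb
        rw [mem_children] at hc
        obtain ⟨hk, hb⟩ := hT _ _ hb
        obtain ⟨hb1, hb2, hb3⟩ := hS.1 hb
        refine Finset.mem_erase.2 ⟨?_, hS.2 ⟨hb1, .head hc hb2, .head ⟨hc.adj, hk⟩ hb3⟩⟩
        rintro rfl
        have := hc.depth_eq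
        have := hb2.depth_le
        omega
      have h3 := Finset.card_le_card h2
      by_cases hv : v ∈ P.tree.black
      · have hvS : v ∈ S v := hS.2 ⟨hv, .refl, .refl⟩
        rw [Finset.card_erase_of_mem hvS] at h3
        have := Finset.card_pos.2 ⟨v, hvS⟩
        simp only [color, hv, if_true, pending_dot]
        omega
      · have := Finset.card_erase_le (s := S v) (a := v)
        simp only [color, hv, if_false, pending_one]
        omega
  refine (key v).trans (Finset.card_le_one.2 fun a ha b hb => ?_)
  obtain ⟨ha1, -, ha3⟩ := hS.1 ha
  obtain ⟨hb1, -, hb3⟩ := hS.1 hb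
  refine hP a ha1 b hb1 (Relation.ReflTransGen.trans ?_ hb3)
  clear ha1 ha
  induction ha3 with
  | refl => exact .refl
  | tail _ h ih => exact .head h.symm ih

end IndexedTree
end

/-! ## The symmetrization map and the change of the root -/

noncomputable section

namespace IndexedTree

open TwoColoredRootedTree BranchValue

variable {P : IndexedTree.{u}}

/-- The value of the part of the tree above `v` when `r` is taken as the root. -/
def valueFrom (P : IndexedTree.{u}) (r v : P.tree.V) : BranchValue := (P.reroot r).value v

/-- `p` is the parent of `v` when `r` is taken as the root. -/
def IsParentFrom (P : IndexedTree.{u}) (r p v : P.tree.V) : Prop := (P.tree.reroot r).IsParent p v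

/-- The children of `v` when `r` is taken as the root. -/
def childrenFrom (P : IndexedTree.{u}) (r v : P.tree.V) : Finset P.tree.V :=
  (P.tree.reroot r).children v

theorem mem_childrenFrom {r v c : P.tree.V} : c ∈ P.childrenFrom r v ↔ P.IsParentFrom r v c :=
  mem_children (X := P.tree.reroot r)

theorem isParentFrom_self {v c : P.tree.V} : P.IsParentFrom v v c ↔ P.tree.graph.Adj v c :=
  isParent_root_iff (X := P.tree.reroot v)

theorem IsParentFrom.isParentFrom_iff {r p v : P.tree.V} (h : P.IsParentFrom r p v) {c : P.tree.V} :
    P.IsParentFrom r v c ↔ P.tree.graph.Adj v c ∧ c ≠ p :=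
  IsParent.isParent_iff (X := P.tree.reroot r) h

theorem valueFrom_eq (r v : P.tree.V) :
    P.valueFrom r v = color dot P v *
      ∏ c ∈ P.childrenFrom r v, act (P.wt v c) (P.valueFrom r c) :=
  (P.reroot r).value_eq v

/-- The part above `v` depends only on the direction `p` in which the root lies. -/
theorem valueFrom_congr {r r' p v : P.tree.V} (h : P.IsParentFrom r p v)
    (h' : P.IsParentFrom r' p v) : P.valueFrom r v = P.valueFrom r' v := by
  have step : ∀ v : P.tree.V, (∀ c, P.IsParentFrom r v c → ∀ p, P.IsParentFrom r p c →
        P.IsParentFrom r' p c → P.valueFrom r c = P.valueFrom r' c) →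
      ∀ p, P.IsParentFrom r p v → P.IsParentFrom r' p v → P.valueFrom r v = P.valueFrom r' v := by
    intro v ih p h h'
    have hch : P.childrenFrom r v = P.childrenFrom r' v := by
      ext c
      rw [mem_childrenFrom, mem_childrenFrom, h.isParentFrom_iff, h'.isParentFrom_iff]
    rw [valueFrom_eq, valueFrom_eq, ← hch]
    congr 1
    refine Finset.prod_congr rfl fun c hc => ?_
    rw [ih c (mem_childrenFrom.1 hc) v (mem_childrenFrom.1 hc)
      (mem_childrenFrom.1 (by rw [← hch]; exact hc))]
  exact children_induction (X := P.tree.reroot r) step v p h h'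

open Classical in
/-- The set of the parents of a vertex, which has at most one element. -/
def parents (P : IndexedTree.{u}) (v : P.tree.V) : Finset P.tree.V :=
  Finset.univ.filter fun p => P.tree.IsParent p v

theorem mem_parents {p v : P.tree.V} : p ∈ P.parents v ↔ P.tree.IsParent p v := by
  simp [parents]

theorem disjoint_children_parents (v : P.tree.V) :
    Disjoint (P.tree.children v) (P.parents v) := by
  rw [Finset.disjoint_left]
  intro c hc hc'
  exact (mem_children.1 hc).asymm (mem_parents.1 hc')

/-- The value of the part of the tree that is not above `v`. -/
def coValue (P : IndexedTree.{u}) (v : P.tree.V) : BranchValue :=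
  ∏ p ∈ P.parents v, act (P.wt v p) (P.valueFrom v p)

theorem coValue_root (P : IndexedTree.{u}) : P.coValue P.tree.root = 1 := by
  refine Finset.prod_eq_one fun p hp => ?_
  exact absurd (mem_parents.1 hp) (not_isParent_root p)

theorem coValue_of_isParent {p v : P.tree.V} (h : P.tree.IsParent p v) :
    P.coValue v = act (P.wt p v) (P.valueFrom v p) := by
  have : P.parents v = {p} := by
    ext q
    rw [mem_parents, Finset.mem_singleton]
    exact ⟨fun hq => hq.unique h, fun hq => hq ▸ h⟩
  rw [coValue, this, Finset.prod_singleton, wt_comm]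

theorem value_eq_valueFrom {v c : P.tree.V} (h : P.tree.IsParent v c) :
    P.value c = P.valueFrom v c :=
  valueFrom_congr (r := P.tree.root) h (isParentFrom_self.2 h.adj)

open Classical in
theorem valueFrom_self (v : P.tree.V) : P.valueFrom v v = P.value v * P.coValue v := by
  have hch : P.childrenFrom v v = P.tree.children v ∪ P.parents v := by
    ext c
    rw [Finset.mem_union, mem_childrenFrom, mem_children, mem_parents, isParentFrom_self,
      adj_iff_isParent]
  rw [valueFrom_eq, hch, Finset.prod_union (disjoint_children_parents v), coValue, value_eq,
    mul_assoc]
  congr 2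
  exact Finset.prod_congr rfl fun c hc => by rw [value_eq_valueFrom (mem_children.1 hc)]

open Classical in
-- Seen from the child `c`, the vertex `v` loses `c` as a child, and its former parent, if any,
-- becomes one.
theorem valueFrom_child {v c : P.tree.V} (h : P.tree.IsParent v c) :
    P.valueFrom c v = color dot P v * P.coValue v *
      ∏ d ∈ (P.tree.children v).erase c, act (P.wt v d) (P.value d) := by
  have hcv : P.IsParentFrom c c v := isParentFrom_self.2 h.adj.symm
  have hch : P.childrenFrom c v = (P.tree.children v).erase c ∪ P.parents v := by
    ext d
    rw [Finset.mem_union, Finset.mem_erase, mem_childrenFrom, mem_children, mem_parents,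
      hcv.isParentFrom_iff, adj_iff_isParent]
    constructor
    · rintro ⟨h1 | h1, h2⟩
      · exact Or.inl ⟨h2, h1⟩
      · exact Or.inr h1
    · rintro (⟨h2, h1⟩ | h1)
      · exact ⟨Or.inl h1, h2⟩
      · refine ⟨Or.inr h1, ?_⟩
        rintro rfl
        exact h1.asymm h
  have hval : ∀ d, P.tree.graph.Adj v d → d ≠ c → P.valueFrom c d = P.valueFrom v d :=
    fun d hd hdc => valueFrom_congr (hcv.isParentFrom_iff.2 ⟨hd, hdc⟩) (isParentFrom_self.2 hd)
  rw [valueFrom_eq, hch, Finset.prod_union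
    ((disjoint_children_parents v).mono_left (Finset.erase_subset _ _)), coValue,
    mul_assoc (color dot P v), mul_comm (∏ p ∈ P.parents v, _)]
  congr 2
  · refine Finset.prod_congr rfl fun d hd => ?_
    obtain ⟨hdc, hd⟩ := Finset.mem_erase.1 hd
    rw [mem_children] at hd
    rw [hval d hd.adj hdc, value_eq_valueFrom hd]
  · refine Finset.prod_congr rfl fun p hp => ?_
    have hp := mem_parents.1 hp
    rw [hval p hp.adj.symm]
    rintro rfl
    exact hp.asymm h

/-- The sum, up to the sign at `v`, of the signed values of the trees whose root is a black vertex
above `v`. -/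
def rerootSum (P : IndexedTree.{u}) (v : P.tree.V) : HAlg :=
  if (P.coValue v).pending = 0
    then HAlg.cut ((P.value v).1.val * HAlg.letter (next (P.value v).pending)) (P.coValue v).1.val
    else -HAlg.cut (P.value v).1.val ((P.coValue v).1.val * HAlg.Y)

/-! ### Signed sums over the changes of the root -/

theorem ZeroSeparated.reroot (hP : P.ZeroSeparated) (r : P.tree.V) : (P.reroot r).ZeroSeparated :=
  hP

/-- With `v` as the root, the pending vertices of both sides are pending together. -/
theorem pending_add_le (hP : P.ZeroSeparated) (v : P.tree.V) :
    (P.value v).pending + (P.coValue v).pending ≤ 1 := by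
  rw [← pending_mul, ← valueFrom_self]
  exact (hP.reroot v).pending_le v

/-- One formula for both cases of `rerootSum`. At most one vertex is pending in all at `v`. If it
lies above `v`, its `y` can itself be cut, which gives the first term; if it lies on the other side,
its `y` belongs to the second argument and cannot be cut. -/
theorem rerootSum_eq (hP : P.ZeroSeparated) (v : P.tree.V) :
    P.rerootSum v = ((P.value v).pending : ℚ) • (P.valueFrom v v).1.val
      - HAlg.cut (P.value v).1.val
        ((P.coValue v).1.val * HAlg.letter (next (P.valueFrom v v).pending)) := by
  have h := pending_add_le hP v
  rw [valueFrom_self, pending_mul, rerootSum]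
  rcases Nat.eq_zero_or_pos (P.coValue v).pending with h0 | h0
  · rw [if_pos h0, h0, add_zero]
    rcases Nat.le_one_iff_eq_zero_or_eq_one.1 ((Nat.le_add_right _ _).trans h) with h1 | h1
    · simpa [h1, next_zero, HAlg.X] using HAlg.cut_mul_X (P.value v).1.val (P.coValue v).1.val
    · simpa [h1, next_one, HAlg.Y] using HAlg.cut_mul_Y (P.value v).1.val (P.coValue v).1.val
  · have h1 : (P.coValue v).pending = 1 := by omega
    have h2 : (P.value v).pending = 0 := by omega
    simp [h1, h2, next_one, HAlg.Y]

open Classical in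
-- The contribution of a child in the form that `cut_prod` produces at `v`: the branch of `c`, with
-- the letters of its edge, is cut against the rest of the tree seen from `c`.
theorem rerootSum_child (hP : P.ZeroSeparated) {v c : P.tree.V} (h : P.tree.IsParent v c) :
    (-1 : ℚ) ^ P.wt v c • P.rerootSum c
      = ((act (P.wt v c) (P.value c)).pending : ℚ) • (P.valueFrom v v).1.val
        - HAlg.cut (act (P.wt v c) (P.value c)).1.val
          ((P.valueFrom c v).1.val * HAlg.letter (next (P.valueFrom v v).pending)) := by
  have hmul : P.valueFrom v v = P.valueFrom c v * act (P.wt v c) (P.value c) := by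
    rw [valueFrom_self, valueFrom_child h, value_eq, mul_assoc _ _ (act _ _),
      Finset.prod_erase_mul (P.tree.children v) (fun d => act (P.wt v d) (P.value d))
        (mem_children.2 h)]
    ac_rfl
  have hco := coValue_of_isParent h
  rcases hk : P.wt v c with _ | k
  -- Across an edge of index zero the tree has the same value seen from `v` and from `c`, so this is
  -- `rerootSum_eq` at `c`.
  · rw [hk, act_zero] at hmul hco
    rw [rerootSum_eq hP, valueFrom_self c, act_zero, hco, hmul, mul_comm (P.valueFrom c v)]
    simp
  -- For index `k + 1`, moving `x ^ k` through the cut gives the sign `(-1) ^ k`; the remaining sign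
  -- is the minus in front of `cut`. Nothing is pending after the edge on either side.
  · rw [hk] at hmul hco
    have hp : (act (k + 1) (P.value c)).pending = 0 := by simp [pending_act]
    have hp' : (P.coValue c).pending = 0 := by rw [hco]; simp [pending_act]
    rw [rerootSum, if_pos hp', hp, hmul, pending_mul, hp, add_zero, fst_act_succ, hco,
      fst_act_succ, HAlg.cut_mul_X_pow]
    simp [pow_succ]

open Classical in
-- The value of `v` is the product over its children, so `cut_prod` distributes the cut over them,
-- and `valueFrom_child` identifies the uncut factors. The pending numbers add up too; that of `v`
-- itself yields the term of a black `v`.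
theorem rerootSum_recursion (hP : P.ZeroSeparated) (v : P.tree.V) :
    P.rerootSum v = (if v ∈ P.tree.black then (P.valueFrom v v).1.val else 0)
      + ∑ c ∈ P.tree.children v, (-1 : ℚ) ^ P.wt v c • P.rerootSum c := by
  have h1 : (P.value v).1
      = ∏ c ∈ P.tree.children v, (act (P.wt v c) (P.value c)).1 := by
    rw [value_eq, Prod.fst_mul, Prod.fst_prod]
    have hcol : (color dot P v).1 = 1 := by
      unfold color
      split_ifs <;> rfl
    rw [hcol, one_mul]
  have h2 : (P.value v).pending = (color dot P v).pending
      + ∑ c ∈ P.tree.children v, (act (P.wt v c) (P.value c)).pending := by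
    rw [value_eq, pending_mul, pending_prod]
  have h3 : ((color dot P v).pending : ℚ) • (P.valueFrom v v).1.val
      = if v ∈ P.tree.black then (P.valueFrom v v).1.val else 0 := by
    by_cases hv : v ∈ P.tree.black <;> simp [color, hv, pending_dot, pending_one]
  rw [Finset.sum_congr rfl fun c hc => rerootSum_child hP (mem_children.1 hc),
    Finset.sum_sub_distrib, rerootSum_eq hP, h1, HAlg.cut_prod, h2, ← h3, Nat.cast_add,
    Nat.cast_sum, add_smul, Finset.sum_smul, add_sub_assoc]
  congr 2
  refine Finset.sum_congr rfl fun c hc => ?_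
  rw [valueFrom_child (mem_children.1 hc), Prod.fst_mul, Prod.fst_mul, Prod.fst_prod]
  have hcol : (color dot P v).1 = 1 := by
    unfold color
    split_ifs <;> rfl
  rw [hcol, one_mul]

open Classical in
/-- The symmetrization of the value of a tree is the signed sum of the values of the trees that
are obtained by changing the root to a black vertex. -/
theorem cut_value_root (hP : P.ZeroSeparated) (hroot : P.tree.root ∈ P.tree.black) :
    HAlg.cut ((P.value P.tree.root).1.val * HAlg.Y) 1
      = ∑ v : P.tree.V, if v ∈ P.tree.black
          then (-1 : ℚ) ^ P.height v • (P.valueFrom v v).1.val else 0 := by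
  let T (v : P.tree.V) : HAlg := (-1 : ℚ) ^ P.height v • P.rerootSum v
  have hT : ∀ v, T v = (if v ∈ P.tree.black
        then (-1 : ℚ) ^ P.height v • (P.valueFrom v v).1.val else 0)
      + ∑ c ∈ P.tree.children v, T c := by
    intro v
    simp only [T]
    rw [rerootSum_recursion hP v, smul_add, Finset.smul_sum, smul_ite, smul_zero]
    congr 1
    refine Finset.sum_congr rfl fun c hc => ?_
    rw [smul_smul, ← pow_add, height_of_isParent (mem_children.1 hc)]
  -- Every vertex except for the root is a child of exactly one vertex, so in the sum of the
  -- recursions over all vertices only the term at the root survives.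
  have hsum : ∑ v, ∑ c ∈ P.tree.children v, T c = ∑ c ∈ Finset.univ.erase P.tree.root, T c := by
    rw [← Finset.sum_biUnion]
    · refine Finset.sum_congr ?_ fun _ _ => rfl
      ext c
      simp only [Finset.mem_biUnion, Finset.mem_univ, true_and, mem_children, Finset.mem_erase,
        and_true]
      exact ⟨fun ⟨p, hp⟩ => hp.ne_root, exists_isParent⟩
    · intro a _ b _ hab
      change Disjoint _ _
      rw [Finset.disjoint_left]
      intro c hc hc'
      exact hab ((mem_children.1 hc).unique (mem_children.1 hc'))
  have htot := Finset.sum_congr (rfl : (Finset.univ : Finset P.tree.V) = _) fun v _ => hT v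
  rw [Finset.sum_add_distrib, hsum, ← Finset.add_sum_erase _ T (Finset.mem_univ P.tree.root)]
    at htot
  rw [← add_right_cancel htot]
  -- The root is black and hence pending, which makes the appended letter a `y`.
  have hp : (P.value P.tree.root).pending = 1 := by
    have h1 := pending_add_le hP P.tree.root
    have h2 : (P.value P.tree.root).pending = _ := congrArg pending (value_eq P _)
    rw [pending_mul] at h2
    simp only [color, hroot, if_true, pending_dot] at h2
    omega
  simp only [T, height_root, rerootSum, coValue_root, pending_one, hp, next_one]
  simp [HAlg.Y]

end IndexedTree
end

/-! ## Mirror symmetric trees -/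

noncomputable section

namespace IndexedTree

open TwoColoredRootedTree BranchValue

variable {P Q : IndexedTree.{u}}

theorem Iso.isParent_iff (e : Iso P Q) (p v : P.tree.V) :
    Q.tree.IsParent (e.toIso p) (e.toIso v) ↔ P.tree.IsParent p v := by
  refine (isParent_iff_of_rank (X := P.tree)
    (r := fun p v => Q.tree.IsParent (e.toIso p) (e.toIso v)) (fun v => Q.tree.depth (e.toIso v))
    (fun p v h => e.toIso.map_adj_iff.1 h.adj) (fun p v h => ?_) (fun v hv => ?_) p v).symm
  · rw [h.depth_eq]
    omega
  · obtain ⟨q, hq⟩ := exists_isParent (X := Q.tree) (v := e.toIso v) fun h =>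
      hv (e.toIso.injective (h.trans e.map_root.symm))
    exact ⟨e.toIso.symm q, by simpa using hq⟩

theorem Iso.value_eq (e : Iso P Q) (v : P.tree.V) : Q.value (e.toIso v) = P.value v := by
  refine eq_eval dot act (α := fun v => Q.value (e.toIso v)) (fun v => ?_) v
  have hch : Q.tree.children (e.toIso v) = (P.tree.children v).map e.toIso.toEquiv.toEmbedding := by
    ext q
    obtain ⟨c, rfl⟩ := e.toIso.surjective q
    rw [mem_children, e.isParent_iff, Finset.mem_map]
    constructor
    · exact fun h => ⟨c, mem_children.2 h, rfl⟩
    · rintro ⟨d, hd, hdc⟩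
      rw [← e.toIso.injective hdc]
      exact mem_children.1 hd
  have hcol : color dot Q (e.toIso v) = color dot P v := by
    have := e.map_black v
    by_cases hv : v ∈ P.tree.black <;> simp_all [color]
  rw [IndexedTree.value_eq, hch, Finset.prod_map, hcol]
  congr 1
  refine Finset.prod_congr rfl fun c hc => ?_
  have hadj := (mem_children.1 hc).adj
  have hadj' : Q.tree.graph.Adj (e.toIso v) (e.toIso c) := e.toIso.map_adj_iff.2 hadj
  have hw : Q.wt (e.toIso v) (e.toIso c) = P.wt v c := by
    rw [wt_of_adj hadj, wt_of_adj hadj', e.map_idx]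
  rw [← hw]
  rfl

/-- A permutation of the vertices that respects the edges, the colors and the index, and that
changes the parity of the sums of the index over the paths from the root. -/
structure IsMirror (P : IndexedTree.{u}) (σ : P.tree.graph ≃g P.tree.graph) : Prop where
  black_iff : ∀ v, σ v ∈ P.tree.black ↔ v ∈ P.tree.black
  wt_eq : ∀ a b, P.tree.graph.Adj a b → P.wt (σ a) (σ b) = P.wt a b
  odd : ∀ v, Odd (P.height v + P.height (σ v))

namespace IsMirror

variable {σ : P.tree.graph ≃g P.tree.graph}

/-- The isomorphism between the trees with the roots `v` and `σ v`. -/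
def iso (h : IsMirror P σ) (v : P.tree.V) : Iso (P.reroot v) (P.reroot (σ v)) where
  toIso := σ
  map_root := rfl
  map_black := h.black_iff
  map_idx a b hab hab' :=
    ((wt_of_adj (P := P) hab').symm.trans (h.wt_eq a b hab)).trans (wt_of_adj (P := P) hab)

theorem valueFrom_eq (h : IsMirror P σ) (v : P.tree.V) :
    P.valueFrom (σ v) (σ v) = P.valueFrom v v :=
  (h.iso v).value_eq v

theorem neg_one_pow (h : IsMirror P σ) (v : P.tree.V) :
    (-1 : ℚ) ^ P.height (σ v) = -(-1 : ℚ) ^ P.height v := by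
  have h1 := (h.odd v).neg_one_pow (α := ℚ)
  rw [pow_add] at h1
  rcases neg_one_pow_eq_or ℚ (P.height v) with h2 | h2 <;> rw [h2] at h1 ⊢ <;> linarith

/-- Reindexing by `σ` keeps the values and reverses the signs, so the sum equals its negative. -/
theorem cut_value_root (h : IsMirror P σ) (hP : P.ZeroSeparated)
    (hroot : P.tree.root ∈ P.tree.black) :
    HAlg.cut ((P.value P.tree.root).1.val * HAlg.Y) 1 = 0 := by
  classical
  rw [IndexedTree.cut_value_root hP hroot]
  refine self_eq_neg.1 ?_
  rw [← Finset.sum_neg_distrib]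
  refine Fintype.sum_equiv σ.toEquiv _ _ fun v => ?_
  change _ = -(if σ v ∈ _ then (-1 : ℚ) ^ P.height (σ v) • (P.valueFrom (σ v) (σ v)).1.val else 0)
  rw [h.valueFrom_eq, h.neg_one_pow]
  have := h.black_iff v
  by_cases hv : v ∈ P.tree.black <;> simp_all

/-- The same cancellation: `v` and `σ v` give the same basis element with opposite signs. -/
theorem phiMap_eq_zero {P : AdmissiblePair.{u}} {σ : P.1.tree.graph ≃g P.1.tree.graph}
    (h : IsMirror P.1 σ) : PhiMap P.toTwoCRT = 0 := by
  classical
  have hP : PhiMap P.toTwoCRT = P.symm := by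
    rw [PhiMap, AdmissiblePair.toTwoCRT, Finsupp.linearCombination_single, one_smul]
    rfl
  rw [hP]
  refine self_eq_neg.1 ?_
  unfold AdmissiblePair.symm
  rw [← Finset.sum_neg_distrib]
  refine Fintype.sum_equiv (σ.toEquiv.subtypeEquiv fun v => (h.black_iff v).symm) _ _ fun v => ?_
  have h1 := h.neg_one_pow v
  have h2 : (P.reroot (σ.toEquiv.subtypeEquiv (fun v => (h.black_iff v).symm) v)).toTwoCRT
      = (P.reroot v).toTwoCRT := by
    unfold AdmissiblePair.toTwoCRT
    rw [Quotient.sound (s := AdmissiblePair.setoid.{u}) (b := P.reroot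
      (σ.toEquiv.subtypeEquiv (fun v => (h.black_iff v).symm) v)) (a := P.reroot v) ⟨h.iso v⟩]
  rw [h2]
  change _ = -((-1 : ℚ) ^ P.1.height (σ v) • (P.reroot v).toTwoCRT)
  rw [h1, neg_smul, neg_neg]
  rfl

end IsMirror

/-- Modulo two it does not matter which end is the parent. -/
theorem even_height_of_adj {a b : P.tree.V} (h : P.tree.graph.Adj a b) :
    Even (P.height a + P.height b + P.wt a b) := by
  rcases isParent_or_isParent h with h | h
  · rw [height_of_isParent h]
    exact ⟨P.height a + P.wt a b, by ring⟩
  · rw [height_of_isParent h]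
    exact ⟨P.height b + P.wt a b, by rw [wt_comm b a]; ring⟩

/-- A tree that consists of two isomorphic parts joined by an edge of odd index between
corresponding vertices is mirror symmetric. -/
theorem exists_isMirror (P : IndexedTree.{u}) {V₁ V₂ B₁ B₂ : Set P.tree.V}
    {E₁ E₂ : Set (Sym2 P.tree.V)} (f : P.tree.graph.edgeSet)
    (hV : V₁ ∪ V₂ = Set.univ) (hVd : Disjoint V₁ V₂)
    (hE : E₁ ∪ E₂ ∪ {(f : Sym2 P.tree.V)} = P.tree.graph.edgeSet)
    (hB : B₁ ∪ B₂ = P.tree.black) (hB₁ : B₁ ⊆ V₁) (hB₂ : B₂ ⊆ V₂)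
    (hE₁ : ∀ e ∈ E₁, ∀ v ∈ e, v ∈ V₁) (hE₂ : ∀ e ∈ E₂, ∀ v ∈ e, v ∈ V₂) (F : V₁ ≃ V₂)
    (hFE : ∀ a b : V₁,
      s((a : P.tree.V), (b : P.tree.V)) ∈ E₁ ↔ s((F a : P.tree.V), (F b : P.tree.V)) ∈ E₂)
    (hFB : ∀ v : V₁, (v : P.tree.V) ∈ B₁ ↔ (F v : P.tree.V) ∈ B₂)
    (hfF : ∃ v : V₁, (f : Sym2 P.tree.V) = s((v : P.tree.V), (F v : P.tree.V)))
    (hodd : Odd (P.idx f))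
    (hwF : ∀ a b : V₁, P.tree.graph.Adj a b → P.tree.graph.Adj (F a) (F b) →
      P.wt a b = P.wt (F a) (F b)) :
    ∃ σ, IsMirror P σ := by
  classical
  have h2 : ∀ v, v ∉ V₁ → v ∈ V₂ := fun v hv =>
    ((Set.mem_union _ _ _).1 (hV ▸ Set.mem_univ v)).resolve_left hv
  have h1 : ∀ v, v ∈ V₂ → v ∉ V₁ := fun v hv hv' => Set.disjoint_left.1 hVd hv' hv
  -- The exchange of the two halves, `F` on one and its inverse on the other.
  let τ (v : P.tree.V) : P.tree.V :=
    if h : v ∈ V₁ then F ⟨v, h⟩ else F.symm ⟨v, h2 v h⟩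
  have hτ1 : ∀ a : V₁, τ a = F a := fun a => by simp [τ]
  have hτ2 : ∀ a : V₁, τ (F a) = a := fun a => by simp [τ, h1 _ (F a).2]
  have hcases : ∀ v : P.tree.V, ∃ a : V₁, v = a ∨ v = F a := fun v => by
    by_cases hv : v ∈ V₁
    · exact ⟨⟨v, hv⟩, Or.inl rfl⟩
    · exact ⟨F.symm ⟨v, h2 v hv⟩, Or.inr (by simp)⟩
  have hinv : Function.Involutive τ := fun v => by
    obtain ⟨a, rfl | rfl⟩ := hcases v
    · rw [hτ1, hτ2]
    · rw [hτ2, hτ1]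
  have hsub1 : ∀ {a b}, s(a, b) ∈ E₁ → P.tree.graph.Adj a b := fun h => by
    rw [← SimpleGraph.mem_edgeSet, ← hE]
    exact Or.inl (Or.inl h)
  have hsub2 : ∀ {a b}, s(a, b) ∈ E₂ → P.tree.graph.Adj a b := fun h => by
    rw [← SimpleGraph.mem_edgeSet, ← hE]
    exact Or.inl (Or.inr h)
  obtain ⟨w, hw⟩ := hfF
  have hfw : P.tree.graph.Adj w (F w) := by
    rw [← SimpleGraph.mem_edgeSet, ← hw]
    exact f.2
  have hadj : ∀ a b, P.tree.graph.Adj a b →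
      P.tree.graph.Adj (τ a) (τ b) ∧ P.wt (τ a) (τ b) = P.wt a b := by
    intro a b hab
    have hab' := hab
    rw [← SimpleGraph.mem_edgeSet, ← hE] at hab'
    rcases hab' with (h | h) | h
    · have ha := hE₁ _ h a (by simp)
      have hb := hE₁ _ h b (by simp)
      lift a to V₁ using ha
      lift b to V₁ using hb
      have h' := hsub2 ((hFE a b).1 h)
      rw [hτ1, hτ1]
      exact ⟨h', (hwF a b hab h').symm⟩
    · have ha := hE₂ _ h a (by simp)
      have hb := hE₂ _ h b (by simp)
      obtain ⟨a, rfl⟩ : ∃ a' : V₁, (F a' : P.tree.V) = a := ⟨F.symm ⟨a, ha⟩, by simp⟩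
      obtain ⟨b, rfl⟩ : ∃ b' : V₁, (F b' : P.tree.V) = b := ⟨F.symm ⟨b, hb⟩, by simp⟩
      have h' := hsub1 ((hFE a b).2 h)
      rw [hτ2, hτ2]
      exact ⟨h', hwF a b h' hab⟩
    -- The edge `f` is mapped to itself with its ends exchanged.
    · rw [Set.mem_singleton_iff, hw] at h
      rcases Sym2.eq_iff.1 h with ⟨rfl, rfl⟩ | ⟨rfl, rfl⟩
      · rw [hτ1, hτ2]
        exact ⟨hfw.symm, wt_comm _ _⟩
      · rw [hτ1, hτ2]
        exact ⟨hfw, wt_comm _ _⟩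
  let σ : P.tree.graph ≃g P.tree.graph :=
    { toEquiv := hinv.toPerm
      map_rel_iff' := fun {a b} => by
        refine ⟨fun h => ?_, fun h => (hadj a b h).1⟩
        have := (hadj _ _ h).1
        change P.tree.graph.Adj (τ (τ a)) (τ (τ b)) at this
        rwa [hinv, hinv] at this }
  have hB1 : ∀ a : V₁, (a : P.tree.V) ∈ P.tree.black ↔ (a : P.tree.V) ∈ B₁ := fun a => by
    rw [← hB]
    exact or_iff_left fun h => h1 _ (hB₂ h) a.2
  have hB2 : ∀ a : V₂, (a : P.tree.V) ∈ P.tree.black ↔ (a : P.tree.V) ∈ B₂ := fun a => by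
    rw [← hB]
    exact or_iff_right fun h => h1 _ a.2 (hB₁ h)
  refine ⟨σ, fun v => ?_, fun a b h => (hadj a b h).2, ?_⟩
  · change τ v ∈ _ ↔ _
    obtain ⟨a, rfl | rfl⟩ := hcases v
    · rw [hτ1, hB1, hB2, hFB]
    · rw [hτ2, hB1, hB2, hFB]
  -- An edge and its image have the same index, so both heights change by the same parity.
  · have hstep : ∀ a b, P.tree.graph.Adj a b →
        (Odd (P.height a + P.height (τ a)) ↔ Odd (P.height b + P.height (τ b))) := by
      intro a b hab
      obtain ⟨hab', hk⟩ := hadj a b hab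
      have e1 := even_height_of_adj hab
      have e2 := even_height_of_adj hab'
      rw [hk] at e2
      rw [Nat.even_iff] at e1 e2
      rw [Nat.odd_iff, Nat.odd_iff]
      omega
    have hall : ∀ v, Odd (P.height v + P.height (τ v)) ↔
        Odd (P.height P.tree.root + P.height (τ P.tree.root)) := fun v => by
      induction v using parent_induction with
      | h0 => rfl
      | h v w h ih => rw [← hstep v w h.adj, ih]
    -- At the end `w` of `f`, the image `τ w` is the other end, and the parity is that of the index
    -- of `f`.
    have hw' : Odd (P.height w + P.height (τ w)) := by
      have e1 := even_height_of_adj hfw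
      have e2 : P.wt w (F w) = P.idx f := by
        rw [wt_of_adj hfw]
        unfold idxAt
        congr 1
        exact Subtype.ext hw.symm
      rw [e2] at e1
      rw [hτ1]
      rw [Nat.odd_iff] at hodd ⊢
      rw [Nat.even_iff] at e1
      omega
    exact fun v => (hall v).2 ((hall w).1 hw')

end IndexedTree

theorem HarvestablePair.phi_w (Y : HarvestablePair.{u}) :
    (HAlg.phi Y.w : HAlg) = HAlg.cut ((Y.1.value Y.1.tree.root).1.val * HAlg.Y) 1 := by
  rw [HAlg.phi_eq_cut, (Y.2.value_eq _).1]
  rfl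

theorem IndexedTree.IsHarvestableForm.value_root_eq {P Q : IndexedTree.{u}}
    (h : IndexedTree.IsHarvestableForm P Q) :
    Q.value Q.tree.root = P.value P.tree.root :=
  h.eval_root_eq IndexedTree.BranchValue.act_zero IndexedTree.BranchValue.act_add
end

/-! ## Construction of trees -/

noncomputable section

/-- The graph in which every vertex except for `r` is joined to its parent. -/
def parentGraph {V : Type u} (r : V) (par : V → V) : SimpleGraph V where
  Adj a b := a ≠ b ∧ ((b ≠ r ∧ par b = a) ∨ (a ≠ r ∧ par a = b))
  symm := ⟨fun _ _ h => ⟨h.1.symm, h.2.symm⟩⟩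
  loopless := ⟨fun _ h => h.1 rfl⟩

section ParentGraph

variable {V : Type u} {r : V} {par : V → V} {d : V → ℕ}

theorem parentGraph_adj (hd : ∀ v, v ≠ r → d (par v) < d v) {v : V} (hv : v ≠ r) :
    (parentGraph r par).Adj (par v) v := by
  refine ⟨fun h => ?_, Or.inl ⟨hv, rfl⟩⟩
  have := hd v hv
  rw [h] at this
  omega

theorem parent_edge_injective (hd : ∀ v, v ≠ r → d (par v) < d v) {v w : V} (hv : v ≠ r)
    (hw : w ≠ r) (h : s(par v, v) = s(par w, w)) : v = w := by
  rcases Sym2.eq_iff.1 h with ⟨-, h⟩ | ⟨h1, h2⟩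
  · exact h
  · have e1 := hd v hv
    have e2 := hd w hw
    rw [h1] at e1
    rw [← h2] at e2
    omega

/-- Parents lead to `r`, so the graph is connected. Sending a vertex other than `r` to the edge to
its parent is a bijection onto the edges, and the rank `d` makes it injective, so there is one edge
fewer than vertices. -/
theorem parentGraph_isTree [Finite V] (hd : ∀ v, v ≠ r → d (par v) < d v) :
    (parentGraph r par).IsTree := by
  classical
  have := Fintype.ofFinite V
  rw [SimpleGraph.isTree_iff_connected_and_card]
  constructor
  · have key : ∀ n v, d v = n → (parentGraph r par).Reachable r v := by
      intro n
      induction n using Nat.strong_induction_on with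
      | _ n ih =>
        intro v hv
        by_cases hvr : v = r
        · rw [hvr]
        · exact (ih (d (par v)) (hv ▸ hd v hvr) _ rfl).trans (parentGraph_adj hd hvr).reachable
    have : Nonempty V := ⟨r⟩
    exact ⟨fun v w => (key _ v rfl).symm.trans (key _ w rfl)⟩
  · have h : Nat.card {v : V // v ≠ r} = Nat.card (parentGraph r par).edgeSet := by
      refine Nat.card_congr (Equiv.ofBijective
        (fun v => ⟨s(par v.1, v.1), parentGraph_adj hd v.2⟩) ⟨fun v w h => ?_, ?_⟩)
      · exact Subtype.ext (parent_edge_injective hd v.2 w.2 (congrArg Subtype.val h))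
      · rintro ⟨e, he⟩
        induction e using Sym2.ind with
        | _ a b =>
          rcases he.2 with ⟨hb, h⟩ | ⟨ha, h⟩
          · exact ⟨⟨b, hb⟩, Subtype.ext (congrArg (s(·, b)) h)⟩
          · exact ⟨⟨a, ha⟩, Subtype.ext ((congrArg (s(·, a)) h).trans Sym2.eq_swap)⟩
    rw [← h, Nat.card_eq_fintype_card, Nat.card_eq_fintype_card, Fintype.card_subtype_compl]
    have : 0 < Fintype.card V := Fintype.card_pos_iff.2 ⟨r⟩
    simp
    omega

end ParentGraph

namespace IndexedTree

open TwoColoredRootedTree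

/-- A tree can be given by a root, the parents of the other vertices, the colors, and the index on
the edges to the parents. -/
theorem exists_of_parent {V : Type u} [Fintype V] (r : V) (par : V → V) (d : V → ℕ)
    (hd : ∀ v, v ≠ r → d (par v) < d v) (B : Set V) (hr : r ∈ B)
    (hB : ∀ v, v ∉ B → ∃ c, c ≠ r ∧ par c = v) (k : V → ℕ) :
    ∃ (Q : IndexedTree.{u}) (e : V ≃ Q.tree.V), e r = Q.tree.root ∧
      (∀ p v, Q.tree.IsParent (e p) (e v) ↔ v ≠ r ∧ par v = p) ∧
      (∀ v, e v ∈ Q.tree.black ↔ v ∈ B) ∧ ∀ v, v ≠ r → Q.wt (e (par v)) (e v) = k v := by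
  classical
  -- All vertices are black at first, so that degrees are available before the terminals have to be
  -- shown black for the colors `B`.
  let T : TwoColoredRootedTree.{u} :=
    { V := V
      graph := parentGraph r par
      isTree := parentGraph_isTree hd
      root := r
      black := Set.univ
      terminal_black := fun _ _ => trivial }
  have hT : ∀ p v, T.IsParent p v ↔ v ≠ r ∧ par v = p :=
    isParent_iff_of_rank (X := T) (r := fun p v => v ≠ r ∧ par v = p) d
      (fun p v h => h.2 ▸ parentGraph_adj hd h.1) (fun p v h => h.2 ▸ hd v h.1)
      (fun v hv => ⟨par v, hv, rfl⟩)
  let T' : TwoColoredRootedTree.{u} :=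
    { T with
      black := B
      terminal_black := fun v hv => by
        by_contra hvB
        obtain ⟨c, hc⟩ := hB v hvB
        have hvr : v ≠ T.root := fun h => hvB (h ▸ hr)
        have h1 := deg_eq (X := T) v
        rw [if_neg hvr, deg, hv] at h1
        have h2 : (T.children v).Nonempty := ⟨c, mem_children.2 ((hT v c).2 hc)⟩
        have := Finset.card_pos.2 h2
        omega }
  let Q : IndexedTree.{u} :=
    { tree := T'
      -- Every edge has the form `{par v, v}` for exactly one `v`, so the choice is forced and the
      -- default `0` never occurs.
      idx := fun e => if h : ∃ v, v ≠ r ∧ s(par v, v) = e.1 then k h.choose else 0 }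
  refine ⟨Q, Equiv.refl V, rfl, hT, fun _ => Iff.rfl, fun v hv => ?_⟩
  have hadj : Q.tree.graph.Adj (par v) v := parentGraph_adj hd hv
  have hex : ∃ w, w ≠ r ∧ s(par w, w) = s(par v, v) := ⟨v, hv, rfl⟩
  have h1 : Q.idxAt hadj = k hex.choose := dif_pos hex
  change Q.wt (par v) v = k v
  rw [wt_of_adj hadj, h1, parent_edge_injective hd hex.choose_spec.1 hv hex.choose_spec.2]

/-! ### Deletion of a vertex -/

variable {P Q : IndexedTree.{u}}

theorem exists_child_of_white (hroot : P.tree.root ∈ P.tree.black) {v : P.tree.V}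
    (hv : v ∉ P.tree.black) : ∃ c, P.tree.IsParent v c := by
  classical
  have hvr : v ≠ P.tree.root := by
    rintro rfl
    exact hv hroot
  have h1 := deg_eq (X := P.tree) v
  rw [if_neg hvr] at h1
  have h2 : P.tree.deg v ≠ 1 := fun h => hv (P.tree.terminal_black v h)
  obtain ⟨c, hc⟩ := Finset.card_pos.1 (show 0 < (P.tree.children v).card by omega)
  exact ⟨c, mem_children.1 hc⟩

theorem exists_isDeletion (hroot : P.tree.root ∈ P.tree.black) {p c : P.tree.V}
    (hpc : P.tree.IsParent p c) (hb : c ∈ P.tree.black → p ∉ P.tree.black ∧ P.wt p c = 0)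
    (hw : P.wt p c = 0 ∨ (P.tree.children c).card = 1) : ∃ Q ι, IsDeletion P Q c ι := by
  classical
  have hex : ∀ v, ∃ q, v ≠ P.tree.root → P.tree.IsParent q v := fun v => by
    by_cases hv : v = P.tree.root
    · exact ⟨v, fun h => absurd hv h⟩
    · obtain ⟨q, hq⟩ := exists_isParent hv
      exact ⟨q, fun _ => hq⟩
  choose par hpar using hex
  have hpar' : ∀ q v, P.tree.IsParent q v ↔ v ≠ P.tree.root ∧ par v = q := fun q v =>
    ⟨fun h => ⟨h.ne_root, (hpar v h.ne_root).unique h⟩, fun h => h.2 ▸ hpar v h.1⟩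
  -- The children of `c` are handed over to `p`.
  let par' (v : {v : P.tree.V // v ≠ c}) : {v : P.tree.V // v ≠ c} :=
    if h : par v = c then ⟨p, hpc.adj.ne⟩ else ⟨par v, h⟩
  have hp1 : ∀ v : {v // v ≠ c}, par v = c → (par' v).1 = p := fun v h => by simp [par', h]
  have hp2 : ∀ v : {v // v ≠ c}, par v ≠ c → (par' v).1 = par v := fun v h => by simp [par', h]
  have hparc : par c = p := ((hpar' _ _).1 hpc).2
  have hrel : ∀ q v : {v // v ≠ c}, (v.1 ≠ P.tree.root ∧ par' v = q) ↔
      (P.tree.IsParent q.1 v.1 ∨ (P.tree.IsParent q.1 c ∧ P.tree.IsParent c v.1)) := by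
    intro q v
    rw [Subtype.ext_iff, hpar', hpar', hpar', hparc]
    by_cases h : par v = c
    · have hq : q.1 ≠ c := q.2
      rw [hp1 v h]
      simp [h, hq.symm, hpc.ne_root, and_comm]
    · rw [hp2 v h]
      simp [h]
  obtain ⟨Q, e, e1, e2, e3, e4⟩ := exists_of_parent (V := {v : P.tree.V // v ≠ c})
    ⟨P.tree.root, hpc.ne_root.symm⟩ par' (fun v => P.tree.depth v)
    (fun v hv => by
      rcases (hrel _ v).1 ⟨fun h => hv (Subtype.ext h), rfl⟩ with h | ⟨h, h'⟩
      · rw [h.depth_eq]; omega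
      · rw [h'.depth_eq, h.depth_eq]; omega)
    {v | v.1 ∈ P.tree.black ∨ (P.tree.IsParent v.1 c ∧ c ∈ P.tree.black)} (Or.inl hroot)
    -- A vertex that stays white needs a child. If the one found is `c`, then `c` is white, as it
    -- would have made `v` black, and a child of `c` serves instead.
    (fun v hv => by
      obtain ⟨x, hx⟩ := exists_child_of_white hroot fun h => hv (Or.inl h)
      by_cases hxc : x = c
      · subst hxc
        obtain ⟨y, hy⟩ := exists_child_of_white hroot fun h => hv (Or.inr ⟨hx, h⟩)
        have := (hrel v ⟨y, hy.adj.ne'⟩).2 (Or.inr ⟨hx, hy⟩)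
        exact ⟨_, fun h => this.1 (congrArg Subtype.val h), this.2⟩
      · have := (hrel v ⟨x, hxc⟩).2 (Or.inl hx)
        exact ⟨_, fun h => this.1 (congrArg Subtype.val h), this.2⟩)
    (fun v => if par v = c then P.wt p c + P.wt c v else P.wt (par v) v)
  have hroot' : ∀ v : {v // v ≠ c}, v ≠ ⟨P.tree.root, hpc.ne_root.symm⟩ ↔ v.1 ≠ P.tree.root :=
    fun v => not_congr Subtype.ext_iff
  have hwt : ∀ q v : {v // v ≠ c}, v.1 ≠ P.tree.root → par' v = q → Q.wt (e q) (e v)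
      = if par v = c then P.wt p c + P.wt c v else P.wt (par v) v := fun q v hv h => by
    rw [← h, e4 v ((hroot' v).2 hv)]
  refine ⟨Q, fun q => (e.symm q).1, Subtype.val_injective.comp e.symm.injective, ?_, ?_, ?_, ?_, ?_,
    ?_, ?_, ?_⟩
  · ext x
    constructor
    · rintro ⟨q, rfl⟩
      exact (e.symm q).2
    · exact fun hx => ⟨e ⟨x, hx⟩, by simp⟩
  · rw [← e1, Equiv.symm_apply_apply]
  · intro q v
    obtain ⟨q, rfl⟩ := e.surjective q
    obtain ⟨v, rfl⟩ := e.surjective v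
    rw [e2, hroot', Equiv.symm_apply_apply, Equiv.symm_apply_apply, hrel]
  · intro q v
    obtain ⟨q, rfl⟩ := e.surjective q
    obtain ⟨v, rfl⟩ := e.surjective v
    rw [Equiv.symm_apply_apply, Equiv.symm_apply_apply]
    intro h
    obtain ⟨h1, h2⟩ := (hrel q v).2 (Or.inl h)
    have h3 := ((hpar' _ _).1 h).2
    rw [hwt q v h1 h2, if_neg (by rw [h3]; exact q.2), h3]
  · intro q v
    obtain ⟨q, rfl⟩ := e.surjective q
    obtain ⟨v, rfl⟩ := e.surjective v
    rw [Equiv.symm_apply_apply, Equiv.symm_apply_apply]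
    intro h h'
    obtain ⟨h1, h2⟩ := (hrel q v).2 (Or.inr ⟨h, h'⟩)
    rw [hwt q v h1 h2, if_pos ((hpar' _ _).1 h').2, h.unique hpc]
  · intro q
    obtain ⟨q, rfl⟩ := e.surjective q
    rw [Equiv.symm_apply_apply, e3]
    rfl
  · intro q hq
    rw [hq.unique hpc]
    exact hb
  · intro q hq
    rw [hq.unique hpc]
    exact hw

namespace IsDeletion

variable {c : P.tree.V} {ι : Q.tree.V → P.tree.V}

theorem ne_deleted (h : IsDeletion P Q c ι) (q : Q.tree.V) : ι q ≠ c := by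
  have : ι q ∈ Set.range ι := ⟨q, rfl⟩
  rw [h.range_eq] at this
  exact this

theorem exists_eq (h : IsDeletion P Q c ι) {x : P.tree.V} (hx : x ≠ c) : ∃ q, ι q = x := by
  have : x ∈ Set.range ι := by rw [h.range_eq]; exact hx
  exact this

theorem card_lt (h : IsDeletion P Q c ι) : Fintype.card Q.tree.V < Fintype.card P.tree.V :=
  Fintype.card_lt_of_injective_of_notMem ι h.injective (b := c) (by rw [h.range_eq]; simp)

theorem isContraction (h : IsDeletion P Q c ι) {p : P.tree.V} (hpc : P.tree.IsParent p c)
    (h0 : P.wt p c = 0) : IsContraction P Q p c := by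
  classical
  -- The contraction map inverts `ι` and sends `c` to the image of `p`.
  have hex : ∀ x, ∃ q, ι q = if x = c then p else x := fun x => by
    refine h.exists_eq ?_
    split_ifs with hx
    · exact hpc.adj.ne
    · exact hx
  choose π hπ using hex
  have hπc : ι (π c) = p := by rw [hπ, if_pos rfl]
  have hπn : ∀ x, x ≠ c → ι (π x) = x := fun x hx => by rw [hπ, if_neg hx]
  have hπι : ∀ q, π (ι q) = q := fun q => h.injective (hπn _ (h.ne_deleted q))
  have hpp : π c = π p := h.injective (by rw [hπc, hπn p hpc.adj.ne])
  have hpar : ∀ x y, P.tree.IsParent x y → π x = π y ∨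
      (Q.tree.IsParent (π x) (π y) ∧ Q.wt (π x) (π y) = P.wt x y) := by
    intro x y hxy
    by_cases hy : y = c
    · subst hy
      left
      rw [hxy.unique hpc, hpp]
    · right
      by_cases hx : x = c
      · subst hx
        have e1 : P.tree.IsParent (ι (π x)) x := by rwa [hπc]
        have e2 : P.tree.IsParent x (ι (π y)) := by rwa [hπn y hy]
        refine ⟨(h.isParent_iff _ _).2 (Or.inr ⟨e1, e2⟩), ?_⟩
        rw [h.wt_eq' _ _ e1 e2, hπc, h0, zero_add, hπn y hy]
      · have e1 : P.tree.IsParent (ι (π x)) (ι (π y)) := by rwa [hπn x hx, hπn y hy]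
        refine ⟨(h.isParent_iff _ _).2 (Or.inl e1), ?_⟩
        rw [h.wt_eq _ _ e1, hπn x hx, hπn y hy]
  have hlift : ∀ q q', Q.tree.IsParent q q' → ∃ x y, π x = q ∧ π y = q' ∧ P.tree.IsParent x y := by
    intro q q' hq
    rcases (h.isParent_iff q q').1 hq with h' | ⟨h1, h2⟩
    · exact ⟨_, _, hπι q, hπι q', h'⟩
    · exact ⟨c, _, by rw [hpp, ← h1.unique hpc, hπι], hπι q', h2⟩
  refine ⟨π, fun q => ⟨_, hπι q⟩, fun x y => ?_, fun q q' => ?_, ?_, fun q => ?_, ?_⟩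
  · constructor
    · intro hxy
      have hxy' := congrArg ι hxy
      rw [hπ, hπ] at hxy'
      split_ifs at hxy' with hx hy hy
      · exact Or.inl (hx.trans hy.symm)
      · exact Or.inr (by rw [hx, hxy', Sym2.eq_swap])
      · exact Or.inr (by rw [hy, hxy'])
      · exact Or.inl hxy'
    · rintro (rfl | hs)
      · rfl
      · rcases Sym2.eq_iff.1 hs with ⟨rfl, rfl⟩ | ⟨rfl, rfl⟩
        · exact hpp.symm
        · exact hpp
  · constructor
    · refine fun hq => ⟨hq.ne, ?_⟩
      rcases isParent_or_isParent hq with hq | hq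
      · obtain ⟨x, y, hx, hy, hxy⟩ := hlift _ _ hq
        exact ⟨x, y, hx, hy, hxy.adj⟩
      · obtain ⟨x, y, hx, hy, hxy⟩ := hlift _ _ hq
        exact ⟨y, x, hy, hx, hxy.adj.symm⟩
    · rintro ⟨hne, x, y, rfl, rfl, hxy⟩
      rcases isParent_or_isParent hxy with hxy | hxy
      · exact ((hpar _ _ hxy).resolve_left hne).1.adj
      · exact ((hpar _ _ hxy).resolve_left hne.symm).1.adj.symm
  · rw [← h.map_root, hπι]
  · rw [h.black_iff]
    constructor
    · rintro (hq | ⟨hq, hc⟩)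
      · exact ⟨_, hq, hπι q⟩
      · exact ⟨c, hc, by rw [hpp, ← hq.unique hpc, hπι]⟩
    · rintro ⟨x, hx, rfl⟩
      by_cases hxc : x = c
      · subst hxc
        exact Or.inr ⟨by rwa [hπc], hx⟩
      · exact Or.inl (by rwa [hπn x hxc])
  · intro x y hxy hxy'
    rw [← wt_of_adj hxy, ← wt_of_adj hxy']
    rcases isParent_or_isParent hxy with h1 | h1
    · exact ((hpar _ _ h1).resolve_left hxy'.ne).2
    · rw [wt_comm, wt_comm x]
      exact ((hpar _ _ h1).resolve_left hxy'.ne').2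

theorem isJoin (h : IsDeletion P Q c ι) {p d : P.tree.V} (hpc : P.tree.IsParent p c)
    (hd : P.tree.children c = {d}) (hc : c ∉ P.tree.black) : IsJoin P Q c := by
  have hcd : P.tree.IsParent c d := mem_children.1 (by simp [hd])
  have hd' : ∀ x, P.tree.IsParent c x → x = d := fun x hx => by
    have := mem_children.2 hx
    rwa [hd, Finset.mem_singleton] at this
  have hsym : ∀ q q', s(ι q, ι q') = s(p, d) → Q.wt q q' = P.wt p c + P.wt c d := by
    intro q q' hs
    rcases Sym2.eq_iff.1 hs with ⟨h1, h2⟩ | ⟨h1, h2⟩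
    · rw [h.wt_eq' q q' (by rwa [h1]) (by rwa [h2]), h1, h2]
    · rw [wt_comm, h.wt_eq' q' q (by rwa [h2]) (by rwa [h1]), h1, h2]
  refine ⟨p, d, hpc.adj, hcd.adj, ι, fun hpd => hcd.asymm (hpd ▸ hpc), h.injective, h.range_eq,
    fun q q' => ?_, h.map_root, fun q => ?_, fun q q' hq hq' => ?_, fun q q' hq hs => ?_⟩
  · rw [adj_iff_isParent, h.isParent_iff, h.isParent_iff, adj_iff_isParent, Sym2.eq_iff]
    constructor
    · rintro ((h1 | ⟨h1, h2⟩) | h1 | ⟨h1, h2⟩)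
      · exact Or.inl (Or.inl h1)
      · exact Or.inr (Or.inl ⟨h1.unique hpc, hd' _ h2⟩)
      · exact Or.inl (Or.inr h1)
      · exact Or.inr (Or.inr ⟨hd' _ h2, h1.unique hpc⟩)
    · rintro ((h1 | h1) | ⟨h1, h2⟩ | ⟨h1, h2⟩)
      · exact Or.inl (Or.inl h1)
      · exact Or.inr (Or.inl h1)
      · exact Or.inl (Or.inr ⟨by rwa [h1], by rwa [h2]⟩)
      · exact Or.inr (Or.inr ⟨by rwa [h2], by rwa [h1]⟩)
  · rw [h.black_iff]
    exact or_iff_left fun h => hc h.2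
  · rw [← wt_of_adj hq, ← wt_of_adj hq']
    rcases isParent_or_isParent hq' with h1 | h1
    · exact h.wt_eq _ _ h1
    · rw [wt_comm, h.wt_eq _ _ h1, wt_comm]
  · rw [← wt_of_adj hq, ← wt_of_adj hpc.adj, ← wt_of_adj hcd.adj, hsym q q' hs]

end IsDeletion

end IndexedTree
end

/-! ## Existence of a harvestable form -/

noncomputable section

namespace IndexedTree

open TwoColoredRootedTree

variable {P Q : IndexedTree.{u}}

/-- Invariants of the contractions and the joinings of edges. -/
structure IsReducible (P : IndexedTree.{u}) : Prop where
  root_black : P.tree.root ∈ P.tree.black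
  zeroSeparated : P.ZeroSeparated
  exists_black : ∃ b ∈ P.tree.black, b ≠ P.tree.root

/-- An edge of index zero in `Q` lifts to one or two such edges in `P`, and a black vertex of `Q` is
black in `P` or joined there by index zero to the black `c`. So a violation of separation in `Q`
would give one in `P`. -/
theorem IsDeletion.isReducible {c : P.tree.V} {ι : Q.tree.V → P.tree.V}
    (h : IsDeletion P Q c ι) (hP : P.IsReducible) {p : P.tree.V} (hpc : P.tree.IsParent p c) :
    Q.IsReducible := by
  have hroot : Q.tree.root ∈ Q.tree.black :=
    (h.black_iff _).2 (Or.inl (h.map_root ▸ hP.root_black))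
  have hex : ∃ b ∈ Q.tree.black, b ≠ Q.tree.root := by
    obtain ⟨b, hb, hbr⟩ := hP.exists_black
    by_cases hbc : b = c
    -- If the second black vertex is deleted, its color passes to its parent, which was white and
    -- therefore is not the root.
    · subst hbc
      obtain ⟨q, rfl⟩ := h.exists_eq hpc.adj.ne
      refine ⟨q, (h.black_iff q).2 (Or.inr ⟨hpc, hb⟩), ?_⟩
      rintro rfl
      exact (h.not_black _ hpc hb).1 (h.map_root ▸ hP.root_black)
    · obtain ⟨q, rfl⟩ := h.exists_eq hbc
      refine ⟨q, (h.black_iff q).2 (Or.inl hb), ?_⟩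
      rintro rfl
      exact hbr h.map_root
  refine ⟨hroot, ?_, hex⟩
  · have hpar : ∀ q q', Q.tree.IsParent q q' → Q.wt q q' = 0 →
        Relation.ReflTransGen P.ZeroAdj (ι q) (ι q') ∧
        Relation.ReflTransGen P.ZeroAdj (ι q') (ι q) := by
      intro q q' hq h0
      rcases (h.isParent_iff q q').1 hq with h1 | ⟨h1, h2⟩
      · rw [h.wt_eq _ _ h1] at h0
        have hz : P.ZeroAdj (ι q) (ι q') := ⟨h1.adj, h0⟩
        exact ⟨.single hz, .single hz.symm⟩
      · rw [h.wt_eq' _ _ h1 h2] at h0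
        have hz1 : P.ZeroAdj (ι q) c := ⟨h1.adj, by omega⟩
        have hz2 : P.ZeroAdj c (ι q') := ⟨h2.adj, by omega⟩
        exact ⟨.head hz1 (.single hz2), .head hz2.symm (.single hz1.symm)⟩
    have hstep : ∀ q q', Q.ZeroAdj q q' → Relation.ReflTransGen P.ZeroAdj (ι q) (ι q') := by
      rintro q q' ⟨hq, h0⟩
      rcases isParent_or_isParent hq with h1 | h1
      · exact (hpar _ _ h1 h0).1
      · exact (hpar _ _ h1 (by rw [wt_comm, h0])).2
    have hblack : ∀ q ∈ Q.tree.black, ∃ b ∈ P.tree.black,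
        Relation.ReflTransGen P.ZeroAdj (ι q) b ∧ Relation.ReflTransGen P.ZeroAdj b (ι q) ∧
        (b = ι q ∨ (b = c ∧ ι q = p)) := by
      intro q hq
      rcases (h.black_iff q).1 hq with h1 | ⟨h1, h2⟩
      · exact ⟨_, h1, .refl, .refl, Or.inl rfl⟩
      · have hz : P.ZeroAdj (ι q) c := ⟨h1.adj, (h.not_black _ h1 h2).2⟩
        exact ⟨c, h2, .single hz, .single hz.symm, Or.inr ⟨rfl, h1.unique hpc⟩⟩
    intro a ha b hb hab
    obtain ⟨x, hx, -, hx1, hx2⟩ := hblack a ha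
    obtain ⟨y, hy, hy1, -, hy2⟩ := hblack b hb
    have hab' : Relation.ReflTransGen P.ZeroAdj (ι a) (ι b) := by
      clear hx1 hx2 hy1 hy2 hb
      induction hab with
      | refl => exact .refl
      | tail _ h ih => exact ih.trans (hstep _ _ h)
    have hxy := hP.zeroSeparated x hx y hy (hx1.trans (hab'.trans hy1))
    apply h.injective
    -- The mixed cases would make `c` a value of `ι`.
    rcases hx2 with rfl | ⟨rfl, h1⟩ <;> rcases hy2 with h2 | ⟨h2, h3⟩
    · exact hxy.trans h2
    · exact absurd (hxy.trans h2) (h.ne_deleted a)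
    · exact absurd (hxy.trans h2).symm (h.ne_deleted b)
    · exact h1.trans h3.symm

/-- An edge of index zero that cannot be contracted has two black ends, which separation forbids. -/
theorem ZeroSeparated.wt_pos (hP : P.ZeroSeparated) {a b : P.tree.V} (h : P.tree.graph.Adj a b)
    (hab : ¬ P.Contractible a b) (hba : ¬ P.Contractible b a) : 0 < P.wt a b := by
  by_contra h0
  have h0 : P.wt a b = 0 := by omega
  by_cases ha : a ∈ P.tree.black
  · by_cases hb : b ∈ P.tree.black
    · exact h.ne (hP a ha b hb (.single ⟨h, h0⟩))
    · exact hba ⟨hb, h.symm, by rw [← wt_of_adj, wt_comm, h0]⟩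
  · exact hab ⟨ha, h, by rw [← wt_of_adj, h0]⟩

theorem exists_contractStep (hP : P.IsReducible) {a b : P.tree.V} (h : P.Contractible a b) :
    ∃ Q, ContractStep P Q ∧ Q.IsReducible ∧
      Fintype.card Q.tree.V < Fintype.card P.tree.V := by
  have key : ∀ p c, P.tree.IsParent p c → P.wt p c = 0 → ∃ Q, IsContraction P Q p c ∧
      Q.IsReducible ∧ Fintype.card Q.tree.V < Fintype.card P.tree.V := by
    intro p c hpc h0
    obtain ⟨Q, ι, hQ⟩ := exists_isDeletion hP.root_black hpc
      (fun hc => ⟨fun hp => hpc.adj.ne (hP.zeroSeparated _ hp _ hc (.single ⟨hpc.adj, h0⟩)), h0⟩)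
      (Or.inl h0)
    exact ⟨Q, hQ.isContraction hpc h0, hQ.isReducible hP hpc, hQ.card_lt⟩
  have h' := h
  obtain ⟨-, hab, h0⟩ := h'
  rw [← wt_of_adj] at h0
  rcases isParent_or_isParent hab with h1 | h1
  · obtain ⟨Q, h2, h3⟩ := key a b h1 h0
    exact ⟨Q, ⟨a, b, h, h2⟩, h3⟩
  · obtain ⟨Q, h2, h3⟩ := key b a h1 (by rw [wt_comm, h0])
    exact ⟨Q, ⟨a, b, h, h2.swap⟩, h3⟩

theorem exists_contracted (hP : P.IsReducible) : ∃ Q, Relation.ReflTransGen ContractStep P Q ∧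
    (∀ a b, ¬ Q.Contractible a b) ∧ Q.IsReducible := by
  induction hn : Fintype.card P.tree.V using Nat.strong_induction_on generalizing P with
  | _ n ih =>
    by_cases h : ∃ a b, P.Contractible a b
    · obtain ⟨a, b, h⟩ := h
      obtain ⟨Q, h1, h2, h3⟩ := exists_contractStep hP h
      obtain ⟨R, h4, h5⟩ := ih _ (hn ▸ h3) h2 rfl
      exact ⟨R, .head h1 h4, h5⟩
    · push Not at h
      exact ⟨P, .refl, h, hP⟩

/-- The index is positive on all edges. -/
def IsPositive (P : IndexedTree.{u}) : Prop := ∀ a b, P.tree.graph.Adj a b → 0 < P.wt a b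

theorem isPositive_of_isParent (h : ∀ a b, P.tree.IsParent a b → 0 < P.wt a b) :
    P.IsPositive := by
  intro a b hab
  rcases isParent_or_isParent hab with h' | h'
  · exact h a b h'
  · rw [wt_comm]
    exact h b a h'

theorem exists_joinStep (hP : P.IsReducible) (hpos : P.IsPositive) {c : P.tree.V}
    (hc : P.Joinable c) : ∃ Q, JoinStep P Q ∧ Q.IsReducible ∧ Q.IsPositive ∧
      Fintype.card Q.tree.V < Fintype.card P.tree.V := by
  classical
  have hcr : c ≠ P.tree.root := by
    rintro rfl
    exact hc.1 hP.root_black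
  obtain ⟨p, hpc⟩ := exists_isParent hcr
  have hcard : (P.tree.children c).card = 1 := by
    have := deg_eq (X := P.tree) c
    rw [hc.2, if_neg hcr] at this
    omega
  obtain ⟨d, hd⟩ := Finset.card_eq_one.1 hcard
  obtain ⟨Q, ι, hQ⟩ := exists_isDeletion hP.root_black hpc (fun h => absurd h hc.1) (Or.inr hcard)
  refine ⟨Q, ⟨c, hc, hQ.isJoin hpc hd hc.1⟩, hQ.isReducible hP hpc,
    isPositive_of_isParent fun a b hab => ?_, hQ.card_lt⟩
  rcases (hQ.isParent_iff a b).1 hab with h | ⟨h, h'⟩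
  · rw [hQ.wt_eq _ _ h]
    exact hpos _ _ h.adj
  · rw [hQ.wt_eq' _ _ h h']
    exact Nat.add_pos_left (hpos _ _ h.adj) _

theorem exists_joined (hP : P.IsReducible) (hpos : P.IsPositive) :
    ∃ Q, Relation.ReflTransGen JoinStep P Q ∧ (∀ c, ¬ Q.Joinable c) ∧ Q.IsReducible ∧
      Q.IsPositive := by
  induction hn : Fintype.card P.tree.V using Nat.strong_induction_on generalizing P with
  | _ n ih =>
    by_cases h : ∃ c, P.Joinable c
    · obtain ⟨c, h⟩ := h
      obtain ⟨Q, h1, h2, h3, h4⟩ := exists_joinStep hP hpos h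
      obtain ⟨R, h5, h6⟩ := ih _ (hn ▸ h4) h2 h3 rfl
      exact ⟨R, .head h1 h5, h6⟩
    · push Not at h
      exact ⟨P, .refl, h, hP, hpos⟩

/-! ### Insertion of a vertex -/

theorem exists_isInsertionAt (hroot : P.tree.root ∈ P.tree.black) {v : P.tree.V}
    (hch : ∃ c, P.tree.IsParent v c) (hv : v ∈ P.tree.black) :
    ∃ Q ι n, IsInsertionAt P Q v ι n := by
  classical
  have hex : ∀ v, ∃ q, v ≠ P.tree.root → P.tree.IsParent q v := fun v => by
    by_cases hv : v = P.tree.root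
    · exact ⟨v, fun h => absurd hv h⟩
    · obtain ⟨q, hq⟩ := exists_isParent hv
      exact ⟨q, fun _ => hq⟩
  choose par hpar using hex
  have hpar' : ∀ q v, P.tree.IsParent q v ↔ v ≠ P.tree.root ∧ par v = q := fun q v =>
    ⟨fun h => ⟨h.ne_root, (hpar v h.ne_root).unique h⟩, fun h => h.2 ▸ hpar v h.1⟩
  -- The new vertex is `none`, placed between `v` and its children.
  let par' : Option P.tree.V → Option P.tree.V
    | none => some v
    | some w => if par w = v then none else some (par w)
  obtain ⟨Q, e, e1, e2, e3, e4⟩ := exists_of_parent (V := Option P.tree.V)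
    (some P.tree.root) par'
    (fun w => w.elim (2 * P.tree.depth v + 1) fun w => 2 * P.tree.depth w)
    (fun w hw => by
      rcases w with _ | w
      · simp [par']
      · have hd := (hpar w fun h => hw (congrArg some h)).depth_eq
        by_cases h : par w = v
        · rw [h] at hd
          simp [par', h, hd]
          omega
        · simp [par', h, hd])
    (some '' P.tree.black) ⟨_, hroot, rfl⟩
    (fun w hw => by
      rcases w with _ | w
      · obtain ⟨c, hc⟩ := hch
        have hc' := (hpar' _ _).1 hc
        exact ⟨some c, by simpa using hc'.1, by simp [par', hc'.2]⟩
      · have hw' : w ∉ P.tree.black := fun h => hw ⟨w, h, rfl⟩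
        obtain ⟨c, hc⟩ := exists_child_of_white hroot hw'
        have hc' := (hpar' _ _).1 hc
        -- A white vertex is not `v`, so it keeps its children.
        have hne : w ≠ v := fun h => hw' (h ▸ hv)
        exact ⟨some c, by simpa using hc'.1, by simp [par', hc'.2, hne]⟩)
    (fun w => w.elim 0 fun w => P.wt (par w) w)
  have hwt : ∀ p w, w ≠ some P.tree.root → par' w = p →
      Q.wt (e p) (e w) = w.elim 0 fun w => P.wt (par w) w := fun p w hw h => by
    rw [← h, e4 w hw]
  refine ⟨Q, fun x => e (some x), e none, e.injective.comp (Option.some_injective _), ?_, e1,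
    ?_, ?_, ?_, ?_, ?_, ?_, ?_, ?_⟩
  · ext q
    obtain ⟨w, rfl⟩ := e.surjective q
    cases w <;> simp
  · intro x y
    rw [e2, hpar']
    by_cases h : par y = v
    · simp only [par', h, if_true]
      constructor
      · simp
      · rintro ⟨⟨-, rfl⟩, h⟩
        exact absurd rfl h
    · simp only [par', h, if_false, Option.some_inj, ne_eq]
      constructor
      · rintro ⟨h1, rfl⟩
        exact ⟨⟨h1, rfl⟩, h⟩
      · exact fun h => h.1
  · intro x
    rw [e2]
    simp [par', eq_comm]
  · intro x
    rw [e2, hpar']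
    by_cases h : par x = v <;> simp [par', h]
  · intro x y h hx
    have h' := (hpar' _ _).1 h
    rw [hwt _ _ (by simpa using h'.1) (by simp [par', h'.2, hx])]
    simp [h'.2]
  · rw [hwt _ _ (by simp) (by simp [par'])]
    rfl
  · intro y h
    have h' := (hpar' _ _).1 h
    rw [hwt _ _ (by simpa using h'.1) (by simp [par', h'.2])]
    simp [h'.2]
  · intro x
    rw [e3]
    simp
  · rw [e3]
    simp

/-- Invariants of the insertions of vertices. -/
structure IsPreharvestable (P : IndexedTree.{u}) : Prop where
  root_black : P.tree.root ∈ P.tree.black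
  exists_ne_root : ∃ b, b ≠ P.tree.root
  white_branched : ∀ v, v ∉ P.tree.black → 3 ≤ P.tree.deg v
  of_wt_eq_zero : ∀ p c, P.tree.IsParent p c → P.wt p c = 0 →
    p ∈ P.tree.black ∧ c ∉ P.tree.black ∧ (P.tree.children p).card = 1

namespace IsInsertionAt

variable {v : P.tree.V} {ι : P.tree.V → Q.tree.V} {n : Q.tree.V}

theorem isInsertion (h : IsInsertionAt P Q v ι n) : IsInsertion P Q v := by
  refine ⟨ι, n, h.injective, h.range_eq, fun x y => ?_, fun x => ?_, h.map_root, h.new_white,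
    h.black_iff, fun x y hxy hxy' => ?_, fun hv => ?_, fun w hw hw' => ?_⟩
  · rw [adj_iff_isParent, adj_iff_isParent, h.isParent_iff, h.isParent_iff]
    constructor
    · rintro (⟨h1, h2⟩ | ⟨h1, h2⟩)
      · exact ⟨Or.inl h1, fun h => h2 h.1, fun ⟨h3, h4⟩ => h1.asymm (h3 ▸ h4)⟩
      · exact ⟨Or.inr h1, fun ⟨h3, h4⟩ => h1.asymm (h3 ▸ h4), fun h => h2 h.1⟩
    · rintro ⟨h1 | h1, h2, h3⟩
      · exact Or.inl ⟨h1, fun hx => h2 ⟨hx, hx ▸ h1⟩⟩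
      · exact Or.inr ⟨h1, fun hy => h3 ⟨hy, hy ▸ h1⟩⟩
  · rw [adj_iff_isParent, h.isParent_new, h.new_isParent, or_comm]
  · rw [← wt_of_adj hxy, ← wt_of_adj hxy']
    rcases isParent_or_isParent hxy' with h1 | h1
    · obtain ⟨h2, h3⟩ := (h.isParent_iff _ _).1 h1
      exact h.wt_eq _ _ h2 h3
    · obtain ⟨h2, h3⟩ := (h.isParent_iff _ _).1 h1
      rw [wt_comm, h.wt_eq _ _ h2 h3, wt_comm]
  · rw [← wt_of_adj, wt_comm, h.wt_new]
  · rw [← wt_of_adj, ← wt_of_adj, h.wt_new' _ hw]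

theorem root_iff (h : IsInsertionAt P Q v ι n) (x : P.tree.V) :
    ι x = Q.tree.root ↔ x = P.tree.root := by
  rw [← h.map_root]
  exact h.injective.eq_iff

theorem deg_of_ne (h : IsInsertionAt P Q v ι n) {x : P.tree.V} (hx : x ≠ v) :
    Q.tree.deg (ι x) = P.tree.deg x := by
  classical
  rw [deg_eq, deg_eq, h.children_of_ne hx, Finset.card_map]
  simp only [h.root_iff]

open Classical in
theorem deg_self (h : IsInsertionAt P Q v ι n) :
    Q.tree.deg (ι v) = if v = P.tree.root then 1 else 2 := by
  rw [deg_eq, h.children_self, Finset.card_singleton]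
  simp only [h.root_iff]
  split_ifs <;> rfl

theorem deg_new (h : IsInsertionAt P Q v ι n) :
    Q.tree.deg n = (P.tree.children v).card + 1 := by
  classical
  rw [deg_eq, h.children_new, Finset.card_map, if_neg]
  rw [← h.map_root]
  exact (h.ne_new _).symm

theorem splittable (h : IsInsertionAt P Q v ι n) {q : Q.tree.V} (hq : Q.Splittable q) :
    ∃ x, ι x = q ∧ x ≠ v ∧ P.Splittable x := by
  obtain ⟨h1, h2, h3⟩ := hq
  obtain ⟨x, rfl⟩ := h.exists_eq (q := q) (by rintro rfl; exact h.new_white h1)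
  have hx : x ≠ v := by
    rintro rfl
    rw [h.deg_self] at h3
    split_ifs at h3 <;> omega
  refine ⟨x, rfl, hx, (h.black_iff x).1 h1, fun hr => h2 ((h.root_iff x).2 hr), ?_⟩
  rwa [← h.deg_of_ne hx]

/-- The only new edge of index zero leads from the black `v` to its now single child `n`. Since `v`
had at least two children, none of them was attached by index zero, and `n` has degree at least
three. -/
theorem isPreharvestable (h : IsInsertionAt P Q v ι n) (hP : P.IsPreharvestable)
    (hv : v ∈ P.tree.black) (hch : 2 ≤ (P.tree.children v).card) : Q.IsPreharvestable where
  root_black := by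
    rw [← h.map_root, h.black_iff]
    exact hP.root_black
  exists_ne_root := by
    obtain ⟨b, hb⟩ := hP.exists_ne_root
    exact ⟨ι b, fun hb' => hb ((h.root_iff b).1 hb')⟩
  white_branched q hq := by
    by_cases hqn : q = n
    · subst hqn
      rw [h.deg_new]
      omega
    · obtain ⟨x, rfl⟩ := h.exists_eq hqn
      rw [h.black_iff] at hq
      rw [h.deg_of_ne (by rintro rfl; exact hq hv)]
      exact hP.white_branched x hq
  of_wt_eq_zero p c hpc h0 := by
    by_cases hp : p = n
    · subst hp
      obtain ⟨y, rfl⟩ := h.exists_eq hpc.adj.ne'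
      rw [h.new_isParent] at hpc
      rw [h.wt_new' y hpc] at h0
      have := (hP.of_wt_eq_zero v y hpc h0).2.2
      omega
    · obtain ⟨x, rfl⟩ := h.exists_eq hp
      by_cases hc : c = n
      · subst hc
        rw [h.isParent_new] at hpc
        subst hpc
        exact ⟨(h.black_iff x).2 hv, h.new_white, by rw [h.children_self, Finset.card_singleton]⟩
      · obtain ⟨y, rfl⟩ := h.exists_eq hc
        obtain ⟨h1, h2⟩ := (h.isParent_iff x y).1 hpc
        rw [h.wt_eq x y h1 h2] at h0
        rw [h.black_iff, h.black_iff, h.children_of_ne h2, Finset.card_map]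
        exact hP.of_wt_eq_zero x y h1 h0

end IsInsertionAt

/-- An insertion at `v` leaves `v` with degree two, adds a white vertex and keeps the other degrees,
so the number of splittable vertices drops. -/
theorem exists_inserted (hP : P.IsPreharvestable) :
    ∃ Q, Relation.ReflTransGen InsertStep P Q ∧ (∀ v, ¬ Q.Splittable v) ∧
      Q.IsPreharvestable := by
  classical
  induction hn : (Finset.univ.filter P.Splittable).card using Nat.strong_induction_on
    generalizing P with
  | _ n ih =>
    by_cases h : ∃ v, P.Splittable v
    · obtain ⟨v, hv⟩ := h
      have hch : 2 ≤ (P.tree.children v).card := by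
        have h1 := hv.2.2
        rw [deg_eq, if_neg hv.2.1] at h1
        omega
      obtain ⟨c, hc⟩ := Finset.card_pos.1 (show 0 < (P.tree.children v).card by omega)
      obtain ⟨Q, ι, m, hQ⟩ := exists_isInsertionAt hP.root_black ⟨c, mem_children.1 hc⟩ hv.1
      have hlt : (Finset.univ.filter Q.Splittable).card < n := by
        have hsub : Finset.univ.filter Q.Splittable
            ⊆ ((Finset.univ.filter P.Splittable).erase v).image ι := by
          intro q hq
          obtain ⟨x, hx, hxv, hxs⟩ := hQ.splittable (Finset.mem_filter.1 hq).2
          exact Finset.mem_image.2 ⟨x, by simp [hxv, hxs], hx⟩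
        refine ((Finset.card_le_card hsub).trans Finset.card_image_le).trans_lt ?_
        rw [← hn]
        exact Finset.card_erase_lt_of_mem (by simp [hv])
      obtain ⟨R, h1, h2⟩ := ih _ hlt (hQ.isPreharvestable hP hv.1 hch) rfl
      exact ⟨R, .head ⟨v, hv, hQ.isInsertion⟩ h1, h2⟩
    · push Not at h
      exact ⟨P, .refl, h, hP⟩

theorem IsPreharvestable.isHarvestable (hP : P.IsPreharvestable) (h : ∀ v, ¬ P.Splittable v)
    (hroot : P.tree.deg P.tree.root = 1) : P.IsHarvestable where
  root_terminal := hroot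
  white_branched := hP.white_branched
  black_not_branched v hv h3 := by
    refine h v ⟨hv, ?_, h3⟩
    rintro rfl
    omega
  pos_of_white_parent v w hvw hv := by
    rw [← wt_of_adj]
    exact Nat.pos_of_ne_zero fun h0 => hv (hP.of_wt_eq_zero v w hvw h0).1
  pos_of_black v w hvw hv hw := by
    rw [← wt_of_adj hvw]
    refine Nat.pos_of_ne_zero fun h0 => ?_
    rcases isParent_or_isParent hvw with h1 | h1
    · exact (hP.of_wt_eq_zero v w h1 h0).2.1 hw
    · exact (hP.of_wt_eq_zero w v h1 (by rw [wt_comm, h0])).2.1 hv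

theorem exists_child_root (h : ∃ b, b ≠ P.tree.root) : ∃ c, P.tree.IsParent P.tree.root c := by
  by_contra! hc
  obtain ⟨b, hb⟩ := h
  refine hb (parent_induction (p := fun v => v = P.tree.root) rfl ?_ b)
  rintro _ w hw rfl
  exact absurd hw (hc w)

/-- A pair with black root and essentially positive index has a harvestable form that is a
harvestable pair, unless the root is the only black vertex. -/
theorem IsReducible.exists_isHarvestableForm (hP : P.IsReducible) :
    ∃ Q, IsHarvestableForm P Q ∧ Q.IsHarvestable := by
  classical
  obtain ⟨P₁, h1, h1', hP₁⟩ := exists_contracted hP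
  obtain ⟨P₂, h2, h2', hP₂, hpos⟩ := exists_joined hP₁
    fun a b hab => hP₁.zeroSeparated.wt_pos hab (h1' a b) (h1' b a)
  -- No index zero is left after the contractions. A white vertex has a parent and a child, and the
  -- joins exclude degree two.
  have hP₂' : P₂.IsPreharvestable := by
    refine ⟨hP₂.root_black, ?_, fun v hv => ?_, fun p c hpc h0 => ?_⟩
    · obtain ⟨b, -, hb⟩ := hP₂.exists_black
      exact ⟨b, hb⟩
    · obtain ⟨c, hc⟩ := exists_child_of_white hP₂.root_black hv
      have e1 := deg_eq (X := P₂.tree) v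
      rw [if_neg fun h : v = P₂.tree.root => hv (h ▸ hP₂.root_black)] at e1
      have e2 := Finset.card_pos.2 ⟨c, mem_children.2 hc⟩
      have e3 : P₂.tree.deg v ≠ 2 := fun h => h2' v ⟨hv, h⟩
      omega
    · exact absurd h0 (hpos p c hpc.adj).ne'
  obtain ⟨P₃, h3, h3', hP₃⟩ := exists_inserted hP₂'
  by_cases hdeg : P₃.tree.deg P₃.tree.root = 1
  · exact ⟨P₃, ⟨P₁, P₂, P₃, ⟨h1, h1'⟩, ⟨h2, h2'⟩, ⟨h3, h3'⟩, Or.inl ⟨hdeg, rfl⟩⟩,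
      hP₃.isHarvestable h3' hdeg⟩
  · obtain ⟨c, hc⟩ := exists_child_root hP₃.exists_ne_root
    -- The root has no parent, so its degree, which is neither zero nor one, counts its children.
    have hch : 2 ≤ (P₃.tree.children P₃.tree.root).card := by
      have e1 := deg_eq (X := P₃.tree) P₃.tree.root
      rw [if_pos rfl] at e1
      have e2 := Finset.card_pos.2 ⟨c, mem_children.2 hc⟩
      omega
    obtain ⟨Q, ι, n, hQ⟩ := exists_isInsertionAt hP₃.root_black ⟨c, hc⟩ hP₃.root_black
    refine ⟨Q, ⟨P₁, P₂, P₃, ⟨h1, h1'⟩, ⟨h2, h2'⟩, ⟨h3, h3'⟩, Or.inr ⟨hdeg, hQ.isInsertion⟩⟩, ?_⟩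
    refine (hQ.isPreharvestable hP₃ hP₃.root_black hch).isHarvestable (fun q hq => ?_) ?_
    · obtain ⟨x, -, -, hx⟩ := hQ.splittable hq
      exact h3' x hx
    · rw [← hQ.map_root, hQ.deg_self, if_pos rfl]

end IndexedTree
end

/-! ### The proposition -/

theorem proposition3p10 (X : TwoColoredRootedTree.{u}) (k : X.Index)
    (hroot : X.root ∈ X.black) (hk : X.EssentiallyPositive k)
    -- `V = V₁ ⊔ V₂`, `E = E₁ ⊔ E₂ ⊔ {f}`, `V_• = B₁ ⊔ B₂`
    (V₁ V₂ B₁ B₂ : Set X.V) (E₁ E₂ : Set (Sym2 X.V)) (f : X.graph.edgeSet)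
    (hV : V₁ ∪ V₂ = Set.univ) (hVd : Disjoint V₁ V₂)
    (hE : E₁ ∪ E₂ ∪ {(f : Sym2 X.V)} = X.graph.edgeSet) (hEd : Disjoint E₁ E₂)
    (hf₁ : (f : Sym2 X.V) ∉ E₁) (hf₂ : (f : Sym2 X.V) ∉ E₂)
    (hB : B₁ ∪ B₂ = X.black) (hB₁ : B₁ ⊆ V₁) (hB₂ : B₂ ⊆ V₂)
    -- the edges in `Eᵢ` have their ends in `Vᵢ`
    (hE₁ : ∀ e ∈ E₁, ∀ v ∈ e, v ∈ V₁) (hE₂ : ∀ e ∈ E₂, ∀ v ∈ e, v ∈ V₂)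
    -- `F : (V₁, E₁, rt) → (V₂, E₂, F(rt))` is an isomorphism of rooted trees respecting the colors
    (hroot₁ : X.root ∈ B₁) (F : V₁ ≃ V₂)
    (hFE : ∀ a b : V₁, s((a : X.V), (b : X.V)) ∈ E₁ ↔ s((F a : X.V), (F b : X.V)) ∈ E₂)
    (hFB : ∀ v : V₁, (v : X.V) ∈ B₁ ↔ (F v : X.V) ∈ B₂)
    -- `f` joins a vertex to its image
    (hfF : ∃ v : V₁, (f : Sym2 X.V) = s((v : X.V), (F v : X.V)))
    -- `k_f` is odd, and `F` respects the index
    (hodd : Odd (k f))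
    (hkF : ∀ (a b : V₁) (h : X.graph.Adj a b) (h' : X.graph.Adj (F a) (F b)),
      k ⟨s((a : X.V), (b : X.V)), h⟩ = k ⟨s((F a : X.V), (F b : X.V)), h'⟩) :
    -- `Φ(X, k) = 0`
    PhiMap (AdmissiblePair.toTwoCRT ⟨⟨X, k⟩, hroot, hk⟩) = 0 ∧
    -- `(X, k)` has a harvestable form, and `φ(w(X_h, k_h)) = 0`
    (∃ Y : HarvestablePair.{u}, IndexedTree.IsHarvestableForm ⟨X, k⟩ Y.1) ∧
    ∀ Y : HarvestablePair.{u}, IndexedTree.IsHarvestableForm ⟨X, k⟩ Y.1 →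
      HAlg.phi Y.w = 0 := by
  have hZ : (⟨X, k⟩ : IndexedTree.{u}).ZeroSeparated :=
    IndexedTree.zeroSeparated_of_essentiallyPositive hk
  obtain ⟨σ, hσ⟩ := IndexedTree.exists_isMirror ⟨X, k⟩ f hV hVd hE hB hB₁ hB₂ hE₁ hE₂ F hFE hFB hfF
    hodd fun a b h h' => by
      rw [IndexedTree.wt_of_adj h, IndexedTree.wt_of_adj h']
      exact hkF a b h h'
  refine ⟨IndexedTree.IsMirror.phiMap_eq_zero hσ, ?_, fun Y hY => ?_⟩
  · have hred : (⟨X, k⟩ : IndexedTree.{u}).IsReducible := by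
      -- The image of the root is a second black vertex, so the harvestable form does not shrink to
      -- a point.
      let r : V₁ := ⟨X.root, hB₁ hroot₁⟩
      refine ⟨hroot, hZ, (F r : X.V), ?_, fun h => ?_⟩
      · exact hB ▸ Or.inr ((hFB r).1 hroot₁)
      · exact Set.disjoint_left.1 hVd (hB₁ hroot₁) (h ▸ (F r).2)
    obtain ⟨Q, hQ, hQ'⟩ := hred.exists_isHarvestableForm
    exact ⟨⟨Q, hQ'⟩, hQ⟩
  · refine Subtype.ext ?_
    rw [Y.phi_w, hY.value_root_eq]
    exact hσ.cut_value_root hZ hroot
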